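/- Let $s\in\mathbb N$, $s\ge 1$, and $T,L>0$. Let $\mathbf s=(s_0,s_1,s_2,s_3):\mathbb R\to\mathbb R^4$ be smooth with $\|\mathbf s\|_{L^\infty}+\|\mathbf s'\|_{H^s(\mathbb R,\mathbb R^4)}<\infty$, let $\gamma$ be a Hermitian $2\times2$ matrix and let $g\in C^\infty(\mathbb R,\mathbb R)$. Write $\sigma_0,\dots,\sigma_3$ for the Pauli matrices ($\sigma_0$ the identity), $\mathbf s\cdot\sigma=\sum_{\alpha=0}^3 s_\alpha\sigma_\alpha$, $\langle z,w\rangle=\sum_{j=1,2}z_j\bar w_j$ on $\mathbb C^2$, $H^k=H^k(\mathbb R,\mathbb C^2)$ and $\|u\|_{H^k}^2=\sum_{j=0}^k\|\partial_x^ju\|_{L^2}^2$. *Nonlinear Dirac equation.* For $a\in H^s$ let $U_{\rm Dirac}(\cdot)a\in C([0,T],H^s)$ denote the solution $u$ (if it exists) of $$i\partial_tu=-i\sigma_3\partial_xu+\mathbf s\cdot\sigma\,u+g(\langle u,\gamma u\rangle)\gamma u,\qquad u(0)=a,$$ the equation being understood in $L^2$. The pair $(T,L)$ satisfies $(\mathrm{Lip})_s$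 if there is $C>0$ such that for all $a,b\in H^s$ with $\|a\|_{H^s},\|b\|_{H^s}\le L$ the solutions $U_{\rm Dirac}(\cdot)a,\,U_{\rm Dirac}(\cdot)b\in C([0,T],H^s)$ exist and $\sup_{0\le t\le T}\|U_{\rm Dirac}(t)a-U_{\rm Dirac}(t)b\|_{H^s}\le C\|a-b\|_{H^s}$. *Nonlinear quantum walk.* For $\delta>0$ and $v=(v_1,v_2)\in\ell^2(\delta\mathbb Z,\mathbb C^2)$ put, for $x\in\delta\mathbb Z$, $$(S_\delta v)(x)=(v_1(x-\delta),v_2(x+\delta)),\quad (C_\delta v)(x)=e^{-i\delta\,\mathbf s(x)\cdot\sigma}v(x),\quad (N_\delta v)(x)=e^{-i\delta g(\langle v(x),\gamma v(x)\rangle)\gamma}v(x),$$ and let $\mathcal U_\delta(m)=(S_\delta C_\delta N_\delta)^m$ be the $m$-fold iterate of $S_\delta\circ C_\delta\circ N_\delta$. *Interpolation.* Let $F$ be the unitary Fourier transform $Fu(\xi)=\frac1{\sqrt{2\pi}}\int_{\mathbb R}e^{-ix\xi}u(x)\,dx$ on $L^2(\mathbb R,\mathbb C^2)$, let $j_\delta=F^{-1}\chi_{[-\pi/\delta,\pi/\delta]}F$,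 and let $\mathfrak I_\delta:\ell^2(\delta\mathbb Z,\mathbb C^2)\to L^2(\mathbb R,\mathbb C^2)$ be Shannon interpolation, $F(\mathfrak I_\delta v)(\xi)=\chi_{[-\pi/\delta,\pi/\delta]}(\xi)\frac{\delta}{\sqrt{2\pi}}\sum_{x\in\delta\mathbb Z}e^{-ix\xi}v(x)$, which is a bijection onto the range of $j_\delta$. Assume that $(T,L)$ satisfies $(\mathrm{Lip})_s$. Then there are $C>0$ and $\delta_0>0$ such that for every $u_0\in H^{s+1}$ with $\|u_0\|_{H^{s+1}}\le L$ and every $\delta\in(0,\delta_0]$, $$\sup_{m\in\mathbb Z,\ 0\le m\delta\le T}\big\|\mathfrak I_\delta\,\mathcal U_\delta(m)\,\mathfrak I_\delta^{-1}j_\delta u_0-U_{\rm Dirac}(m\delta)u_0\big\|_{H^s}\le C\,\delta .$$ Here $C$ and $\delta_0$ may depend on $s,T,L,\mathbf s,\gamma,g$, but not on $u_0$, $\delta$ or $m$. -/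

import Mathlib

open MeasureTheory Filter Topology
open scoped FourierTransform SchwartzMap LineDeriv ENNReal ContDiff Matrix

namespace NLQW

noncomputable section

/-- `ℂ²` with its Euclidean norm. -/
abbrev C2 : Type := EuclideanSpace ℂ (Fin 2)

/-- `2 × 2` complex matrices. -/
abbrev Mat2 : Type := Matrix (Fin 2) (Fin 2) ℂ

/-- `L²(ℝ, ℂ²)`. -/
abbrev L2 : Type := Lp C2 2 (volume : Measure ℝ)

/-- The lattice space `ℓ²(δℤ, ℂ²)`. A function on `δℤ` is written as a function of `n : ℤ`, its
value at the site `x = δ n` being the value at `n`. (The norm on `δℤ` is `√δ` times the norm here;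
only membership in the space is used.) -/
abbrev Lattice : Type := lp (fun _ : ℤ => C2) 2

/-- The action of a matrix on `ℂ²`. -/
def act (M : Mat2) (z : C2) : C2 := Matrix.toEuclideanCLM (n := Fin 2) (𝕜 := ℂ) M z

/-! ### Sobolev spaces -/

/-- `v ∈ L²` is the distributional derivative of `u ∈ L²`. -/
def IsWeakDeriv (u v : L2) : Prop :=
  ∂_{(1 : ℝ)} (u : 𝓢'(ℝ, C2)) = (v : 𝓢'(ℝ, C2))

open Classical in
/-- The distributional derivative of `u` if it belongs to `L²` (and `0` otherwise). -/
def weakDeriv (u : L2) : L2 := if h : ∃ v, IsWeakDeriv u v then h.choose else 0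

/-- `u ∈ H^k(ℝ, ℂ²)`: the distributional derivatives up to order `k` belong to `L²`. -/
def MemH : ℕ → L2 → Prop
  | 0, _ => True
  | k + 1, u => ∃ v, IsWeakDeriv u v ∧ MemH k v

/-- `‖u‖_{H^k} = (∑_{j ≤ k} ‖∂ₓʲ u‖²_{L²})^{1/2}`, meaningful for `u ∈ H^k`. -/
def normH (k : ℕ) (u : L2) : ℝ :=
  Real.sqrt (∑ j ∈ Finset.range (k + 1), ‖weakDeriv^[j] u‖ ^ 2)

/-! ### Coins and the nonlinear quantum walk -/

/-- The Pauli matrices `σ₀, σ₁, σ₂, σ₃`. -/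
def pauli : Fin 4 → Mat2 :=
  ![!![1, 0; 0, 1], !![0, 1; 1, 0], !![0, -Complex.I; Complex.I, 0], !![1, 0; 0, -1]]

/-- `p · σ = ∑_α p_α σ_α` for `p ∈ ℝ⁴`. -/
def pauliComb (p : EuclideanSpace ℝ (Fin 4)) : Mat2 := ∑ α, (p α : ℂ) • pauli α

/-- The real number `⟨z, γ z⟩_{ℂ²}` (`γ` Hermitian), where `⟨u, v⟩ = ∑ⱼ uⱼ v̄ⱼ`. -/
def quad (γ : Mat2) (z : C2) : ℝ := (∑ j, z j * star (act γ z j)).re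

/-- `e^{-i t M}`. -/
def expI (t : ℝ) (M : Mat2) : Mat2 := NormedSpace.exp ((-(Complex.I * (t : ℂ))) • M)

theorem norm_act_expI (t : ℝ) {M : Mat2} (hM : M.IsHermitian) (z : C2) :
    ‖act (expI t M) z‖ = ‖z‖ := by
  have h1 : (expI t M)ᴴ * expI t M = 1 := by
    unfold expI
    rw [← Matrix.exp_conjTranspose, Matrix.conjTranspose_smul, hM.eq,
      ← Matrix.exp_add_of_commute _ _ ((Commute.refl M).smul_left _ |>.smul_right _), ← add_smul]
    simp
  have h2 : ContinuousLinearMap.adjoint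
        (Matrix.toEuclideanCLM (n := Fin 2) (𝕜 := ℂ) (expI t M)) ∘L
      (Matrix.toEuclideanCLM (n := Fin 2) (𝕜 := ℂ) (expI t M)) = 1 := by
    rw [← ContinuousLinearMap.star_eq_adjoint, ← map_star, ← ContinuousLinearMap.mul_def,
      ← map_mul, Matrix.star_eq_conjTranspose, h1, map_one]
  exact (ContinuousLinearMap.norm_map_iff_adjoint_comp_self _).2 h2 z

theorem isHermitian_pauliComb (p : EuclideanSpace ℝ (Fin 4)) : (pauliComb p).IsHermitian := by
  ext i j
  fin_cases i <;> fin_cases j <;>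
    simp [pauliComb, pauli, Fin.sum_univ_four, Matrix.conjTranspose_apply]

theorem isHermitian_smul {γ : Mat2} (hγ : γ.IsHermitian) (r : ℝ) : ((r : ℂ) • γ).IsHermitian := by
  rw [Matrix.IsHermitian, Matrix.conjTranspose_smul, hγ.eq]
  simp

theorem memℓp_of_norm_le {f h : ℤ → C2} (hh : Memℓp h 2) (hf : ∀ n, ‖f n‖ ≤ ‖h n‖) :
    Memℓp f 2 := by
  refine memℓp_gen (Summable.of_nonneg_of_le (fun n => by positivity) (fun n => ?_)
    (hh.summable (by norm_num)))
  exact Real.rpow_le_rpow (norm_nonneg _) (hf n) (by norm_num)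

theorem memℓp_comp {h : ℤ → C2} (hh : Memℓp h 2) (e : ℤ ≃ ℤ) : Memℓp (fun n => h (e n)) 2 :=
  memℓp_gen ((e.summable_iff (f := fun n => ‖h n‖ ^ (2 : ℝ≥0∞).toReal)).2
    (hh.summable (by norm_num)))

theorem memℓp_shift (v : Lattice) : Memℓp (fun n : ℤ => (!₂[v (n - 1) 0, v (n + 1) 1] : C2)) 2 := by
  have hA : Memℓp (fun n : ℤ => (!₂[v (n - 1) 0, 0] : C2)) 2 := by
    refine memℓp_of_norm_le (memℓp_comp (lp.memℓp v) (Equiv.subRight 1)) fun n => ?_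
    simpa [EuclideanSpace.norm_eq] using Real.sqrt_le_sqrt
      (show ‖v (n - 1) 0‖ ^ 2 ≤ ‖v (n - 1) 0‖ ^ 2 + ‖v (n - 1) 1‖ ^ 2 by nlinarith [sq_nonneg ‖v (n - 1) 1‖])
  have hB : Memℓp (fun n : ℤ => (!₂[0, v (n + 1) 1] : C2)) 2 := by
    refine memℓp_of_norm_le (memℓp_comp (lp.memℓp v) (Equiv.addRight 1)) fun n => ?_
    simpa [EuclideanSpace.norm_eq] using Real.sqrt_le_sqrt
      (show ‖v (n + 1) 1‖ ^ 2 ≤ ‖v (n + 1) 0‖ ^ 2 + ‖v (n + 1) 1‖ ^ 2 by nlinarith [sq_nonneg ‖v (n + 1) 0‖])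
  convert hA.add hB using 1
  ext n i
  fin_cases i <;> simp

/-- The shift: the first component moves by `+δ`, the second by `-δ`. -/
def shift (v : Lattice) : Lattice := ⟨fun n => !₂[v (n - 1) 0, v (n + 1) 1], memℓp_shift v⟩

/-- The linear coin `(C v)(x) = e^{-iδ p(x)·σ} v(x)`, `x = δ n`. -/
def coin (δ : ℝ) (p : ℝ → EuclideanSpace ℝ (Fin 4)) (v : Lattice) : Lattice :=
  ⟨fun n => act (expI δ (pauliComb (p (δ * n)))) (v n),
    memℓp_of_norm_le (lp.memℓp v) fun n => (norm_act_expI δ (isHermitian_pauliComb _) (v n)).le⟩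

/-- The nonlinear coin `(N v)(x) = e^{-iδ g(⟨v(x), γ v(x)⟩) γ} v(x)`. -/
def nonlinearCoin (δ : ℝ) (γ : Mat2) (hγ : γ.IsHermitian) (g : ℝ → ℝ) (v : Lattice) : Lattice :=
  ⟨fun n => act (expI δ ((g (quad γ (v n)) : ℂ) • γ)) (v n),
    memℓp_of_norm_le (lp.memℓp v) fun n => (norm_act_expI δ (isHermitian_smul hγ _) (v n)).le⟩

/-- `m` steps of the nonlinear quantum walk, each step being shift ∘ coin ∘ nonlinear coin. -/
def walk (δ : ℝ) (p : ℝ → EuclideanSpace ℝ (Fin 4)) (γ : Mat2) (hγ : γ.IsHermitian) (g : ℝ → ℝ)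
    (m : ℕ) (v : Lattice) : Lattice :=
  (fun w => shift (coin δ p (nonlinearCoin δ γ hγ g w)))^[m] v

/-! ### Band limiting and Shannon interpolation

The Fourier transform `𝓕` on `L²` is Mathlib's, with kernel `e^{-2πi x ξ}`. With this
normalization the frequency band `[-π/δ, π/δ]` reads `[-1/(2δ), 1/(2δ)]`. -/

/-- The frequency band. -/
def band (δ : ℝ) : Set ℝ := Set.Icc (-(1 / (2 * δ))) (1 / (2 * δ))

theorem measurableSet_band (δ : ℝ) : MeasurableSet (band δ) := measurableSet_Icc

/-- The band-limiting projection `j_δ = 𝓕⁻¹ χ_{band} 𝓕`. -/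
def bandLimit (δ : ℝ) (u : L2) : L2 :=
  𝓕⁻ (((Lp.memLp (𝓕 u : L2)).indicator (measurableSet_band δ)).toLp)

/-- `ξ ↦ χ_{band}(ξ) δ e^{-2πi δ n ξ} c`, the contribution of the site `x = δ n` carrying the
value `c` to the lattice Fourier series. -/
def bandWaveFun (δ : ℝ) (n : ℤ) (c : C2) : ℝ → C2 :=
  (band δ).indicator fun ξ =>
    ((δ : ℂ) * Complex.exp (-(2 * Real.pi * (δ * n) * ξ : ℝ) * Complex.I)) • c

theorem memLp_bandWaveFun (δ : ℝ) (n : ℤ) (c : C2) :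
    MemLp (bandWaveFun δ n c) 2 (volume : Measure ℝ) := by
  unfold bandWaveFun
  rw [memLp_indicator_iff_restrict (measurableSet_band δ)]
  have : IsFiniteMeasure ((volume : Measure ℝ).restrict (band δ)) :=
    ⟨by simp [band]⟩
  refine MemLp.of_bound (C := |δ| * ‖c‖) ?_ (ae_of_all _ fun ξ => ?_)
  · exact Continuous.aestronglyMeasurable (by fun_prop)
  · rw [norm_smul, norm_mul, Complex.norm_real, ← Complex.ofReal_neg,
      Complex.norm_exp_ofReal_mul_I, mul_one, Real.norm_eq_abs]

/-- The lattice Fourier transform `ξ ↦ δ ∑_{x ∈ δℤ} e^{-2πi x ξ} v(x)` (convergent in `L²` of the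
band), extended by zero outside the band. -/
def latticeFourier (δ : ℝ) (v : Lattice) : L2 :=
  ∑' n : ℤ, (memLp_bandWaveFun δ n (v n)).toLp

/-- Shannon interpolation `𝔍_δ : ℓ²(δℤ, ℂ²) → L²(ℝ, ℂ²)`. -/
def shannon (δ : ℝ) (v : Lattice) : L2 := 𝓕⁻ (latticeFourier δ v)

/-- The inverse of Shannon interpolation (a bijection onto the band-limited functions). -/
def shannonInv (δ : ℝ) : L2 → Lattice := Function.invFun (shannon δ)

/-! ### The nonlinear Dirac equation -/

/-- `u ∈ C([0,T], H^k)` solves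
`i ∂ₜ u = -i σ₃ ∂ₓ u + p·σ u + g(⟨u, γ u⟩) γ u`, `u(0) = a`.
For `k ≥ 1` the right hand side is a continuous function of time with values in `L²`, so the
equation is understood in `L²`. -/
structure IsDiracSolution (k : ℕ) (p : ℝ → EuclideanSpace ℝ (Fin 4)) (γ : Mat2) (g : ℝ → ℝ)
    (T : ℝ) (a : L2) (u : ℝ → L2) : Prop where
  initial : u 0 = a
  mem : ∀ t ∈ Set.Icc 0 T, MemH k (u t)
  cont : ∀ t ∈ Set.Icc 0 T,
    Tendsto (fun τ => normH k (u τ - u t)) (𝓝[Set.Icc 0 T] t) (𝓝 0)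
  eqn : ∀ t ∈ Set.Icc 0 T, ∃ d : L2, HasDerivWithinAt u d (Set.Icc 0 T) t ∧
    ∀ᵐ x ∂(volume : Measure ℝ),
      Complex.I • d x = -(Complex.I • act (pauli 3) (weakDeriv (u t) x))
        + act (pauliComb (p x)) (u t x)
        + (g (quad γ (u t x)) : ℂ) • act γ (u t x)

/-- The uniform Lipschitz well-posedness condition for `(T, L)` in `H^k`: the Dirac equation has a
solution flow `a ↦ U(·) a ∈ C([0,T], H^k)` on the ball of radius `L` of `H^k`, which is Lipschitz in
`H^k` uniformly on `[0,T]`. -/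
def LipCondition (k : ℕ) (p : ℝ → EuclideanSpace ℝ (Fin 4)) (γ : Mat2) (g : ℝ → ℝ)
    (T L : ℝ) : Prop :=
  ∃ C : ℝ, 0 < C ∧ ∃ U : ℝ → L2 → L2,
    (∀ a, MemH k a → normH k a ≤ L → IsDiracSolution k p γ g T a (fun t => U t a)) ∧
    ∀ a b, MemH k a → normH k a ≤ L → MemH k b → normH k b ≤ L →
      ∀ t ∈ Set.Icc 0 T, normH k (U t a - U t b) ≤ C * normH k (a - b)

end

end NLQW

open NLQW

/-! On band-limited interpolants the lattice shift is exactly the free group e^{-δσ₃∂ₓ}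
(`shannon_shift`), and the two coins together act at each site as z ↦ z + δ K((δ, p(x)), z), where K
is smooth and K at parameter 0 is -i times the zeroth-order part of the Dirac equation
(`exists_isGenerator`). One step of the walk is therefore an exponential Euler step, v ↦
e^{-δσ₃∂ₓ}(v + δ 𝔍K(v)). Comparing it with Duhamel's formula (`duhamel_estimate`) turns an H^s error
ε into at most ε + Cδ(ε + δ(1 + r)), with r the H^{s+1} size of v, and a discrete Gronwall argument
sums these up to O(δ).

The hypothesis bounds the exact solution u only in H^s, so every lost derivative must fall on the
walk. This happens when v or its increment is moved along the free group and when the increment is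
sampled. The walk can bear it: superposition estimates are tame (`exists_sobolevBound_tame`), so
while the H^s norm stays in a fixed ball, the H^{s+1} norm r grows to at most r + Cδ(1 + r) per step
(`IsGenerator.exists_step_error`). The ball is never left, because for small δ the error itself
keeps the walk within distance 1 of u; this bootstrap is `IsGenerator.exists_error_bound`.

Nonlinear estimates come from Hadamard's lemma, which writes the increment of a smooth map as a
smooth coefficient times the increment of its argument. They are proved for smooth functions with
classical derivatives (`SobolevBound`, `CoeffBound`), whereas the free group and the interpolation
are handled by a Fourier weight (`SobolevLE`). Band-limited functions are smooth, so the two scales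
can be exchanged there, and general functions follow by approximation. Sampling is stable
(`SobolevBound.sobolevLE_shannon`) because on the band difference quotients control derivatives,
while cell by cell they are controlled by them.

The Lipschitz condition enters only through a uniform H^s bound on its flow. An arbitrary solution
agrees with that flow because both are limits of the same walk (`IsDiracSolution.eq_of_mem_Icc`). -/

namespace NLQW

open scoped NNReal

/-! ### Hadamard's lemma with smooth dependence on both points -/

section Hadamard

/-- An integral over a compact interval depending smoothly on a parameter is smooth. -/
theorem contDiff_intervalIntegral_nat (n : ℕ) : ∀ {E F : Type}
    [NormedAddCommGroup E] [NormedSpace ℝ E] [FiniteDimensional ℝ E]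
    [NormedAddCommGroup F] [NormedSpace ℝ F] [CompleteSpace F]
    {f : E × ℝ → F}, ContDiff ℝ ∞ f → ContDiff ℝ n (fun y => ∫ r in (0 : ℝ)..1, f (y, r)) := by
  induction n with
  | zero =>
    intro E F _ _ _ _ _ _ f hf
    rw [Nat.cast_zero, contDiff_zero]
    exact intervalIntegral.continuous_parametric_intervalIntegral_of_continuous'
      (f := fun y r => f (y, r)) hf.continuous 0 1
  | succ n ih =>
    intro E F _ _ _ _ _ _ f hf
    have hderiv : ∀ y r, HasFDerivAt (fun y => f (y, r))
        ((fderiv ℝ f (y, r)).comp (ContinuousLinearMap.inl ℝ E ℝ)) y := fun y r => by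
      have h1 : HasFDerivAt f (fderiv ℝ f (y, r)) (y, r) :=
        (hf.differentiable (by simp) _).hasFDerivAt
      exact h1.comp y ((hasFDerivAt_id y).prodMk (hasFDerivAt_const r y))
    have hsm : ContDiff ℝ ∞ (fun q : E × ℝ =>
        (fderiv ℝ f q).comp (ContinuousLinearMap.inl ℝ E ℝ)) :=
      (hf.fderiv_right (m := ∞) (by simp)).clm_comp contDiff_const
    have key : ∀ y, HasFDerivAt (fun y => ∫ r in (0 : ℝ)..1, f (y, r))
        (∫ r in (0 : ℝ)..1, (fderiv ℝ f (y, r)).comp (ContinuousLinearMap.inl ℝ E ℝ)) y := by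
      intro y
      -- Finite dimension makes the unit ball around y compact, so one constant dominates the
      -- derivative for all nearby parameters and all r in [0, 1].
      obtain ⟨M, hM⟩ := ((isCompact_closedBall y 1).prod (isCompact_Icc (a := (0 : ℝ))
        (b := 1))).exists_bound_of_continuousOn hsm.continuous.continuousOn
      refine intervalIntegral.hasFDerivAt_integral_of_dominated_of_fderiv_le
        (F := fun y r => f (y, r))
        (F' := fun y r => (fderiv ℝ f (y, r)).comp (ContinuousLinearMap.inl ℝ E ℝ))
        (bound := fun _ => M) (Metric.closedBall_mem_nhds y one_pos) ?_ ?_ ?_ ?_ ?_ ?_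
      · exact Eventually.of_forall fun z =>
          (hf.continuous.comp (by fun_prop : Continuous fun r : ℝ => (z, r))).aestronglyMeasurable
      · exact (hf.continuous.comp
          (by fun_prop : Continuous fun r : ℝ => (y, r))).intervalIntegrable _ _
      · exact (hsm.continuous.comp
          (by fun_prop : Continuous fun r : ℝ => (y, r))).aestronglyMeasurable
      · refine ae_of_all _ fun r hr z hz => hM (z, r) ⟨hz, ?_⟩
        rw [Set.uIoc_of_le zero_le_one] at hr
        exact ⟨hr.1.le, hr.2⟩
      · exact intervalIntegrable_const
      · exact ae_of_all _ fun r _ z _ => hderiv z r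
    rw [Nat.cast_add, Nat.cast_one, contDiff_succ_iff_hasFDerivAt]
    exact ⟨_, ih hsm, key⟩

theorem contDiff_intervalIntegral {E F : Type}
    [NormedAddCommGroup E] [NormedSpace ℝ E] [FiniteDimensional ℝ E]
    [NormedAddCommGroup F] [NormedSpace ℝ F] [CompleteSpace F]
    {f : E × ℝ → F} (hf : ContDiff ℝ ∞ f) :
    ContDiff ℝ ∞ (fun y => ∫ r in (0 : ℝ)..1, f (y, r)) :=
  contDiff_infty.2 fun n => contDiff_intervalIntegral_nat n hf

/-- Hadamard's lemma: the increment of a smooth map is a smooth linear function of the increment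
of the variable. -/
theorem exists_hadamard {E F : Type} [NormedAddCommGroup E] [NormedSpace ℝ E]
    [FiniteDimensional ℝ E] [NormedAddCommGroup F] [NormedSpace ℝ F] [CompleteSpace F] {H : E → F}
    (hH : ContDiff ℝ ∞ H) :
    ∃ B : E × E → (E →L[ℝ] F), ContDiff ℝ ∞ B ∧ ∀ a b, H a - H b = B (a, b) (a - b) := by
  have hD : ContDiff ℝ ∞ (fderiv ℝ H) := hH.fderiv_right (m := ∞) (by simp)
  -- The coefficient is the average of the derivative over the segment from b to a.
  refine ⟨fun q => ∫ r in (0 : ℝ)..1, fderiv ℝ H (q.2 + r • (q.1 - q.2)),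
    contDiff_intervalIntegral (f := fun q : (E × E) × ℝ =>
      fderiv ℝ H (q.1.2 + q.2 • (q.1.1 - q.1.2))) (hD.comp (by fun_prop)), fun a b => ?_⟩
  have hline : ∀ r : ℝ, HasDerivAt (fun r : ℝ => b + r • (a - b)) (a - b) r := fun r => by
    simpa using ((hasDerivAt_id r).smul_const (a - b)).const_add b
  have hcont : Continuous fun r : ℝ => fderiv ℝ H (b + r • (a - b)) :=
    hD.continuous.comp (by fun_prop)
  have h := intervalIntegral.integral_eq_sub_of_hasDerivAt (a := 0) (b := 1)
    (f := fun r : ℝ => H (b + r • (a - b)))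
    (f' := fun r => fderiv ℝ H (b + r • (a - b)) (a - b))
    (fun r _ => ((hH.differentiable (by simp) _).hasFDerivAt.comp_hasDerivAt r (hline r)))
    ((hcont.clm_apply continuous_const).intervalIntegrable _ _)
  simp only [one_smul, zero_smul, add_zero, add_sub_cancel] at h
  rw [← h]
  exact (ContinuousLinearMap.intervalIntegral_apply (hcont.intervalIntegrable _ _) _).symm

end Hadamard

end NLQW

namespace NLQW

open scoped NNReal

/-! ### Sobolev estimates for smooth functions through classical derivatives -/

section SmoothEstimates

variable {E F G : Type} [NormedAddCommGroup E] [NormedSpace ℝ E] [NormedAddCommGroup F]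
  [NormedSpace ℝ F] [NormedAddCommGroup G] [NormedSpace ℝ G]

theorem contDiff_deriv {f : ℝ → E} (hf : ContDiff ℝ ∞ f) : ContDiff ℝ ∞ (deriv f) :=
  (contDiff_infty_iff_deriv.1 hf).2

theorem contDiff_iteratedDeriv {f : ℝ → E} (hf : ContDiff ℝ ∞ f) (j : ℕ) :
    ContDiff ℝ ∞ (iteratedDeriv j f) := by
  induction j generalizing f with
  | zero => simpa using hf
  | succ j ih => rw [iteratedDeriv_succ']; exact ih (contDiff_deriv hf)

/-- The derivatives of `f` of order at most `k` are bounded by `r` in `L²`. -/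
def SobolevBound (k : ℕ) (r : ℝ≥0) (f : ℝ → E) : Prop :=
  ∀ j ≤ k, eLpNorm (iteratedDeriv j f) 2 volume ≤ r

/-- `f` is bounded by `R`, and its derivatives of order `1, …, k` are bounded by `R` in `L²`. -/
def CoeffBound (k : ℕ) (R : ℝ≥0) (f : ℝ → E) : Prop :=
  (∀ x, ‖f x‖ ≤ R) ∧ ∀ j < k, eLpNorm (iteratedDeriv (j + 1) f) 2 volume ≤ R

theorem sobolevBound_zero {r : ℝ≥0} {f : ℝ → E} :
    SobolevBound 0 r f ↔ eLpNorm f 2 volume ≤ r := by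
  simp [SobolevBound]

theorem sobolevBound_succ {k : ℕ} {r : ℝ≥0} {f : ℝ → E} :
    SobolevBound (k + 1) r f ↔ eLpNorm f 2 volume ≤ r ∧ SobolevBound k r (deriv f) := by
  constructor
  · intro h
    refine ⟨by simpa using h 0 (by omega), fun j hj => ?_⟩
    rw [← iteratedDeriv_succ']
    exact h (j + 1) (by omega)
  · rintro ⟨h0, h1⟩ j hj
    rcases j with _ | j
    · simpa using h0
    · rw [iteratedDeriv_succ']
      exact h1 j (by omega)

theorem coeffBound_succ {k : ℕ} {R : ℝ≥0} {f : ℝ → E} :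
    CoeffBound (k + 1) R f ↔ (∀ x, ‖f x‖ ≤ R) ∧ SobolevBound k R (deriv f) := by
  simp only [CoeffBound, SobolevBound, iteratedDeriv_succ', Nat.lt_succ_iff]

theorem coeffBound_zero {R : ℝ≥0} {f : ℝ → E} : CoeffBound 0 R f ↔ ∀ x, ‖f x‖ ≤ R := by
  simp [CoeffBound]

theorem SobolevBound.mono {k l : ℕ} {r r' : ℝ≥0} {f : ℝ → E} (h : SobolevBound k r f)
    (hl : l ≤ k) (hr : r ≤ r') : SobolevBound l r' f := fun j hj =>
  (h j (hj.trans hl)).trans (by exact_mod_cast hr)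

theorem CoeffBound.mono {k l : ℕ} {r r' : ℝ≥0} {f : ℝ → E} (h : CoeffBound k r f)
    (hl : l ≤ k) (hr : r ≤ r') : CoeffBound l r' f :=
  ⟨fun x => (h.1 x).trans (by exact_mod_cast hr),
    fun j hj => (h.2 j (hj.trans_le hl)).trans (by exact_mod_cast hr)⟩

theorem SobolevBound.memLp {k j : ℕ} {r : ℝ≥0} {f : ℝ → E} (h : SobolevBound k r f)
    (hf : ContDiff ℝ ∞ f) (hj : j ≤ k) : MemLp (iteratedDeriv j f) 2 volume :=
  ⟨(contDiff_iteratedDeriv hf j).continuous.aestronglyMeasurable,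
    (h j hj).trans_lt ENNReal.coe_lt_top⟩

theorem SobolevBound.add {k : ℕ} {r r' : ℝ≥0} {f g : ℝ → E} (hf : ContDiff ℝ ∞ f)
    (hg : ContDiff ℝ ∞ g) (h : SobolevBound k r f) (h' : SobolevBound k r' g) :
    SobolevBound k (r + r') (fun x => f x + g x) := by
  intro j hj
  have : iteratedDeriv j (fun x => f x + g x) = iteratedDeriv j f + iteratedDeriv j g := by
    ext x
    exact iteratedDeriv_fun_add (hf.of_le (by exact_mod_cast le_top)).contDiffAt
      (hg.of_le (by exact_mod_cast le_top)).contDiffAt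
  rw [this, ENNReal.coe_add]
  exact (eLpNorm_add_le (contDiff_iteratedDeriv hf j).continuous.aestronglyMeasurable
    (contDiff_iteratedDeriv hg j).continuous.aestronglyMeasurable (by norm_num)).trans
    (add_le_add (h j hj) (h' j hj))

theorem SobolevBound.clm_comp {k : ℕ} {r : ℝ≥0} {f : ℝ → E} (hf : ContDiff ℝ ∞ f)
    (h : SobolevBound k r f) (A : E →L[ℝ] F) :
    SobolevBound k (‖A‖₊ * r) (fun x => A (f x)) := by
  induction k generalizing f with
  | zero =>
    rw [sobolevBound_zero] at *
    refine (eLpNorm_le_nnreal_smul_eLpNorm_of_ae_le_mul (c := ‖A‖₊)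
      (ae_of_all _ fun x => A.le_opNNNorm (f x)) 2).trans ?_
    rw [ENNReal.smul_def, smul_eq_mul, ENNReal.coe_mul]
    gcongr
  | succ k ih =>
    rw [sobolevBound_succ] at *
    refine ⟨?_, ?_⟩
    · refine (eLpNorm_le_nnreal_smul_eLpNorm_of_ae_le_mul (c := ‖A‖₊)
        (ae_of_all _ fun x => A.le_opNNNorm (f x)) 2).trans ?_
      rw [ENNReal.smul_def, smul_eq_mul, ENNReal.coe_mul]
      gcongr
      exact h.1
    · have : deriv (fun x => A (f x)) = fun x => A (deriv f x) := by
        ext x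
        exact (A.hasFDerivAt.comp_hasDerivAt x (hf.differentiable (by simp) x).hasDerivAt).deriv
      rw [this]
      exact ih (contDiff_deriv hf) h.2

/-! ### Local estimates -/

theorem eLpNorm_two_sq {E : Type} [NormedAddCommGroup E] (f : ℝ → E) (μ : Measure ℝ) :
    eLpNorm f 2 μ ^ 2 = ∫⁻ x, ‖f x‖ₑ ^ 2 ∂μ := by
  have := eLpNorm_nnreal_pow_eq_lintegral (f := f) (μ := μ) (p := 2) (by norm_num)
  simpa using this

/-- Comparison of the L¹ and L² norms on an interval of length δ; this is where the factor δ of the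
cell estimates comes from. -/
theorem lintegral_enorm_sq_le {E : Type} [NormedAddCommGroup E] {f : ℝ → E} (hf : Continuous f) (x δ : ℝ) :
    (∫⁻ y in Set.Ioc x (x + δ), ‖f y‖ₑ) ^ 2
      ≤ ENNReal.ofReal δ * ∫⁻ y in Set.Ioc x (x + δ), ‖f y‖ₑ ^ 2 := by
  have h := eLpNorm_le_eLpNorm_mul_rpow_measure_univ (f := f) (p := 1) (q := 2)
    (μ := volume.restrict (Set.Ioc x (x + δ))) (by norm_num) hf.aestronglyMeasurable
  rw [eLpNorm_one_eq_lintegral_enorm] at h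
  refine (pow_le_pow_left' h 2).trans (le_of_eq ?_)
  rw [mul_pow, eLpNorm_two_sq, mul_comm]
  congr 1
  rw [← ENNReal.rpow_natCast, ← ENNReal.rpow_mul]
  norm_num

theorem enorm_sub_le_lintegral [CompleteSpace E] {f : ℝ → E} (hf : ContDiff ℝ ∞ f) {x y : ℝ}
    (hxy : x ≤ y) : ‖f y - f x‖ₑ ≤ ∫⁻ z in Set.Ioc x y, ‖deriv f z‖ₑ := by
  have hc := (contDiff_deriv hf).continuous
  rw [← intervalIntegral.integral_eq_sub_of_hasDerivAt (f := f) (f' := deriv f)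
    (fun z _ => (hf.differentiable (by simp) z).hasDerivAt) (hc.intervalIntegrable _ _),
    intervalIntegral.integral_of_le hxy]
  exact enorm_integral_le_lintegral_enorm _

/-- The square of an increment is controlled by the local `L²` mass of the derivative. -/
theorem enorm_sub_sq_le [CompleteSpace E] {f : ℝ → E} (hf : ContDiff ℝ ∞ f) (x : ℝ) {δ : ℝ}
    (hδ : 0 ≤ δ) : ‖f (x + δ) - f x‖ₑ ^ 2
      ≤ ENNReal.ofReal δ * ∫⁻ y in Set.Ioc x (x + δ), ‖deriv f y‖ₑ ^ 2 :=
  (pow_le_pow_left' (enorm_sub_le_lintegral hf (by linarith)) 2).trans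
    (lintegral_enorm_sq_le (contDiff_deriv hf).continuous x δ)

theorem ennreal_add_sq_le (a b : ℝ≥0∞) : (a + b) ^ 2 ≤ 2 * (a ^ 2 + b ^ 2) := by
  have := ENNReal.rpow_add_le_mul_rpow_add_rpow a b (p := 2) (by norm_num)
  norm_num at this
  exact_mod_cast this

/-- The value at a point is controlled by the local `L²` masses of the function and of its
derivative. -/
theorem enorm_sq_le [CompleteSpace E] {f : ℝ → E} (hf : ContDiff ℝ ∞ f) (x δ : ℝ) : ENNReal.ofReal δ * ‖f x‖ₑ ^ 2
      ≤ 2 * ((∫⁻ y in Set.Ioc x (x + δ), ‖f y‖ₑ ^ 2)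
        + ENNReal.ofReal δ ^ 2 * ∫⁻ y in Set.Ioc x (x + δ), ‖deriv f y‖ₑ ^ 2) := by
  have hpt : ∀ y ∈ Set.Ioc x (x + δ),
      ‖f x‖ₑ ^ 2 ≤ 2 * (‖f y‖ₑ ^ 2 +
        ENNReal.ofReal δ * ∫⁻ y in Set.Ioc x (x + δ), ‖deriv f y‖ₑ ^ 2) := by
    intro y hy
    have h1 : ‖f x‖ₑ ≤ ‖f y‖ₑ + ∫⁻ z in Set.Ioc x (x + δ), ‖deriv f z‖ₑ := by
      calc ‖f x‖ₑ = ‖f y - (f y - f x)‖ₑ := by rw [sub_sub_cancel]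
        _ ≤ ‖f y‖ₑ + ‖f y - f x‖ₑ := enorm_sub_le
        _ ≤ _ := by
          gcongr
          exact (enorm_sub_le_lintegral hf hy.1.le).trans
            (lintegral_mono_set (Set.Ioc_subset_Ioc_right hy.2))
    refine (pow_le_pow_left' h1 2).trans ((ennreal_add_sq_le _ _).trans ?_)
    gcongr
    exact lintegral_enorm_sq_le (contDiff_deriv hf).continuous x δ
  have hvol : volume (Set.Ioc x (x + δ)) = ENNReal.ofReal δ := by simp
  have h2 := setLIntegral_mono' (μ := volume) measurableSet_Ioc hpt
  rw [setLIntegral_const, hvol, mul_comm, lintegral_const_mul' _ _ (by norm_num),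
    lintegral_add_right' _ aemeasurable_const, setLIntegral_const, hvol] at h2
  refine h2.trans (le_of_eq ?_)
  ring

/-- Sobolev embedding on the line. -/
theorem norm_le_of_sobolevBound [CompleteSpace E] {k : ℕ} {r : ℝ≥0} {f : ℝ → E}
    (hf : ContDiff ℝ ∞ f) (h : SobolevBound (k + 1) r f) (x : ℝ) : ‖f x‖ ≤ (2 * r : ℝ≥0) := by
  rw [sobolevBound_succ] at h
  have h1 := enorm_sq_le hf x 1
  have hm : ∀ g : ℝ → E, eLpNorm g 2 volume ≤ r →
      ∫⁻ y in Set.Ioc x (x + 1), ‖g y‖ₑ ^ 2 ≤ (r : ℝ≥0∞) ^ 2 := fun g hg => by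
    refine (setLIntegral_le_lintegral _ _).trans ?_
    rw [← eLpNorm_two_sq]
    gcongr
  have h2 : ‖f x‖ₑ ^ 2 ≤ ((2 * r : ℝ≥0) : ℝ≥0∞) ^ 2 := by
    simp only [ENNReal.ofReal_one, one_mul, one_pow] at h1
    refine h1.trans ?_
    calc 2 * ((∫⁻ y in Set.Ioc x (x + 1), ‖f y‖ₑ ^ 2)
          + ∫⁻ y in Set.Ioc x (x + 1), ‖deriv f y‖ₑ ^ 2)
        ≤ 2 * ((r : ℝ≥0∞) ^ 2 + (r : ℝ≥0∞) ^ 2) := by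
          gcongr
          · exact hm _ h.1
          · exact hm _ (by simpa using h.2 0 (by omega))
      _ = _ := by push_cast; ring
  have h3 : ‖f x‖ₑ ≤ ((2 * r : ℝ≥0) : ℝ≥0∞) := (ENNReal.pow_le_pow_left_iff (by norm_num)).1 h2
  rw [enorm_le_coe] at h3
  exact_mod_cast h3

/-- By the Sobolev embedding a Sobolev function of positive order may also play the role of a
coefficient; the 2 is the embedding constant. -/
theorem SobolevBound.coeffBound [CompleteSpace E] {k : ℕ} {r : ℝ≥0} {f : ℝ → E}
    (hf : ContDiff ℝ ∞ f) (h : SobolevBound (k + 1) r f) : CoeffBound (k + 1) (2 * r) f :=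
  ⟨norm_le_of_sobolevBound hf h, fun j hj => (h (j + 1) (by omega)).trans (by
    norm_cast; exact le_mul_of_one_le_left zero_le (by norm_num))⟩

/-! ### Products and superpositions -/

theorem deriv_bilinear (B : E →L[ℝ] F →L[ℝ] G) {f : ℝ → E} {g : ℝ → F} (hf : ContDiff ℝ ∞ f)
    (hg : ContDiff ℝ ∞ g) :
    deriv (fun x => B (f x) (g x)) = fun x => B (f x) (deriv g x) + B (deriv f x) (g x) := by
  ext x
  exact (B.hasDerivAt_of_bilinear (fun _ => (hf.differentiable (by simp) x).hasDerivAt)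
    (fun _ => (hg.differentiable (by simp) x).hasDerivAt)).deriv

theorem eLpNorm_bilinear_le (B : E →L[ℝ] F →L[ℝ] G) {f : ℝ → E} {g : ℝ → F} {R r : ℝ≥0}
    (hf : ∀ x, ‖f x‖ ≤ R) (hg : eLpNorm g 2 volume ≤ r) :
    eLpNorm (fun x => B (f x) (g x)) 2 volume ≤ (‖B‖₊ * R * r : ℝ≥0) := by
  refine (eLpNorm_le_nnreal_smul_eLpNorm_of_ae_le_mul (c := ‖B‖₊ * R) (g := g)
    (ae_of_all _ fun x => ?_) 2).trans ?_
  · rw [← NNReal.coe_le_coe]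
    refine (ContinuousLinearMap.le_opNorm₂ B (f x) (g x)).trans ?_
    simp only [NNReal.coe_mul, coe_nnnorm]
    gcongr
    exact hf x
  · rw [ENNReal.smul_def, smul_eq_mul, ENNReal.coe_mul (_ * _)]
    gcongr

/-- A product of a coefficient and a Sobolev function. -/
theorem SobolevBound.bilinear (k : ℕ) : ∀ {E F G : Type} [NormedAddCommGroup E] [NormedSpace ℝ E]
    [NormedAddCommGroup F] [NormedSpace ℝ F] [NormedAddCommGroup G] [NormedSpace ℝ G]
    [CompleteSpace E] [CompleteSpace F]
    (B : E →L[ℝ] F →L[ℝ] G) {f : ℝ → E} {g : ℝ → F} {R r : ℝ≥0}, ContDiff ℝ ∞ f →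
    ContDiff ℝ ∞ g → CoeffBound k R f → SobolevBound k r g →
    SobolevBound k (3 ^ k * (‖B‖₊ * R * r)) (fun x => B (f x) (g x)) := by
  induction k with
  | zero =>
    intro E F G _ _ _ _ _ _ _ _ B f g R r hf hg hR hr
    rw [sobolevBound_zero] at *
    simpa using eLpNorm_bilinear_le B hR.1 hr
  | succ k ih =>
    intro E F G _ _ _ _ _ _ _ _ B f g R r hf hg hR hr
    have hr' := hr.coeffBound hg
    have hR' := coeffBound_succ.1 hR
    have hr2 := sobolevBound_succ.1 hr
    rw [sobolevBound_succ, deriv_bilinear B hf hg]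
    constructor
    · refine (eLpNorm_bilinear_le B hR.1 hr2.1).trans ?_
      rw [ENNReal.coe_le_coe]
      exact le_mul_of_one_le_left zero_le (one_le_pow₀ (by norm_num))
    -- In B(f, g') the coefficient is still f. In B(f', g) the roles are exchanged and g is a
    -- coefficient of size 2r. The two terms add up to 1 + 2 = 3, whence the factor 3^k.
    · have h1 := ih B hf (contDiff_deriv hg) (hR.mono (Nat.le_succ k) le_rfl) hr2.2
      have h2 := ih B.flip hg (contDiff_deriv hf) (hr'.mono (Nat.le_succ k) le_rfl) hR'.2
      have hn : ‖B.flip‖₊ = ‖B‖₊ := NNReal.eq B.opNorm_flip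
      refine (h1.add (by fun_prop (disch := exact contDiff_deriv hg)) ?_ h2).mono le_rfl ?_
      · exact (B.flip.isBoundedBilinearMap.contDiff (n := ∞)).comp (hg.prodMk (contDiff_deriv hf))
      · rw [hn, pow_succ]
        exact le_of_eq (by ring)

theorem exists_bound_of_continuous {F : Type} [NormedAddCommGroup F] [FiniteDimensional ℝ E] {H : E → F} (hH : Continuous H)
    (R : ℝ≥0) : ∃ M : ℝ≥0, ∀ x, ‖x‖ ≤ R → ‖H x‖ ≤ M := by
  obtain ⟨M, hM⟩ := (isCompact_closedBall (0 : E) R).exists_bound_of_continuousOn hH.continuousOn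
  exact ⟨M.toNNReal, fun x hx => (hM x (by simpa using hx)).trans (Real.le_coe_toNNReal M)⟩

theorem deriv_comp_smooth {H : E → F} {f : ℝ → E} (hH : ContDiff ℝ ∞ H) (hf : ContDiff ℝ ∞ f) :
    deriv (fun x => H (f x)) = fun x => fderiv ℝ H (f x) (deriv f x) := by
  ext x
  exact ((hH.differentiable (by simp) _).hasFDerivAt.comp_hasDerivAt x
    (hf.differentiable (by simp) x).hasDerivAt).deriv

/-- Coefficients are stable under smooth superposition. -/
theorem CoeffBound.comp (k : ℕ) : ∀ {E F : Type} [NormedAddCommGroup E] [NormedSpace ℝ E]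
    [FiniteDimensional ℝ E] [NormedAddCommGroup F] [NormedSpace ℝ F] [FiniteDimensional ℝ F]
    {H : E → F}, ContDiff ℝ ∞ H → ∀ R : ℝ≥0, ∃ R' : ℝ≥0, ∀ f : ℝ → E, ContDiff ℝ ∞ f →
      CoeffBound k R f → CoeffBound k R' (fun x => H (f x)) := by
  induction k with
  | zero =>
    intro E F _ _ _ _ _ _ H hH R
    obtain ⟨M, hM⟩ := exists_bound_of_continuous hH.continuous R
    exact ⟨M, fun f _ hR => coeffBound_zero.2 fun x => hM _ (hR.1 x)⟩
  | succ k ih =>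
    intro E F _ _ _ _ _ _ H hH R
    have : CompleteSpace E := FiniteDimensional.complete ℝ E
    obtain ⟨M, hM⟩ := exists_bound_of_continuous hH.continuous R
    have hD : ContDiff ℝ ∞ (fderiv ℝ H) := hH.fderiv_right (m := ∞) (by simp)
    -- The derivative of H(f) is the product of the coefficient DH(f) and the Sobolev function f'.
    -- The induction is applied to DH, which is why the target space is left free.
    obtain ⟨R₁, hR₁⟩ := ih hD R
    refine ⟨M + 3 ^ k * (‖ContinuousLinearMap.id ℝ (E →L[ℝ] F)‖₊ * R₁ * R), fun f hf hR => ?_⟩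
    refine coeffBound_succ.2 ⟨fun x => (hM _ (hR.1 x)).trans ?_, ?_⟩
    · exact_mod_cast le_self_add
    · rw [deriv_comp_smooth hH hf]
      have h1 := hR₁ f hf (hR.mono (Nat.le_succ k) le_rfl)
      have h2 := (coeffBound_succ.1 hR).2
      have : CompleteSpace (E →L[ℝ] F) := FiniteDimensional.complete ℝ _
      exact (SobolevBound.bilinear k (ContinuousLinearMap.id ℝ (E →L[ℝ] F)) (hD.comp hf)
        (contDiff_deriv hf) h1 h2).mono le_rfl le_add_self

theorem SobolevBound.prodMk {k : ℕ} {r r' : ℝ≥0} {f : ℝ → E} {g : ℝ → F} (hf : ContDiff ℝ ∞ f)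
    (hg : ContDiff ℝ ∞ g) (h : SobolevBound k r f) (h' : SobolevBound k r' g) :
    SobolevBound k (r + r') (fun x => (f x, g x)) := by
  have h1 := h.clm_comp hf (ContinuousLinearMap.inl ℝ E F)
  have h2 := h'.clm_comp hg (ContinuousLinearMap.inr ℝ E F)
  have h3 := h1.add (by fun_prop) (by fun_prop) h2
  simp only [ContinuousLinearMap.inl_apply, ContinuousLinearMap.inr_apply, Prod.mk_add_mk,
    add_zero, zero_add] at h3
  refine h3.mono le_rfl (add_le_add ?_ ?_)
  · exact mul_le_of_le_one_left zero_le (ContinuousLinearMap.norm_inl_le_one ℝ E F)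
  · exact mul_le_of_le_one_left zero_le (ContinuousLinearMap.norm_inr_le_one ℝ E F)

theorem deriv_prodMk {f : ℝ → E} {g : ℝ → F} (hf : ContDiff ℝ ∞ f) (hg : ContDiff ℝ ∞ g) :
    deriv (fun x => (f x, g x)) = fun x => (deriv f x, deriv g x) := by
  ext1 x
  exact ((hf.differentiable (by simp) x).hasDerivAt.prodMk
    (hg.differentiable (by simp) x).hasDerivAt).deriv

theorem CoeffBound.prodMk {k : ℕ} {r r' : ℝ≥0} {f : ℝ → E} {g : ℝ → F} (hf : ContDiff ℝ ∞ f)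
    (hg : ContDiff ℝ ∞ g) (h : CoeffBound k r f) (h' : CoeffBound k r' g) :
    CoeffBound k (r + r') (fun x => (f x, g x)) := by
  have h0 : ∀ x, ‖(f x, g x)‖ ≤ (r + r' : ℝ≥0) := fun x => by
    rw [Prod.norm_mk, NNReal.coe_add]
    exact max_le ((h.1 x).trans (by simp)) ((h'.1 x).trans (by simp))
  rcases k with _ | k
  · exact coeffBound_zero.2 h0
  · refine coeffBound_succ.2 ⟨h0, ?_⟩
    rw [deriv_prodMk hf hg]
    exact (coeffBound_succ.1 h).2.prodMk (contDiff_deriv hf) (contDiff_deriv hg)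
      (coeffBound_succ.1 h').2

theorem CoeffBound.const (k : ℕ) (c : E) : CoeffBound k ‖c‖₊ (fun _ : ℝ => c) := by
  refine ⟨fun x => by simp, fun j _ => ?_⟩
  have h0 : iteratedDeriv (j + 1) (fun _ : ℝ => c) = fun _ => 0 := by
    ext x
    simp [iteratedDeriv_const]
  rw [h0]
  simp

variable [FiniteDimensional ℝ E] [FiniteDimensional ℝ F] [FiniteDimensional ℝ G]

/-- A smooth superposition operator is locally Lipschitz in its Sobolev argument. -/
theorem exists_sobolevBound_sub {H : E × F → G} (hH : ContDiff ℝ ∞ H) (k : ℕ) (R : ℝ≥0) :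
    ∃ C : ℝ≥0, ∀ (q : ℝ → E) (y z : ℝ → F), ContDiff ℝ ∞ q → ContDiff ℝ ∞ y → ContDiff ℝ ∞ z →
      CoeffBound k R q → CoeffBound k R y → CoeffBound k R z → ∀ r : ℝ≥0,
      SobolevBound k r (fun x => y x - z x) →
      SobolevBound k (C * r) (fun x => H (q x, y x) - H (q x, z x)) := by
  have : CompleteSpace (E × F) := FiniteDimensional.complete ℝ _
  have : CompleteSpace G := FiniteDimensional.complete ℝ _
  have : CompleteSpace (E × F →L[ℝ] G) := FiniteDimensional.complete ℝ _
  -- Hadamard's lemma turns the difference into a product: a smooth superposition of (q, y) and (q,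
  -- z), which is a coefficient, applied to (0, y - z).
  obtain ⟨B, hB, hBeq⟩ := exists_hadamard hH
  obtain ⟨R', hR'⟩ := CoeffBound.comp k hB (R + R + (R + R))
  refine ⟨3 ^ k * (‖ContinuousLinearMap.id ℝ (E × F →L[ℝ] G)‖₊ * R' *
    ‖ContinuousLinearMap.inr ℝ E F‖₊), fun q y z hq hy hz bq by_ bz r hr => ?_⟩
  have h1 := hR' (fun x => ((q x, y x), (q x, z x))) (by fun_prop)
    ((bq.prodMk hq hy by_).prodMk (by fun_prop) (by fun_prop) (bq.prodMk hq hz bz))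
  have h2 := hr.clm_comp (hy.sub hz) (ContinuousLinearMap.inr ℝ E F)
  have h3 := SobolevBound.bilinear k (ContinuousLinearMap.id ℝ (E × F →L[ℝ] G))
    (hB.comp (by fun_prop)) (by fun_prop) h1 h2
  have heq : (fun x => H (q x, y x) - H (q x, z x)) = fun x =>
      (ContinuousLinearMap.id ℝ (E × F →L[ℝ] G) (B ((q x, y x), (q x, z x))))
        (ContinuousLinearMap.inr ℝ E F (y x - z x)) := by
    ext x
    simp [hBeq]
  rw [heq]
  exact h3.mono le_rfl (le_of_eq (by ring))

/-- A smooth superposition operator vanishing at `0` is bounded on Sobolev functions. -/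
theorem exists_sobolevBound_of_vanish {H : E × F → G} (hH : ContDiff ℝ ∞ H)
    (hH0 : ∀ q, H (q, 0) = 0) (k : ℕ) (R : ℝ≥0) :
    ∃ C : ℝ≥0, ∀ (q : ℝ → E) (z : ℝ → F), ContDiff ℝ ∞ q → ContDiff ℝ ∞ z →
      CoeffBound k R q → CoeffBound k R z → ∀ r : ℝ≥0, SobolevBound k r z →
      SobolevBound k (C * r) (fun x => H (q x, z x)) := by
  obtain ⟨C, hC⟩ := exists_sobolevBound_sub hH k R
  refine ⟨C, fun q z hq hz bq bz r hr => ?_⟩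
  have h0 : CoeffBound k R (fun _ : ℝ => (0 : F)) :=
    (CoeffBound.const k 0).mono le_rfl (by simp)
  simpa [hH0] using hC q z (fun _ => 0) hq hz contDiff_const bq bz h0 r (by simpa using hr)

/-- The tame estimate: one more derivative enters only linearly. -/
theorem exists_sobolevBound_tame {H : E × F → G} (hH : ContDiff ℝ ∞ H)
    (hH0 : ∀ q, H (q, 0) = 0) (k : ℕ) (R : ℝ≥0) :
    ∃ C : ℝ≥0, ∀ (q : ℝ → E) (z : ℝ → F), ContDiff ℝ ∞ q → ContDiff ℝ ∞ z →
      CoeffBound (k + 1) R q → CoeffBound k R z → ∀ r : ℝ≥0, SobolevBound (k + 1) r z →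
      SobolevBound (k + 1) (C * (1 + r)) (fun x => H (q x, z x)) := by
  have : CompleteSpace (E × F) := FiniteDimensional.complete ℝ _
  have : CompleteSpace (E × F →L[ℝ] G) := FiniteDimensional.complete ℝ _
  obtain ⟨C₀, hC₀⟩ := exists_sobolevBound_of_vanish hH hH0 0 R
  have hD : ContDiff ℝ ∞ (fderiv ℝ H) := hH.fderiv_right (m := ∞) (by simp)
  obtain ⟨R', hR'⟩ := CoeffBound.comp k hD (R + R)
  set D := 3 ^ k * (‖ContinuousLinearMap.id ℝ (E × F →L[ℝ] G)‖₊ * R') with hDdef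
  refine ⟨C₀ + D * (R + 1), fun q z hq hz bq bz r hr => ?_⟩
  have bq' := bq.mono (Nat.le_succ k) le_rfl
  rw [sobolevBound_succ] at hr ⊢
  constructor
  · have := sobolevBound_zero.1 (hC₀ q z hq hz (bq.mono (by omega) le_rfl)
      (bz.mono (by omega) le_rfl) r (sobolevBound_zero.2 hr.1))
    refine this.trans ?_
    norm_cast
    exact mul_le_mul' le_self_add le_add_self
  -- In DH(q, z)(q', z') the factor DH(q, z) is measured at order k only, where z is bounded by R;
  -- the top-order bound r enters once, through z'.
  · rw [deriv_comp_smooth (f := fun x => (q x, z x)) hH (by fun_prop), deriv_prodMk hq hz]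
    have h1 := hR' (fun x => (q x, z x)) (by fun_prop) (bq'.prodMk hq hz bz)
    have h2 := (coeffBound_succ.1 bq).2.prodMk (contDiff_deriv hq) (contDiff_deriv hz) hr.2
    refine (SobolevBound.bilinear k (ContinuousLinearMap.id ℝ (E × F →L[ℝ] G))
      (hD.comp (by fun_prop)) ((contDiff_deriv hq).prodMk (contDiff_deriv hz)) h1 h2).mono
      le_rfl ?_
    calc 3 ^ k * (‖ContinuousLinearMap.id ℝ (E × F →L[ℝ] G)‖₊ * R' * (R + r))
        = D * (R + r) := by rw [hDdef]; ring
      _ ≤ D * ((R + 1) * (1 + r)) := by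
          gcongr
          calc R + r ≤ (R + r) + (R * r + 1) := le_self_add
            _ = _ := by ring
      _ ≤ (C₀ + D * (R + 1)) * (1 + r) := by
          calc _ = D * (R + 1) * (1 + r) := by ring
            _ ≤ _ := by gcongr; exact le_add_self

end SmoothEstimates

end NLQW

namespace NLQW

open scoped NNReal

/-! ### Weak derivatives: Fourier description and agreement with classical derivatives -/

section WeakDerivative

theorem toTemperedDistribution_injective :
    Function.Injective (fun u : L2 => (u : 𝓢'(ℝ, C2))) := by
  have h := Lp.ker_toTemperedDistributionCLM_eq_bot (F := C2) (μ := (volume : Measure ℝ)) (p := 2)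
  exact LinearMap.ker_eq_bot.1 h

theorem IsWeakDeriv.weakDeriv_eq {u v : L2} (h : IsWeakDeriv u v) : weakDeriv u = v := by
  have hex : ∃ v, IsWeakDeriv u v := ⟨v, h⟩
  rw [weakDeriv, dif_pos hex]
  have h' : IsWeakDeriv u hex.choose := hex.choose_spec
  unfold IsWeakDeriv at h h'
  exact toTemperedDistribution_injective (h'.symm.trans h)

theorem integrable_smul_of_memLp_two {f : ℝ → ℂ} {g : ℝ → C2} (hf : MemLp f 2 volume)
    (hg : MemLp g 2 volume) : Integrable (fun x => f x • g x) volume :=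
  memLp_one_iff_integrable.1 (hg.smul hf)

/-- Real test functions of compact support already separate locally integrable functions, and each
of them, viewed as complex valued, is a Schwartz function. -/
theorem ae_eq_of_schwartz_integral_eq {f g : ℝ → C2} (hf : LocallyIntegrable f volume)
    (hg : LocallyIntegrable g volume)
    (h : ∀ φ : 𝓢(ℝ, ℂ), ∫ x, φ x • f x = ∫ x, φ x • g x) : f =ᵐ[volume] g := by
  refine ae_eq_of_integral_contDiff_smul_eq hf hg fun φ hφ hc => ?_
  have h₁ : HasCompactSupport (Complex.ofRealCLM ∘ φ) := hc.comp_left rfl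
  have h₂ : ContDiff ℝ ∞ (Complex.ofRealCLM ∘ φ) := by fun_prop
  simpa using h (h₁.toSchwartzMap h₂)

/-- On the Fourier side the weak derivative is the multiplication by `2πiξ`. -/
theorem isWeakDeriv_iff {u v : L2} : IsWeakDeriv u v ↔
    ((𝓕 v : L2) : ℝ → C2) =ᵐ[volume] fun ξ => (2 * Real.pi * Complex.I * ξ) • (𝓕 u : L2) ξ := by
  have hg : (fun x : ℝ => ((inner ℝ x (1 : ℝ) : ℝ) : ℂ)).HasTemperateGrowth := by fun_prop
  have h1 : IsWeakDeriv u v ↔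
      𝓕 (∂_{(1 : ℝ)} (u : 𝓢'(ℝ, C2))) = 𝓕 (v : 𝓢'(ℝ, C2)) := by
    unfold IsWeakDeriv
    refine ⟨fun h => by rw [h], fun h => ?_⟩
    simpa only [FourierTransform.fourierInv_fourier_eq] using
      congrArg (fun w : 𝓢'(ℝ, C2) => 𝓕⁻ w) h
  have h2 : ∀ φ : 𝓢(ℝ, ℂ), ((2 * Real.pi * Complex.I) •
      TemperedDistribution.smulLeftCLM C2 (fun x : ℝ => ((inner ℝ x (1 : ℝ) : ℝ) : ℂ))
        ((𝓕 u : L2) : 𝓢'(ℝ, C2))) φ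
      = ∫ ξ, φ ξ • ((2 * Real.pi * Complex.I * ξ) • (𝓕 u : L2) ξ) := by
    intro φ
    change (2 * Real.pi * Complex.I) • (TemperedDistribution.smulLeftCLM C2
      (fun x : ℝ => ((inner ℝ x (1 : ℝ) : ℝ) : ℂ)) ((𝓕 u : L2) : 𝓢'(ℝ, C2))) φ = _
    rw [TemperedDistribution.smulLeftCLM_apply_apply, Lp.toTemperedDistribution_apply,
      ← integral_smul]
    refine integral_congr_ae (ae_of_all _ fun ξ => ?_)
    simp only [SchwartzMap.smulLeftCLM_apply_apply hg, smul_smul]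
    congr 1
    simp
    ring
  rw [h1, TemperedDistribution.fourier_lineDerivOp_eq, Lp.fourier_toTemperedDistribution_eq,
    Lp.fourier_toTemperedDistribution_eq]
  constructor
  · intro h
    refine ae_eq_of_schwartz_integral_eq ((Lp.memLp _).locallyIntegrable (by norm_num)) ?_
      fun φ => ?_
    · exact ((Lp.memLp (𝓕 u : L2)).locallyIntegrable (by norm_num)).continuous_smul
        (g := fun ξ : ℝ => (2 * Real.pi * Complex.I * ξ : ℂ)) (by fun_prop)
    · rw [← h2, h, Lp.toTemperedDistribution_apply]
  · intro h
    ext1 φ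
    rw [h2, Lp.toTemperedDistribution_apply]
    refine integral_congr_ae ?_
    filter_upwards [h] with ξ hξ
    rw [hξ]

/-- A classical derivative is a weak derivative. -/
theorem isWeakDeriv_of_contDiff {f : ℝ → C2} (hf : ContDiff ℝ ∞ f) {u v : L2}
    (hu : u =ᵐ[volume] f) (hv : v =ᵐ[volume] deriv f) : IsWeakDeriv u v := by
  have hfm : MemLp f 2 volume := (memLp_congr_ae hu).1 (Lp.memLp u)
  have hfm' : MemLp (deriv f) 2 volume := (memLp_congr_ae hv).1 (Lp.memLp v)
  unfold IsWeakDeriv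
  ext1 φ
  rw [TemperedDistribution.lineDerivOp_apply_apply, Lp.toTemperedDistribution_apply,
    Lp.toTemperedDistribution_apply]
  have hφd : ∀ x, (∂_{(1 : ℝ)} φ) x = deriv φ x := fun x => by
    rw [SchwartzMap.lineDerivOp_apply_eq_fderiv]; simp
  have e1 : ∫ x, (-∂_{(1 : ℝ)} φ) x • u x = -∫ x, deriv φ x • f x := by
    rw [← integral_neg]
    refine integral_congr_ae ?_
    filter_upwards [hu] with x hx
    rw [_root_.neg_apply, hφd, hx, neg_smul]
  have e2 : ∫ x, φ x • v x = ∫ x, φ x • deriv f x := by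
    refine integral_congr_ae ?_
    filter_upwards [hv] with x hx
    rw [hx]
  rw [e1, e2]
  have hφ' : MemLp (deriv φ) 2 volume := by
    have := (∂_{(1 : ℝ)} φ).memLp 2 volume
    convert this using 1
    ext x
    rw [hφd]
  -- Integration by parts on the whole line; φf, φf' and φ'f are integrable as products of L²
  -- functions, so there are no boundary terms.
  exact (integral_bilinear_hasDerivAt_right_eq_neg_left_of_integrable
    (L := ContinuousLinearMap.lsmul ℝ ℂ)
    (fun x _ => (φ.differentiable x).hasDerivAt)
    (fun x _ => (hf.differentiable (by simp) x).hasDerivAt)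
    (integrable_smul_of_memLp_two (φ.memLp 2 volume) hfm')
    (integrable_smul_of_memLp_two hφ' hfm)
    (integrable_smul_of_memLp_two (φ.memLp 2 volume) hfm)).symm

/-- A weak derivative of a smooth function is its classical derivative. -/
theorem IsWeakDeriv.ae_eq_deriv {f : ℝ → C2} (hf : ContDiff ℝ ∞ f) {u v : L2}
    (h : IsWeakDeriv u v) (hu : u =ᵐ[volume] f) : v =ᵐ[volume] deriv f := by
  have hf' := contDiff_deriv hf
  refine ae_eq_of_integral_contDiff_smul_eq ((Lp.memLp v).locallyIntegrable (by norm_num))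
    hf'.continuous.locallyIntegrable fun φ hφ hc => ?_
  have h₁ : HasCompactSupport (Complex.ofRealCLM ∘ φ) := hc.comp_left rfl
  have h₂ : ContDiff ℝ ∞ (Complex.ofRealCLM ∘ φ) := by fun_prop
  have hφd : ∀ x : ℝ, HasDerivAt φ (deriv φ x) x := fun x => (hφ.differentiable (by simp) x).hasDerivAt
  have hd : ∀ x, (∂_{(1 : ℝ)} (h₁.toSchwartzMap h₂)) x = ((deriv φ x : ℝ) : ℂ) := fun x => by
    rw [SchwartzMap.lineDerivOp_apply_eq_fderiv, fderiv_apply_one_eq_deriv]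
    exact (hφd x).ofReal_comp.deriv
  have key := congrArg (fun w : 𝓢'(ℝ, C2) => w (h₁.toSchwartzMap h₂)) h
  simp only [TemperedDistribution.lineDerivOp_apply_apply, Lp.toTemperedDistribution_apply] at key
  have e1 : ∫ x, (-∂_{(1 : ℝ)} (h₁.toSchwartzMap h₂)) x • u x = -∫ x, deriv φ x • f x := by
    rw [← integral_neg]
    refine integral_congr_ae ?_
    filter_upwards [hu] with x hx
    rw [_root_.neg_apply, hd, hx, neg_smul, Complex.coe_smul]
  have e2 : ∫ x, (h₁.toSchwartzMap h₂) x • v x = ∫ x, φ x • v x := by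
    refine integral_congr_ae (ae_of_all _ fun x => ?_)
    simp
  rw [e1, e2] at key
  rw [← key]
  have hcd : HasCompactSupport (deriv φ) := hc.deriv
  exact (integral_bilinear_hasDerivAt_right_eq_neg_left_of_integrable
    (L := ContinuousLinearMap.lsmul ℝ ℝ) (fun x _ => hφd x)
    (fun x _ => (hf.differentiable (by simp) x).hasDerivAt)
    ((hφ.continuous.smul hf'.continuous).integrable_of_hasCompactSupport hc.smul_right)
    (((contDiff_deriv hφ).continuous.smul hf.continuous).integrable_of_hasCompactSupport
      hcd.smul_right)
    ((hφ.continuous.smul hf.continuous).integrable_of_hasCompactSupport hc.smul_right)).symm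

end WeakDerivative

end NLQW

namespace NLQW

open scoped NNReal

noncomputable section

/-! ### Multiplication operators -/

/-- A bounded measurable matrix-valued function. -/
structure IsMultiplier (m : ℝ → C2 →L[ℂ] C2) : Prop where
  meas : AEStronglyMeasurable m volume
  bdd : ∃ C, ∀ ξ, ‖m ξ‖ ≤ C

variable {m m' : ℝ → C2 →L[ℂ] C2}

theorem IsMultiplier.memLp (hm : IsMultiplier m) (f : L2) :
    MemLp (fun ξ => m ξ (f ξ)) 2 volume := by
  obtain ⟨C, hC⟩ := hm.bdd
  refine (Lp.memLp f).of_le_mul (c := C) ?_ (ae_of_all _ fun ξ => (m ξ).le_of_opNorm_le (hC ξ) _)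
  exact (ContinuousLinearMap.id ℂ (C2 →L[ℂ] C2)).aestronglyMeasurable_comp₂ hm.meas
    (Lp.aestronglyMeasurable f)

/-- The operator of multiplication by `m` on `L²`. -/
def mulOp (m : ℝ → C2 →L[ℂ] C2) (hm : IsMultiplier m) : L2 →L[ℂ] L2 :=
  LinearMap.mkContinuousOfExistsBound
    { toFun := fun f => (hm.memLp f).toLp
      map_add' := fun f g => by
        rw [← MemLp.toLp_add]
        refine MemLp.toLp_congr _ _ ?_
        filter_upwards [Lp.coeFn_add f g] with ξ h
        rw [h]
        exact map_add (m ξ) _ _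
      map_smul' := fun c f => by
        rw [RingHom.id_apply, ← MemLp.toLp_const_smul]
        refine MemLp.toLp_congr _ _ ?_
        filter_upwards [Lp.coeFn_smul c f] with ξ h
        rw [h]
        exact map_smul (m ξ) c _ } (by
    obtain ⟨C, hC⟩ := hm.bdd
    refine ⟨C, fun f => Lp.norm_le_mul_norm_of_ae_le_mul ?_⟩
    filter_upwards [(hm.memLp f).coeFn_toLp] with ξ h
    change ‖((hm.memLp f).toLp) ξ‖ ≤ _
    rw [h]
    exact (m ξ).le_of_opNorm_le (hC ξ) _)

theorem coeFn_mulOp (hm : IsMultiplier m) (f : L2) :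
    (mulOp m hm f : ℝ → C2) =ᵐ[volume] fun ξ => m ξ (f ξ) :=
  (hm.memLp f).coeFn_toLp

theorem norm_mulOp_apply_le (hm : IsMultiplier m) {f g : L2} {c : ℝ}
    (h : ∀ᵐ ξ, ‖m ξ (f ξ)‖ ≤ c * ‖g ξ‖) : ‖mulOp m hm f‖ ≤ c * ‖g‖ := by
  refine Lp.norm_le_mul_norm_of_ae_le_mul ?_
  filter_upwards [coeFn_mulOp hm f, h] with ξ h1 h2
  rwa [h1]

theorem norm_mulOp_apply_le_mulOp (hm : IsMultiplier m) (hm' : IsMultiplier m') {f g : L2} {c : ℝ}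
    (h : ∀ᵐ ξ, ‖m ξ (f ξ)‖ ≤ c * ‖m' ξ (g ξ)‖) :
    ‖mulOp m hm f‖ ≤ c * ‖mulOp m' hm' g‖ := by
  refine norm_mulOp_apply_le hm ?_
  filter_upwards [coeFn_mulOp hm' g, h] with ξ h1 h2
  rwa [h1]

theorem mulOp_congr_apply (hm : IsMultiplier m) (hm' : IsMultiplier m') {f g : L2}
    (h : ∀ᵐ ξ, m ξ (f ξ) = m' ξ (g ξ)) : mulOp m hm f = mulOp m' hm' g := by
  refine Lp.ext ?_
  filter_upwards [coeFn_mulOp hm f, coeFn_mulOp hm' g, h] with ξ h1 h2 h3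
  rw [h1, h2, h3]

/-- Multiplication by a scalar function. -/
def scalarMul (a : ℝ → ℂ) (ξ : ℝ) : C2 →L[ℂ] C2 := a ξ • ContinuousLinearMap.id ℂ C2

@[simp]
theorem scalarMul_apply (a : ℝ → ℂ) (ξ : ℝ) (z : C2) : scalarMul a ξ z = a ξ • z := rfl

theorem isMultiplier_scalarMul {a : ℝ → ℂ} (ha : Measurable a) {C : ℝ} (hC : ∀ ξ, ‖a ξ‖ ≤ C) :
    IsMultiplier (scalarMul a) :=
  ⟨(ha.aestronglyMeasurable).smul_const _, C, fun ξ => by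
    refine ContinuousLinearMap.opNorm_le_bound _ ((norm_nonneg _).trans (hC ξ)) fun z => ?_
    rw [scalarMul_apply, norm_smul]
    exact mul_le_mul_of_nonneg_right (hC ξ) (norm_nonneg _)⟩

/-! ### Sobolev bounds on the Fourier side -/

/-- The weight `(1 + 2π|ξ|)^k`. -/
def weight (k : ℕ) (ξ : ℝ) : ℝ := (1 + 2 * Real.pi * |ξ|) ^ k

theorem one_le_weight (k : ℕ) (ξ : ℝ) : 1 ≤ weight k ξ :=
  one_le_pow₀ (le_add_of_nonneg_right (by positivity))

theorem weight_nonneg (k : ℕ) (ξ : ℝ) : 0 ≤ weight k ξ := zero_le_one.trans (one_le_weight k ξ)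

theorem weight_succ (k : ℕ) (ξ : ℝ) :
    weight (k + 1) ξ = weight k ξ + 2 * Real.pi * |ξ| * weight k ξ := by
  unfold weight; ring

theorem continuous_weight (k : ℕ) : Continuous (weight k) := by unfold weight; fun_prop

/-- The weight truncated to the frequencies `|ξ| ≤ N`. -/
def truncWeight (k N : ℕ) (ξ : ℝ) : ℂ := if |ξ| ≤ N then (weight k ξ : ℂ) else 0

theorem norm_truncWeight (k N : ℕ) (ξ : ℝ) :
    ‖truncWeight k N ξ‖ = if |ξ| ≤ N then weight k ξ else 0 := by
  unfold truncWeight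
  split_ifs
  · rw [Complex.norm_real, Real.norm_eq_abs, abs_of_nonneg (weight_nonneg k ξ)]
  · simp

theorem norm_truncWeight_le (k N : ℕ) (ξ : ℝ) : ‖truncWeight k N ξ‖ ≤ weight k ξ := by
  rw [norm_truncWeight]
  split_ifs
  · exact le_rfl
  · exact weight_nonneg k ξ

theorem norm_truncWeight_le_const (k N : ℕ) (ξ : ℝ) : ‖truncWeight k N ξ‖ ≤ weight k N := by
  rw [norm_truncWeight]
  split_ifs with h
  · unfold weight
    refine pow_le_pow_left₀ (by positivity) ?_ k
    have := mul_le_mul_of_nonneg_left (h.trans (le_abs_self (N : ℝ))) Real.two_pi_pos.le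
    linarith
  · exact weight_nonneg k _

theorem measurable_truncWeight (k N : ℕ) : Measurable (truncWeight k N) :=
  Measurable.ite (measurableSet_le (by fun_prop) measurable_const)
    (Complex.measurable_ofReal.comp (continuous_weight k).measurable) measurable_const

theorem isMultiplier_truncWeight (k N : ℕ) : IsMultiplier (scalarMul (truncWeight k N)) :=
  isMultiplier_scalarMul (measurable_truncWeight k N) (norm_truncWeight_le_const k N)

/-- The truncated weight as an operator. -/
def weightOp (k N : ℕ) : L2 →L[ℂ] L2 :=
  mulOp (scalarMul (truncWeight k N)) (isMultiplier_truncWeight k N)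

theorem coeFn_weightOp (k N : ℕ) (f : L2) :
    (weightOp k N f : ℝ → C2) =ᵐ[volume] fun ξ => truncWeight k N ξ • f ξ :=
  coeFn_mulOp _ f

/-- `w` lies in `H^k` and `‖(1 + 2π|ξ|)^k 𝓕 w‖ ≤ r`. -/
def SobolevLE (k : ℕ) (r : ℝ) (w : L2) : Prop := ∀ N, ‖weightOp k N (𝓕 w)‖ ≤ r

variable {k l : ℕ} {r r' : ℝ} {w w' : L2}

theorem SobolevLE.nonneg (h : SobolevLE k r w) : 0 ≤ r := (norm_nonneg _).trans (h 0)

theorem SobolevLE.mono (h : SobolevLE k r w) (hr : r ≤ r') : SobolevLE k r' w :=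
  fun N => (h N).trans hr

/-- Comparison of Sobolev bounds from a pointwise comparison of Fourier transforms. -/
theorem SobolevLE.of_fourier_le {c : ℝ} (hc : 0 ≤ c) (h : SobolevLE l r w')
    (hle : ∀ᵐ ξ, weight k ξ * ‖(𝓕 w : L2) ξ‖ ≤ c * (weight l ξ * ‖(𝓕 w' : L2) ξ‖)) :
    SobolevLE k (c * r) w := fun N => by
  refine (norm_mulOp_apply_le_mulOp (isMultiplier_truncWeight k N) (isMultiplier_truncWeight l N)
    (g := 𝓕 w') (c := c) ?_).trans (mul_le_mul_of_nonneg_left (h N) hc)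
  filter_upwards [hle] with ξ hξ
  simp only [scalarMul_apply, norm_smul, norm_truncWeight]
  split_ifs
  · exact hξ
  · simp

theorem SobolevLE.mono_order (h : SobolevLE k r w) (hl : l ≤ k) : SobolevLE l r w := by
  have := h.of_fourier_le (k := l) (w := w) zero_le_one (ae_of_all _ fun ξ => ?_)
  · simpa using this
  · rw [one_mul]
    refine mul_le_mul_of_nonneg_right ?_ (norm_nonneg _)
    exact pow_le_pow_right₀ (le_add_of_nonneg_right (by positivity)) hl

theorem SobolevLE.add (h : SobolevLE k r w) (h' : SobolevLE k r' w') :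
    SobolevLE k (r + r') (w + w') := fun N => by
  rw [FourierTransform.fourier_add, map_add]
  exact (norm_add_le _ _).trans (add_le_add (h N) (h' N))

theorem SobolevLE.smul (h : SobolevLE k r w) (c : ℂ) : SobolevLE k (‖c‖ * r) (c • w) := fun N => by
  rw [FourierTransform.fourier_smul, map_smul, norm_smul]
  exact mul_le_mul_of_nonneg_left (h N) (norm_nonneg _)

theorem SobolevLE.neg (h : SobolevLE k r w) : SobolevLE k r (-w) := by
  simpa using h.smul (-1)

theorem SobolevLE.sub (h : SobolevLE k r w) (h' : SobolevLE k r' w') :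
    SobolevLE k (r + r') (w - w') := by
  rw [sub_eq_add_neg]; exact h.add h'.neg

theorem sobolevLE_zero_right (k : ℕ) : SobolevLE k 0 0 := fun N => by
  have : (𝓕 (0 : L2) : L2) = 0 := by
    have h := FourierTransform.fourier_smul (0 : ℂ) (0 : L2)
    simpa only [zero_smul] using h
  rw [this, map_zero, norm_zero]

/-- Sobolev bounds are closed under limits in `L²`. -/
theorem SobolevLE.of_tendsto {u : ℕ → L2} (h : ∀ n, SobolevLE k r (u n))
    (hu : Tendsto u atTop (𝓝 w)) : SobolevLE k r w := fun N => by
  have hc : Continuous fun f : L2 => ‖weightOp k N (𝓕 f : L2)‖ :=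
    ((weightOp k N).continuous.comp
      (Lp.fourierTransformₗᵢ ℝ C2).continuous).norm
  exact le_of_tendsto ((hc.tendsto w).comp hu) (Eventually.of_forall fun n => h n N)

/-- A Sobolev bound controls the weighted `L²` norm. -/
theorem SobolevLE.eLpNorm_le (h : SobolevLE k r w) :
    eLpNorm (fun ξ => (weight k ξ : ℂ) • (𝓕 w : L2) ξ) 2 volume ≤ ENNReal.ofReal r := by
  -- At each frequency the truncation is eventually inactive, so lower semicontinuity of the norm
  -- carries the bounds, uniform in N, over to the full weight.
  have hlim : ∀ᵐ ξ : ℝ, Tendsto (fun N : ℕ => weightOp k N (𝓕 w) ξ) atTop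
      (𝓝 ((weight k ξ : ℂ) • (𝓕 w : L2) ξ)) := by
    have hall : ∀ᵐ ξ : ℝ, ∀ N : ℕ, weightOp k N (𝓕 w) ξ = truncWeight k N ξ • (𝓕 w : L2) ξ :=
      ae_all_iff.2 fun N => coeFn_weightOp k N (𝓕 w)
    filter_upwards [hall] with ξ hξ
    refine tendsto_const_nhds.congr' ?_
    filter_upwards [eventually_ge_atTop ⌈|ξ|⌉₊] with N hN
    rw [hξ, truncWeight, if_pos (Nat.ceil_le.1 hN)]
  refine (Lp.eLpNorm_lim_le_liminf_eLpNorm (fun N => Lp.aestronglyMeasurable _) _ hlim).trans ?_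
  refine (liminf_le_liminf (v := fun _ => ENNReal.ofReal r)
    (Eventually.of_forall fun N => ?_)).trans (by simp)
  have := h N
  rw [Lp.norm_def] at this
  exact (ENNReal.le_ofReal_iff_toReal_le (Lp.eLpNorm_ne_top _) h.nonneg).2 this

theorem SobolevLE.norm_le (h : SobolevLE k r w) : ‖w‖ ≤ r := by
  rw [← Lp.norm_fourier_eq, Lp.norm_def]
  refine ENNReal.toReal_le_of_le_ofReal h.nonneg (le_trans ?_ h.eLpNorm_le)
  refine eLpNorm_mono fun ξ => ?_
  rw [norm_smul, Complex.norm_real, Real.norm_eq_abs, abs_of_nonneg (weight_nonneg k ξ)]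
  exact le_mul_of_one_le_left (norm_nonneg _) (one_le_weight k ξ)

theorem sobolevLE_zero_order (w : L2) : SobolevLE 0 ‖w‖ w := fun N => by
  have := norm_mulOp_apply_le (isMultiplier_truncWeight 0 N) (f := 𝓕 w) (g := 𝓕 w) (c := 1)
    (ae_of_all _ fun ξ => ?_)
  · simpa [weightOp] using this
  · rw [scalarMul_apply, norm_smul]
    refine mul_le_mul_of_nonneg_right ((norm_truncWeight_le 0 N ξ).trans ?_) (norm_nonneg _)
    simp [weight]

theorem norm_two_pi_I_mul (ξ : ℝ) : ‖(2 * Real.pi * Complex.I * ξ : ℂ)‖ = 2 * Real.pi * |ξ| := by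
  simp [abs_of_pos Real.pi_pos]

/-- One factor of the weight dominates 2πiξ, so the function with Fourier transform 2πiξ 𝓕w is in
L², and the other k factors are left to bound it. -/
theorem SobolevLE.exists_isWeakDeriv (h : SobolevLE (k + 1) r w) :
    ∃ v, IsWeakDeriv w v ∧ SobolevLE k r v := by
  have hm : MemLp (fun ξ : ℝ => (2 * Real.pi * Complex.I * ξ : ℂ) • (𝓕 w : L2) ξ) 2 volume := by
    have h1 : MemLp (fun ξ => (weight (k + 1) ξ : ℂ) • (𝓕 w : L2) ξ) 2 volume :=
      ⟨((Complex.continuous_ofReal.comp (continuous_weight _)).aestronglyMeasurable).smul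
        (Lp.aestronglyMeasurable _), h.eLpNorm_le.trans_lt ENNReal.ofReal_lt_top⟩
    refine h1.mono ?_ (ae_of_all _ fun ξ => ?_)
    · exact (Continuous.aestronglyMeasurable (f := fun ξ : ℝ => (2 * Real.pi * Complex.I * ξ : ℂ))
        (by fun_prop)).smul (Lp.aestronglyMeasurable _)
    · rw [norm_smul, norm_smul, norm_two_pi_I_mul, Complex.norm_real, Real.norm_eq_abs,
        abs_of_nonneg (weight_nonneg _ ξ), weight_succ]
      refine mul_le_mul_of_nonneg_right ?_ (norm_nonneg _)
      have h1 := one_le_weight k ξ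
      have h2 : 0 ≤ 2 * Real.pi * |ξ| := by positivity
      nlinarith
  have hF : ((𝓕 (𝓕⁻ hm.toLp : L2) : L2) : ℝ → C2) =ᵐ[volume]
      fun ξ => (2 * Real.pi * Complex.I * ξ : ℂ) • (𝓕 w : L2) ξ := by
    rw [FourierTransform.fourier_fourierInv_eq]
    exact hm.coeFn_toLp
  refine ⟨𝓕⁻ hm.toLp, isWeakDeriv_iff.2 hF, ?_⟩
  have := h.of_fourier_le (k := k) (w := 𝓕⁻ hm.toLp) zero_le_one ?_
  · simpa using this
  · filter_upwards [hF] with ξ hξ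
    rw [hξ, norm_smul, norm_two_pi_I_mul, weight_succ, one_mul]
    have h1 := weight_nonneg k ξ
    have h2 := norm_nonneg ((𝓕 w : L2) ξ)
    nlinarith [mul_nonneg h1 h2]

/-- One factor of the weight is split as 1 + 2π|ξ|: the first term leaves 𝓕w, the second turns it,
in norm, into 𝓕v. -/
theorem SobolevLE.succ {v : L2} (hv : IsWeakDeriv w v) (h : SobolevLE k r w)
    (h' : SobolevLE k r' v) : SobolevLE (k + 1) (r + r') w := fun N => by
  have hF := isWeakDeriv_iff.1 hv
  have hle : eLpNorm (weightOp (k + 1) N (𝓕 w)) 2 volume ≤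
      eLpNorm (fun ξ => ‖weightOp k N (𝓕 w) ξ‖ + ‖weightOp k N (𝓕 v) ξ‖) 2 volume := by
    refine eLpNorm_mono_ae ?_
    filter_upwards [hF, coeFn_weightOp (k + 1) N (𝓕 w), coeFn_weightOp k N (𝓕 w),
      coeFn_weightOp k N (𝓕 v)] with ξ h1 h2 h3 h4
    rw [h2, h3, h4, h1, Real.norm_of_nonneg (by positivity), norm_smul, norm_smul, norm_smul,
      norm_smul, norm_two_pi_I_mul, norm_truncWeight, norm_truncWeight]
    split_ifs
    · rw [weight_succ]
      exact le_of_eq (by ring)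
    · simp
  have hle2 := hle.trans (eLpNorm_add_le (Lp.aestronglyMeasurable _).norm
    (Lp.aestronglyMeasurable _).norm (by norm_num))
  rw [eLpNorm_norm, eLpNorm_norm] at hle2
  rw [Lp.norm_def]
  refine (ENNReal.toReal_mono (ENNReal.add_ne_top.2 ⟨Lp.eLpNorm_ne_top _, Lp.eLpNorm_ne_top _⟩)
    hle2).trans ?_
  rw [ENNReal.toReal_add (Lp.eLpNorm_ne_top _) (Lp.eLpNorm_ne_top _), ← Lp.norm_def, ← Lp.norm_def]
  exact add_le_add (h N) (h' N)

theorem SobolevLE.memH (h : SobolevLE k r w) : MemH k w := by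
  induction k generalizing w with
  | zero => trivial
  | succ k ih =>
    obtain ⟨v, hv, hk⟩ := h.exists_isWeakDeriv
    exact ⟨v, hv, ih hk⟩

theorem SobolevLE.norm_iterate_weakDeriv_le (h : SobolevLE k r w) {j : ℕ} (hj : j ≤ k) :
    ‖weakDeriv^[j] w‖ ≤ r := by
  induction j generalizing w k with
  | zero => exact h.norm_le
  | succ j ih =>
    obtain ⟨k, rfl⟩ : ∃ i, k = i + 1 := ⟨k - 1, by omega⟩
    obtain ⟨v, hv, hk⟩ := h.exists_isWeakDeriv
    rw [Function.iterate_succ_apply, hv.weakDeriv_eq]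
    exact ih hk (by omega)

theorem MemH.sobolevLE (hw : MemH k w) (h : ∀ j ≤ k, ‖weakDeriv^[j] w‖ ≤ r) :
    SobolevLE k (2 ^ k * r) w := by
  induction k generalizing w with
  | zero => simpa using (sobolevLE_zero_order w).mono (h 0 le_rfl)
  | succ k ih =>
    obtain ⟨v, hv, hk⟩ := hw
    have h1 : ∀ j ≤ k, ‖weakDeriv^[j] v‖ ≤ r := fun j hj => by
      simpa [Function.iterate_succ_apply, hv.weakDeriv_eq] using h (j + 1) (by omega)
    -- `MemH` recurses on the derivative, so giving up the top order takes an induction of its own.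
    have hk' : MemH k w := by
      clear ih h h1
      induction k generalizing w v with
      | zero => trivial
      | succ k ihk =>
        obtain ⟨v', hv', hk'⟩ := hk
        exact ⟨v, hv, ihk v' hv' hk'⟩
    refine ((ih hk' fun j hj => h j (by omega)).succ hv (ih hk h1)).mono (le_of_eq ?_)
    ring

theorem SobolevLE.normH_le (h : SobolevLE k r w) : normH k w ≤ (k + 1) * r := by
  unfold normH
  refine Real.sqrt_le_iff.2 ⟨mul_nonneg (by positivity) h.nonneg, ?_⟩
  calc ∑ j ∈ Finset.range (k + 1), ‖weakDeriv^[j] w‖ ^ 2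
      ≤ ∑ _j ∈ Finset.range (k + 1), r ^ 2 := by
        refine Finset.sum_le_sum fun j hj => ?_
        have := h.norm_iterate_weakDeriv_le (Nat.lt_succ_iff.1 (Finset.mem_range.1 hj))
        gcongr
    _ = (k + 1) * r ^ 2 := by simp
    _ ≤ ((k + 1) * r) ^ 2 := by
        have hk : (0 : ℝ) ≤ k := Nat.cast_nonneg k
        have := h.nonneg
        nlinarith [mul_nonneg hk (sq_nonneg r), mul_nonneg (mul_nonneg hk hk) (sq_nonneg r)]

theorem norm_iterate_weakDeriv_le_normH (k : ℕ) (w : L2) {j : ℕ} (hj : j ≤ k) :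
    ‖weakDeriv^[j] w‖ ≤ normH k w := by
  refine Real.le_sqrt_of_sq_le ?_
  exact Finset.single_le_sum (f := fun j => ‖weakDeriv^[j] w‖ ^ 2) (fun _ _ => sq_nonneg _)
    (Finset.mem_range.2 (Nat.lt_succ_iff.2 hj))

theorem MemH.sobolevLE_normH (hw : MemH k w) : SobolevLE k (2 ^ k * normH k w) w :=
  hw.sobolevLE fun _ hj => norm_iterate_weakDeriv_le_normH k w hj

/-! ### Sobolev bounds of smooth functions -/

theorem exists_toLp_of_sobolevBound {f : ℝ → C2} (hf : ContDiff ℝ ∞ f) {r : ℝ≥0}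
    (h : SobolevBound k r f) : ∃ w : L2, w =ᵐ[volume] f := by
  have hm : MemLp f 2 volume := by simpa using h.memLp hf (Nat.zero_le k)
  exact ⟨hm.toLp, hm.coeFn_toLp⟩

theorem norm_le_of_ae_eq {f : ℝ → C2} {r : ℝ≥0} (h : eLpNorm f 2 volume ≤ r)
    (hw : w =ᵐ[volume] f) : ‖w‖ ≤ r := by
  rw [Lp.norm_def, eLpNorm_congr_ae hw]
  exact ENNReal.toReal_le_coe_of_le_coe h

theorem SobolevBound.sobolevLE {f : ℝ → C2} (hf : ContDiff ℝ ∞ f) {r : ℝ≥0}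
    (h : SobolevBound k r f) (hw : w =ᵐ[volume] f) : SobolevLE k (2 ^ k * r) w := by
  induction k generalizing w f with
  | zero => simpa using (sobolevLE_zero_order w).mono (norm_le_of_ae_eq (sobolevBound_zero.1 h) hw)
  | succ k ih =>
    have h' := sobolevBound_succ.1 h
    obtain ⟨v, hv⟩ := exists_toLp_of_sobolevBound (contDiff_deriv hf) h'.2
    refine ((ih hf (h.mono (Nat.le_succ k) le_rfl) hw).succ
      (isWeakDeriv_of_contDiff hf hw hv) (ih (contDiff_deriv hf) h'.2 hv)).mono (le_of_eq ?_)
    ring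

/-- For a smooth function the classical bounds follow from the Fourier ones. -/
theorem SobolevLE.sobolevBound {f : ℝ → C2} (hf : ContDiff ℝ ∞ f) {r : ℝ≥0}
    (hr : SobolevLE k r w) (hw : w =ᵐ[volume] f) : SobolevBound k r f := by
  have h0 : eLpNorm f 2 volume ≤ r := by
    have := hr.norm_le
    rw [Lp.norm_def] at this
    rw [← eLpNorm_congr_ae hw, ← ENNReal.ofReal_coe_nnreal]
    exact (ENNReal.le_ofReal_iff_toReal_le (Lp.eLpNorm_ne_top w) r.coe_nonneg).2 this
  induction k generalizing w f with
  | zero => exact sobolevBound_zero.2 h0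
  | succ k ih =>
    obtain ⟨v, hv, hr'⟩ := hr.exists_isWeakDeriv
    have hvf := hv.ae_eq_deriv hf hw
    refine sobolevBound_succ.2 ⟨h0, ih (contDiff_deriv hf) hr' hvf ?_⟩
    have := hr'.norm_le
    rw [Lp.norm_def] at this
    rw [← eLpNorm_congr_ae hvf, ← ENNReal.ofReal_coe_nnreal]
    exact (ENNReal.le_ofReal_iff_toReal_le (Lp.eLpNorm_ne_top v) r.coe_nonneg).2 this

end

end NLQW

namespace NLQW

open scoped NNReal

noncomputable section

/-! ### Band-limited functions -/

/-- The Fourier transform of `w` vanishes outside the band. -/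
def BandLimited (δ : ℝ) (w : L2) : Prop := ∀ᵐ ξ, ξ ∉ band δ → (𝓕 w : L2) ξ = 0

variable {k : ℕ} {r δ : ℝ} {w : L2}

/-- On the bounded band powers are bounded and L² is contained in L¹. Finiteness of all these
moments makes the inverse Fourier transform smooth. -/
theorem BandLimited.integrable_pow_mul (hw : BandLimited δ w) (n : ℕ) :
    Integrable (fun ξ : ℝ => ‖ξ‖ ^ n * ‖(𝓕 w : L2) ξ‖) volume := by
  have h1 : IntegrableOn (fun ξ : ℝ => ‖(𝓕 w : L2) ξ‖) (band δ) volume := by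
    have : IsFiniteMeasure ((volume : Measure ℝ).restrict (band δ)) := ⟨by simp [band]⟩
    exact (((Lp.memLp (𝓕 w : L2)).restrict (band δ)).integrable (by norm_num)).norm
  have h2 : IntegrableOn (fun ξ : ℝ => ‖ξ‖ ^ n * ‖(𝓕 w : L2) ξ‖) (band δ) volume :=
    h1.continuousOn_mul_of_subset (K := band δ)
      (Continuous.continuousOn (f := fun ξ : ℝ => ‖ξ‖ ^ n) (by fun_prop))
      isCompact_Icc (measurableSet_band δ) subset_rfl
  refine (h2.integrable_indicator (measurableSet_band δ)).congr ?_
  filter_upwards [hw] with ξ hξ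
  by_cases h : ξ ∈ band δ
  · rw [Set.indicator_of_mem h]
  · rw [Set.indicator_of_notMem h, hξ h]; simp

theorem BandLimited.integrable_fourier (hw : BandLimited δ w) :
    Integrable ((𝓕 w : L2) : ℝ → C2) volume := by
  have h := hw.integrable_pow_mul 0
  simp only [pow_zero, one_mul] at h
  exact (integrable_norm_iff (Lp.aestronglyMeasurable _)).1 h

/-- A band-limited function is smooth. -/
theorem BandLimited.contDiff_fourierInv (hw : BandLimited δ w) :
    ContDiff ℝ ∞ (𝓕⁻ ((𝓕 w : L2) : ℝ → C2)) := by
  have h := Real.contDiff_fourier (N := ⊤) (fun n _ => hw.integrable_pow_mul n)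
  have h' : 𝓕⁻ ((𝓕 w : L2) : ℝ → C2) = fun x => 𝓕 ((𝓕 w : L2) : ℝ → C2) (-x) := by
    ext1 x
    exact Real.fourierInv_eq_fourier_neg _ x
  rw [h']
  exact h.comp contDiff_neg

/-- The Fourier inversion formula for band-limited functions. -/
theorem BandLimited.ae_eq_fourierInv (hw : BandLimited δ w) :
    w =ᵐ[volume] 𝓕⁻ ((𝓕 w : L2) : ℝ → C2) := by
  have hint := hw.integrable_fourier
  refine ae_eq_of_schwartz_integral_eq ((Lp.memLp w).locallyIntegrable (by norm_num))
    hw.contDiff_fourierInv.continuous.locallyIntegrable fun φ => ?_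
  have h1 : ∫ x, φ x • w x = ∫ ξ, (𝓕⁻ φ) ξ • (𝓕 w : L2) ξ := by
    rw [← Lp.toTemperedDistribution_apply, ← Lp.toTemperedDistribution_apply,
      ← TemperedDistribution.fourierInv_apply, Lp.fourierInv_toTemperedDistribution_eq,
      FourierTransform.fourierInv_fourier_eq]
  have h2 : ∫ ξ, (𝓕⁻ φ) ξ • (𝓕 w : L2) ξ = ∫ ξ, 𝓕 (φ : ℝ → ℂ) ξ • (𝓕 w : L2) (-ξ) := by
    rw [← integral_neg_eq_self]
    refine integral_congr_ae (ae_of_all _ fun ξ => ?_)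
    simp only [SchwartzMap.fourierInv_coe, Real.fourierInv_eq_fourier_neg, neg_neg]
  have h3 : 𝓕⁻ ((𝓕 w : L2) : ℝ → C2) = 𝓕 (fun ξ => (𝓕 w : L2) (-ξ)) :=
    Real.fourierInv_eq_fourier_comp_neg _
  rw [h1, h2, h3]
  have := VectorFourier.integral_fourierIntegral_smul_eq_flip (L := innerₗ ℝ)
    (μ := volume) (ν := volume) Real.continuous_fourierChar continuous_inner φ.integrable
    hint.comp_neg
  simpa using! this

theorem fourier_bandLimit (δ : ℝ) (u : L2) :
    ((𝓕 (bandLimit δ u) : L2) : ℝ → C2) =ᵐ[volume] (band δ).indicator (𝓕 u : L2) := by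
  unfold bandLimit
  rw [FourierTransform.fourier_fourierInv_eq]
  exact MemLp.coeFn_toLp _

theorem bandLimited_bandLimit (δ : ℝ) (u : L2) : BandLimited δ (bandLimit δ u) := by
  filter_upwards [fourier_bandLimit δ u] with ξ h1 h2
  rw [h1, Set.indicator_of_notMem h2]

theorem SobolevLE.bandLimit (h : SobolevLE k r w) (δ : ℝ) : SobolevLE k r (bandLimit δ w) := by
  have := h.of_fourier_le (k := k) (w := NLQW.bandLimit δ w) zero_le_one ?_
  · simpa using this
  · filter_upwards [fourier_bandLimit δ w] with ξ hξ
    rw [hξ, one_mul]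
    exact mul_le_mul_of_nonneg_left (norm_indicator_le_norm_self _ _) (weight_nonneg k ξ)

theorem fourier_sub (u v : L2) : (𝓕 (u - v) : L2) = (𝓕 u : L2) - (𝓕 v : L2) :=
  (Lp.fourierTransformₗᵢ ℝ C2).map_sub u v

/-- What is cut off lives at |ξ| > 1/(2δ), where 1 ≤ 2πδ|ξ|: one factor of the weight pays for one
factor δ. -/
theorem SobolevLE.sub_bandLimit (hδ : 0 < δ) (h : SobolevLE (k + 1) r w) :
    SobolevLE k (δ * r) (w - NLQW.bandLimit δ w) := by
  refine h.of_fourier_le hδ.le ?_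
  rw [fourier_sub]
  filter_upwards [fourier_bandLimit δ w, Lp.coeFn_sub (𝓕 w : L2) (𝓕 (NLQW.bandLimit δ w) : L2)]
    with ξ h1 h2
  rw [h2, Pi.sub_apply, h1]
  by_cases hξ : ξ ∈ band δ
  · rw [Set.indicator_of_mem hξ, sub_self, norm_zero, mul_zero]
    have := weight_nonneg (k + 1) ξ
    positivity
  · rw [Set.indicator_of_notMem hξ, sub_zero, weight_succ, ← mul_assoc]
    refine mul_le_mul_of_nonneg_right ?_ (norm_nonneg _)
    have hlt : 1 / (2 * δ) < |ξ| := by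
      by_contra hle
      exact hξ (abs_le.1 (not_lt.1 hle))
    rw [div_lt_iff₀ (by positivity)] at hlt
    have h3 : 1 ≤ δ * (2 * Real.pi * |ξ|) := by
      have := Real.pi_gt_three
      nlinarith [abs_nonneg ξ, mul_nonneg hδ.le (abs_nonneg ξ)]
    have h4 := weight_nonneg k ξ
    nlinarith [mul_nonneg hδ.le h4]

/-- `w ∈ H¹` is the limit of its band-limited parts. -/
theorem SobolevLE.tendsto_bandLimit (h : SobolevLE 1 r w) :
    Tendsto (fun n : ℕ => NLQW.bandLimit (1 / ((n : ℝ) + 1)) w) atTop (𝓝 w) := by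
  rw [tendsto_iff_norm_sub_tendsto_zero]
  have hlim : Tendsto (fun n : ℕ => 1 / ((n : ℝ) + 1) * r) atTop (𝓝 0) := by
    simpa using tendsto_one_div_add_atTop_nhds_zero_nat.mul_const r
  refine squeeze_zero (fun _ => norm_nonneg _) (fun n => ?_) hlim
  rw [norm_sub_rev]
  exact (SobolevLE.sub_bandLimit (by positivity) h).norm_le

end

end NLQW

namespace NLQW

open scoped NNReal

noncomputable section

/-! ### The free Dirac group -/

/-- The projection of `ℂ²` on its `i`-th component. -/
def compProj (i : Fin 2) : C2 →L[ℂ] C2 :=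
  (EuclideanSpace.proj i : C2 →L[ℂ] ℂ).smulRight (EuclideanSpace.single i (1 : ℂ))

theorem compProj_apply (i j : Fin 2) (z : C2) : compProj i z j = if j = i then z i else 0 := by
  simp [compProj, PiLp.single_apply]

/-- The diagonal matrix with entries `a`, `b`. -/
def diagCLM (a b : ℂ) : C2 →L[ℂ] C2 := a • compProj 0 + b • compProj 1

@[simp]
theorem diagCLM_apply_zero (a b : ℂ) (z : C2) : diagCLM a b z 0 = a * z 0 := by
  simp [diagCLM, compProj_apply]

@[simp]
theorem diagCLM_apply_one (a b : ℂ) (z : C2) : diagCLM a b z 1 = b * z 1 := by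
  simp [diagCLM, compProj_apply]

theorem C2.ext {z w : C2} (h0 : z 0 = w 0) (h1 : z 1 = w 1) : z = w := by
  ext i
  fin_cases i
  · exact h0
  · exact h1

theorem norm_C2_sq (z : C2) : ‖z‖ ^ 2 = ‖z 0‖ ^ 2 + ‖z 1‖ ^ 2 := by
  rw [EuclideanSpace.norm_sq_eq, Fin.sum_univ_two]

theorem norm_diagCLM_apply_le {a b : ℂ} {c : ℝ} (ha : ‖a‖ ≤ c) (hb : ‖b‖ ≤ c) (z : C2) :
    ‖diagCLM a b z‖ ≤ c * ‖z‖ := by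
  have hc : 0 ≤ c := (norm_nonneg _).trans ha
  refine abs_le_of_sq_le_sq' ?_ (by positivity) |>.2
  rw [mul_pow, norm_C2_sq, norm_C2_sq, diagCLM_apply_zero, diagCLM_apply_one, norm_mul, norm_mul,
    mul_pow, mul_pow, mul_add]
  gcongr

/-- The symbol of the free Dirac group, `diag(e^{-2πiτξ}, e^{2πiτξ})`. -/
def propSymbol (τ ξ : ℝ) : C2 →L[ℂ] C2 :=
  diagCLM (Complex.exp ((-(2 * Real.pi * τ * ξ) : ℝ) * Complex.I))
    (Complex.exp ((2 * Real.pi * τ * ξ : ℝ) * Complex.I))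

theorem norm_propSymbol_apply (τ ξ : ℝ) (z : C2) : ‖propSymbol τ ξ z‖ = ‖z‖ := by
  have h : ‖propSymbol τ ξ z‖ ^ 2 = ‖z‖ ^ 2 := by
    rw [norm_C2_sq, norm_C2_sq z, propSymbol, diagCLM_apply_zero, diagCLM_apply_one, norm_mul,
      norm_mul, Complex.norm_exp_ofReal_mul_I, Complex.norm_exp_ofReal_mul_I, one_mul, one_mul]
  exact (sq_eq_sq₀ (norm_nonneg _) (norm_nonneg _)).1 h

theorem propSymbol_add (τ σ ξ : ℝ) (z : C2) :
    propSymbol τ ξ (propSymbol σ ξ z) = propSymbol (τ + σ) ξ z := by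
  refine C2.ext ?_ ?_
  · simp only [propSymbol, diagCLM_apply_zero]
    rw [← mul_assoc, ← Complex.exp_add]
    congr 2
    push_cast
    ring
  · simp only [propSymbol, diagCLM_apply_one]
    rw [← mul_assoc, ← Complex.exp_add]
    congr 2
    push_cast
    ring

theorem propSymbol_zero (ξ : ℝ) (z : C2) : propSymbol 0 ξ z = z := by
  refine C2.ext ?_ ?_ <;> simp [propSymbol]

theorem continuous_propSymbol (τ : ℝ) : Continuous (propSymbol τ) := by
  unfold propSymbol diagCLM; fun_prop

theorem isMultiplier_propSymbol (τ : ℝ) : IsMultiplier (propSymbol τ) :=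
  ⟨(continuous_propSymbol τ).aestronglyMeasurable, 1, fun ξ =>
    ContinuousLinearMap.opNorm_le_bound _ zero_le_one fun z => by
      rw [norm_propSymbol_apply, one_mul]⟩

/-- The free Dirac group `e^{-τ σ₃ ∂ₓ}`. -/
def prop (τ : ℝ) (w : L2) : L2 := 𝓕⁻ (mulOp (propSymbol τ) (isMultiplier_propSymbol τ) (𝓕 w))

variable {k : ℕ} {r δ τ : ℝ} {w : L2}

theorem fourier_prop (τ : ℝ) (w : L2) : (𝓕 (prop τ w) : L2) =
    mulOp (propSymbol τ) (isMultiplier_propSymbol τ) (𝓕 w) := by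
  unfold prop
  rw [FourierTransform.fourier_fourierInv_eq]

theorem coeFn_fourier_prop (τ : ℝ) (w : L2) :
    ((𝓕 (prop τ w) : L2) : ℝ → C2) =ᵐ[volume] fun ξ => propSymbol τ ξ ((𝓕 w : L2) ξ) := by
  rw [fourier_prop]
  exact coeFn_mulOp _ _

theorem fourier_injective : Function.Injective (fun w : L2 => (𝓕 w : L2)) :=
  (Lp.fourierTransformₗᵢ ℝ C2).injective

theorem prop_prop (τ σ : ℝ) (w : L2) : prop τ (prop σ w) = prop (τ + σ) w := by
  refine fourier_injective (Lp.ext ?_)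
  filter_upwards [coeFn_fourier_prop τ (prop σ w), coeFn_fourier_prop σ w,
    coeFn_fourier_prop (τ + σ) w] with ξ h1 h2 h3
  simp only [h1, h2, h3, propSymbol_add]

theorem prop_zero (w : L2) : prop 0 w = w := by
  refine fourier_injective (Lp.ext ?_)
  filter_upwards [coeFn_fourier_prop 0 w] with ξ h1
  simp only [h1, propSymbol_zero]

theorem prop_sub (τ : ℝ) (w w' : L2) : prop τ (w - w') = prop τ w - prop τ w' := by
  refine fourier_injective ?_
  simp only [fourier_prop, fourier_sub, map_sub]

theorem SobolevLE.prop (h : SobolevLE k r w) (τ : ℝ) : SobolevLE k r (prop τ w) := by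
  have := h.of_fourier_le (k := k) (w := NLQW.prop τ w) zero_le_one ?_
  · simpa using this
  · filter_upwards [coeFn_fourier_prop τ w] with ξ hξ
    rw [hξ, norm_propSymbol_apply, one_mul]

theorem norm_exp_mul_I_sub_one_le (θ : ℝ) : ‖Complex.exp (θ * Complex.I) - 1‖ ≤ |θ| := by
  rw [mul_comm]
  exact Real.norm_exp_I_mul_ofReal_sub_one_le

/-- The phases of the symbol differ from 1 by at most 2π|τ||ξ|, so one derivative buys a factor |τ|.
-/
theorem SobolevLE.prop_sub_self (h : SobolevLE (k + 1) r w) (τ : ℝ) :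
    SobolevLE k (|τ| * r) (NLQW.prop τ w - w) := by
  refine h.of_fourier_le (abs_nonneg τ) ?_
  rw [fourier_sub]
  filter_upwards [coeFn_fourier_prop τ w, Lp.coeFn_sub (𝓕 (NLQW.prop τ w) : L2) (𝓕 w : L2)]
    with ξ h1 h2
  rw [h2, Pi.sub_apply, h1]
  have h3 : propSymbol τ ξ ((𝓕 w : L2) ξ) - (𝓕 w : L2) ξ =
      diagCLM (Complex.exp ((-(2 * Real.pi * τ * ξ) : ℝ) * Complex.I) - 1)
        (Complex.exp ((2 * Real.pi * τ * ξ : ℝ) * Complex.I) - 1) ((𝓕 w : L2) ξ) := by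
    refine C2.ext ?_ ?_
    · simp only [propSymbol, PiLp.sub_apply, diagCLM_apply_zero]; ring
    · simp only [propSymbol, PiLp.sub_apply, diagCLM_apply_one]; ring
  have habs : |2 * Real.pi * τ * ξ| = 2 * Real.pi * |τ| * |ξ| := by
    rw [abs_mul, abs_mul, abs_of_pos Real.two_pi_pos]
  have h4 := norm_diagCLM_apply_le (c := 2 * Real.pi * |τ| * |ξ|)
    ((norm_exp_mul_I_sub_one_le _).trans (by rw [abs_neg, habs]))
    ((norm_exp_mul_I_sub_one_le _).trans habs.le) ((𝓕 w : L2) ξ)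
  rw [h3]
  refine (mul_le_mul_of_nonneg_left h4 (weight_nonneg k ξ)).trans ?_
  rw [weight_succ]
  have h5 := mul_nonneg (abs_nonneg τ) (mul_nonneg (weight_nonneg k ξ) (norm_nonneg ((𝓕 w : L2) ξ)))
  nlinarith

/-! ### Duhamel's formula -/

/-- `σ₃` as an operator. -/
def sigmaThree : C2 →L[ℂ] C2 := diagCLM 1 (-1)

/-- The weighted symbol of the group. -/
def duhamelSymbol (k N : ℕ) (τ ξ : ℝ) : C2 →L[ℂ] C2 := truncWeight k N ξ • propSymbol τ ξ

theorem isMultiplier_duhamelSymbol (k N : ℕ) (τ : ℝ) : IsMultiplier (duhamelSymbol k N τ) :=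
  ⟨(measurable_truncWeight k N).aestronglyMeasurable.smul
    (continuous_propSymbol τ).aestronglyMeasurable, weight k N, fun ξ => by
      refine ContinuousLinearMap.opNorm_le_bound _ (weight_nonneg _ _) fun z => ?_
      change ‖truncWeight k N ξ • propSymbol τ ξ z‖ ≤ _
      rw [norm_smul, norm_propSymbol_apply]
      exact mul_le_mul_of_nonneg_right (norm_truncWeight_le_const k N ξ) (norm_nonneg _)⟩

/-- The derivative of the weighted symbol along `τ = a - t`. -/
def duhamelSymbolDeriv (k N : ℕ) (τ ξ : ℝ) : C2 →L[ℂ] C2 :=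
  (truncWeight k N ξ * (2 * Real.pi * Complex.I * ξ)) • (propSymbol τ ξ ∘L sigmaThree)

theorem norm_truncWeight_mul_le (k N : ℕ) (ξ : ℝ) {θ : ℝ} (hθ : |ξ| ≤ N → |θ| ≤ 1) :
    ‖truncWeight k N ξ * (Complex.exp (θ * Complex.I) - 1 - θ * Complex.I)‖
      ≤ weight k N * |θ| ^ 2 := by
  by_cases hξ : |ξ| ≤ N
  · rw [norm_mul]
    have h := Complex.norm_exp_sub_one_sub_id_le (x := θ * Complex.I) (by simpa using hθ hξ)
    simp only [norm_mul, Complex.norm_I, mul_one, Complex.norm_real, Real.norm_eq_abs] at h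
    exact mul_le_mul (norm_truncWeight_le_const k N ξ) h (norm_nonneg _) (weight_nonneg _ _)
  · rw [truncWeight, if_neg hξ, zero_mul, norm_zero]
    have := weight_nonneg k N
    positivity

theorem isMultiplier_duhamelSymbolDeriv (k N : ℕ) (τ : ℝ) :
    IsMultiplier (duhamelSymbolDeriv k N τ) := by
  refine ⟨?_, weight k N * (2 * Real.pi * N), fun ξ => ?_⟩
  · exact AEStronglyMeasurable.smul (𝕜 := ℂ)
      ((measurable_truncWeight k N).mul (by fun_prop :
        Measurable fun ξ : ℝ => (2 * Real.pi * Complex.I * ξ : ℂ))).aestronglyMeasurable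
      ((continuous_propSymbol τ).clm_comp continuous_const).aestronglyMeasurable
  · refine ContinuousLinearMap.opNorm_le_bound _
      (mul_nonneg (weight_nonneg _ _) (by positivity)) fun z => ?_
    change ‖(truncWeight k N ξ * (2 * Real.pi * Complex.I * ξ)) •
      propSymbol τ ξ (sigmaThree z)‖ ≤ _
    rw [norm_smul, norm_propSymbol_apply]
    have h1 : ‖sigmaThree z‖ ≤ ‖z‖ := by
      simpa [sigmaThree] using norm_diagCLM_apply_le (c := 1) (a := 1) (b := -1) (by simp) (by simp) z
    refine mul_le_mul ?_ h1 (norm_nonneg _) (mul_nonneg (weight_nonneg _ _) (by positivity))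
    rw [norm_mul, norm_two_pi_I_mul]
    by_cases hξ : |ξ| ≤ N
    · refine mul_le_mul (norm_truncWeight_le_const k N ξ) ?_ (by positivity) (weight_nonneg _ _)
      gcongr
    · rw [truncWeight, if_neg hξ, norm_zero, zero_mul]
      exact mul_nonneg (weight_nonneg _ _) (by positivity)

/-- The weighted group as an operator, and its derivative in time. -/
def duhamelOp (k N : ℕ) (τ : ℝ) : L2 →L[ℂ] L2 :=
  mulOp (duhamelSymbol k N τ) (isMultiplier_duhamelSymbol k N τ)

theorem duhamelOp_fourier (k N : ℕ) (τ : ℝ) (w : L2) :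
    duhamelOp k N τ (𝓕 w) = weightOp k N (𝓕 (NLQW.prop τ w)) := by
  refine mulOp_congr_apply _ _ ?_
  filter_upwards [coeFn_fourier_prop τ w] with ξ h
  rw [h]
  rfl

/-- Truncation to |ξ| ≤ N makes the generator bounded, so the weighted group is differentiable in
operator norm. Duhamel's formula then needs no regularity of u(t) beyond L². -/
theorem hasDerivAt_duhamelOp (k N : ℕ) (a t : ℝ) :
    HasDerivAt (fun t => duhamelOp k N (a - t))
      (mulOp (duhamelSymbolDeriv k N (a - t)) (isMultiplier_duhamelSymbolDeriv k N (a - t))) t := by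
  set D := mulOp (duhamelSymbolDeriv k N (a - t)) (isMultiplier_duhamelSymbolDeriv k N (a - t))
  rw [hasDerivAt_iff_isLittleO]
  have hbound : ∀ᶠ t' in 𝓝 t, ‖duhamelOp k N (a - t') - duhamelOp k N (a - t) - (t' - t) • D‖
      ≤ weight k N * (2 * Real.pi * N) ^ 2 * ‖(t' - t) ^ 2‖ := by
    have hsmall : ∀ᶠ t' in 𝓝 t, 2 * Real.pi * N * |t' - t| ≤ 1 := by
      have hc : Tendsto (fun t' => 2 * Real.pi * N * |t' - t|) (𝓝 t) (𝓝 0) := by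
        have : Continuous fun t' => 2 * Real.pi * N * |t' - t| := by fun_prop
        simpa using this.tendsto t
      exact (hc.eventually_lt_const one_pos).mono fun _ h => h.le
    filter_upwards [hsmall] with t' ht'
    refine ContinuousLinearMap.opNorm_le_bound _
      (mul_nonneg (mul_nonneg (weight_nonneg _ _) (by positivity)) (norm_nonneg _)) fun f => ?_
    refine Lp.norm_le_mul_norm_of_ae_le_mul ?_
    change ∀ᵐ ξ, ‖(duhamelOp k N (a - t') f - duhamelOp k N (a - t) f - (t' - t) • D f : L2) ξ‖ ≤ _
    filter_upwards [coeFn_mulOp (isMultiplier_duhamelSymbol k N (a - t')) f,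
      coeFn_mulOp (isMultiplier_duhamelSymbol k N (a - t)) f,
      coeFn_mulOp (isMultiplier_duhamelSymbolDeriv k N (a - t)) f,
      Lp.coeFn_sub (duhamelOp k N (a - t') f - duhamelOp k N (a - t) f) ((t' - t) • D f),
      Lp.coeFn_sub (duhamelOp k N (a - t') f) (duhamelOp k N (a - t) f),
      Lp.coeFn_smul (t' - t) (D f)] with ξ h1 h2 h3 h4 h5 h6
    rw [h4, Pi.sub_apply, h5, Pi.sub_apply, h6, Pi.smul_apply]
    change ‖(mulOp _ _ f : L2) ξ - (mulOp _ _ f : L2) ξ - (t' - t) • (mulOp _ _ f : L2) ξ‖ ≤ _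
    rw [h1, h2, h3]
    set z := f ξ
    -- θ is the phase gained between t and t'. Both components reduce to e^{±iθ} - 1 ∓ iθ, which is
    -- O(θ²) since |θ| ≤ 1 on the retained frequencies.
    set θ : ℝ := 2 * Real.pi * (t' - t) * ξ with hθ
    have hθ' : |θ| = 2 * Real.pi * |t' - t| * |ξ| := by
      rw [hθ, abs_mul, abs_mul, abs_of_pos Real.two_pi_pos]
    have hid : duhamelSymbol k N (a - t') ξ z - duhamelSymbol k N (a - t) ξ z
          - (t' - t) • duhamelSymbolDeriv k N (a - t) ξ z
        = diagCLM (truncWeight k N ξ * (Complex.exp (θ * Complex.I) - 1 - θ * Complex.I))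
          (truncWeight k N ξ * (Complex.exp ((-θ : ℝ) * Complex.I) - 1 - (-θ : ℝ) * Complex.I))
          (propSymbol (a - t) ξ z) := by
      refine C2.ext ?_ ?_
      · have he : Complex.exp ((-(2 * Real.pi * (a - t') * ξ) : ℝ) * Complex.I)
            = Complex.exp (θ * Complex.I)
              * Complex.exp ((-(2 * Real.pi * (a - t) * ξ) : ℝ) * Complex.I) := by
          rw [← Complex.exp_add, hθ]; congr 1; push_cast; ring
        simp only [duhamelSymbol, duhamelSymbolDeriv, propSymbol, sigmaThree, PiLp.sub_apply,
          PiLp.smul_apply, diagCLM_apply_zero, _root_.smul_apply,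
          ContinuousLinearMap.comp_apply, he, smul_eq_mul, Complex.real_smul]
        rw [hθ]
        push_cast
        ring
      · have he : Complex.exp ((2 * Real.pi * (a - t') * ξ : ℝ) * Complex.I)
            = Complex.exp ((-θ : ℝ) * Complex.I)
              * Complex.exp ((2 * Real.pi * (a - t) * ξ : ℝ) * Complex.I) := by
          rw [← Complex.exp_add, hθ]; congr 1; push_cast; ring
        simp only [duhamelSymbol, duhamelSymbolDeriv, propSymbol, sigmaThree, PiLp.sub_apply,
          PiLp.smul_apply, diagCLM_apply_one, _root_.smul_apply,
          ContinuousLinearMap.comp_apply, he, smul_eq_mul, Complex.real_smul]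
        rw [hθ]
        push_cast
        ring
    have hθ1 : |ξ| ≤ N → |θ| ≤ 1 := fun hξ => by
      rw [hθ']
      refine le_trans ?_ ht'
      have : 0 ≤ 2 * Real.pi * |t' - t| := by positivity
      nlinarith
    rw [hid]
    by_cases hξ : |ξ| ≤ N
    · have hsq : |θ| ^ 2 ≤ (2 * Real.pi * N) ^ 2 * ‖(t' - t) ^ 2‖ := by
        rw [hθ', norm_pow, Real.norm_eq_abs, ← mul_pow]
        refine pow_le_pow_left₀ (by positivity) ?_ 2
        have : 0 ≤ 2 * Real.pi * |t' - t| := by positivity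
        nlinarith
      have hw := mul_le_mul_of_nonneg_left hsq (weight_nonneg k N)
      refine (norm_diagCLM_apply_le (c := weight k N * (2 * Real.pi * N) ^ 2 * ‖(t' - t) ^ 2‖)
        ?_ ?_ _).trans_eq (by rw [norm_propSymbol_apply])
      · exact (norm_truncWeight_mul_le k N ξ hθ1).trans (by linarith)
      · refine (norm_truncWeight_mul_le k N ξ (θ := -θ) (by rwa [abs_neg])).trans ?_
        rw [abs_neg]
        linarith
    · have : diagCLM (truncWeight k N ξ * (Complex.exp (θ * Complex.I) - 1 - θ * Complex.I))
          (truncWeight k N ξ * (Complex.exp ((-θ : ℝ) * Complex.I) - 1 - (-θ : ℝ) * Complex.I))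
          (propSymbol (a - t) ξ z) = 0 := by
        rw [truncWeight, if_neg hξ]
        simp [diagCLM]
      rw [this, norm_zero]
      exact mul_nonneg (mul_nonneg (mul_nonneg (weight_nonneg _ _) (by positivity)) (norm_nonneg _))
        (norm_nonneg _)
  refine (Asymptotics.IsBigO.of_bound _ hbound).trans_isLittleO ?_
  exact (Asymptotics.isLittleO_pow_sub_sub t one_lt_two).congr_left fun x => by
    rw [Real.norm_eq_abs, sq_abs]

theorem ofReal_smul_L2 (c : ℝ) (w : L2) : (c : ℂ) • w = c • w := by
  refine Lp.ext ?_
  filter_upwards [Lp.coeFn_smul (c : ℂ) w, Lp.coeFn_smul c w] with x h1 h2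
  rw [h1, h2, Pi.smul_apply, Pi.smul_apply, Complex.coe_smul]

/-- Duhamel's formula as a mean value estimate: if `∂ₜ u = -σ₃ ∂ₓ u + h(t)` and `h(t)` is close to
the free evolution of `g`, then `u` is close to the free evolution of `u(a) + (t - a) g`. -/
theorem duhamel_estimate {u d h : ℝ → L2} {a b : ℝ} (hab : a ≤ b)
    (hu : ∀ t ∈ Set.Icc a b, HasDerivWithinAt u (d t) (Set.Icc a b) t)
    (hd : ∀ t ∈ Set.Icc a b, ((𝓕 (d t) : L2) : ℝ → C2) =ᵐ[volume] fun ξ =>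
      (𝓕 (h t) : L2) ξ - (2 * Real.pi * Complex.I * ξ) • sigmaThree ((𝓕 (u t) : L2) ξ))
    (g : L2) (hg : ∀ t ∈ Set.Icc a b, SobolevLE k r (NLQW.prop (a - t) (h t) - g)) :
    SobolevLE k ((b - a) * r) (NLQW.prop (a - b) (u b) - u a - ((b - a : ℝ) : ℂ) • g) := fun N => by
  have hF : ∀ t ∈ Set.Icc a b, HasDerivWithinAt (fun t => (𝓕 (u t) : L2)) (𝓕 (d t) : L2)
      (Set.Icc a b) t := fun t ht =>
    ((Lp.fourierTransformₗᵢ ℝ C2).toContinuousLinearEquiv.toContinuousLinearMap.restrictScalars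
      ℝ).hasFDerivAt.comp_hasDerivWithinAt t (hu t ht)
  -- Differentiating the group produces a σ₃∂ₓu term that cancels the one in d(t). What remains is
  -- the transported h(t) minus g, which the hypothesis bounds, and the mean value inequality
  -- finishes.
  have hy : ∀ t ∈ Set.Icc a b, HasDerivWithinAt
      (fun t => duhamelOp k N (a - t) (𝓕 (u t)) - t • weightOp k N (𝓕 g))
      (weightOp k N (𝓕 (NLQW.prop (a - t) (h t) - g))) (Set.Icc a b) t := by
    intro t ht
    have h1 := (((ContinuousLinearMap.restrictScalarsL ℂ L2 L2 ℝ ℝ).hasFDerivAt.comp_hasDerivAt t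
      (hasDerivAt_duhamelOp k N a t)).hasDerivWithinAt (s := Set.Icc a b)).clm_apply (hF t ht)
    have h2 := (((hasDerivAt_id t).smul_const (weightOp k N (𝓕 g))).hasDerivWithinAt
      (s := Set.Icc a b))
    refine (h1.sub h2).congr_deriv ?_
    rw [fourier_sub, map_sub, one_smul]
    congr 1
    rw [← duhamelOp_fourier]
    change mulOp (duhamelSymbolDeriv k N (a - t)) (isMultiplier_duhamelSymbolDeriv k N (a - t))
      (𝓕 (u t)) + duhamelOp k N (a - t) (𝓕 (d t)) = _
    refine Lp.ext ?_
    filter_upwards [Lp.coeFn_add (mulOp (duhamelSymbolDeriv k N (a - t))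
      (isMultiplier_duhamelSymbolDeriv k N (a - t)) (𝓕 (u t))) (duhamelOp k N (a - t) (𝓕 (d t))),
      coeFn_mulOp (isMultiplier_duhamelSymbolDeriv k N (a - t)) (𝓕 (u t)),
      coeFn_mulOp (isMultiplier_duhamelSymbol k N (a - t)) (𝓕 (d t)),
      coeFn_mulOp (isMultiplier_duhamelSymbol k N (a - t)) (𝓕 (h t)), hd t ht]
      with ξ e1 e2 e3 e4 e5
    rw [e1, Pi.add_apply]
    change (mulOp _ _ _ : L2) ξ + (mulOp _ _ _ : L2) ξ = (mulOp _ _ _ : L2) ξ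
    rw [e2, e3, e4, e5, map_sub, map_smul]
    simp only [duhamelSymbol, duhamelSymbolDeriv, _root_.smul_apply,
      ContinuousLinearMap.comp_apply, smul_smul]
    rw [mul_comm (truncWeight k N ξ)]
    abel
  have hmv := (convex_Icc a b).norm_image_sub_le_of_norm_hasDerivWithin_le hy
    (fun t ht => hg t ht N) (Set.left_mem_Icc.2 hab) (Set.right_mem_Icc.2 hab)
  rw [Real.norm_of_nonneg (sub_nonneg.2 hab), mul_comm] at hmv
  refine le_trans (le_of_eq ?_) hmv
  congr 1
  rw [duhamelOp_fourier, duhamelOp_fourier, sub_self, prop_zero, fourier_sub, fourier_sub,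
    FourierTransform.fourier_smul, map_sub, map_sub, map_smul, ofReal_smul_L2, sub_smul]
  abel

end

end NLQW

namespace NLQW

open scoped NNReal

noncomputable section

/-! ### Sampling and finite differences -/

section Sampling

variable {E : Type} [NormedAddCommGroup E] [NormedSpace ℝ E]

/-- The forward difference quotient with step `δ`. -/
def diffQuot (δ : ℝ) (f : ℝ → E) (x : ℝ) : E := δ⁻¹ • (f (x + δ) - f x)

theorem contDiff_diffQuot {f : ℝ → E} (hf : ContDiff ℝ ∞ f) (δ : ℝ) :
    ContDiff ℝ ∞ (diffQuot δ f) := by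
  unfold diffQuot; fun_prop

theorem deriv_diffQuot {f : ℝ → E} (hf : ContDiff ℝ ∞ f) (δ : ℝ) :
    deriv (diffQuot δ f) = diffQuot δ (deriv f) := by
  ext x
  have hd : ∀ y, HasDerivAt f (deriv f y) y := fun y => (hf.differentiable (by simp) y).hasDerivAt
  exact ((((hd (x + δ)).comp_add_const x δ).sub (hd x)).const_smul δ⁻¹).deriv

/-- This one-cell form serves twice: integrated over x it bounds the difference quotient in L²,
summed over the lattice cells it bounds the samples in ℓ². -/
theorem enorm_diffQuot_sq_le [CompleteSpace E] {f : ℝ → E} (hf : ContDiff ℝ ∞ f) {δ : ℝ}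
    (hδ : 0 < δ) (x : ℝ) : ENNReal.ofReal δ * ‖diffQuot δ f x‖ₑ ^ 2
      ≤ ∫⁻ y in Set.Ioc x (x + δ), ‖deriv f y‖ₑ ^ 2 := by
  have hδ0 : ENNReal.ofReal δ ≠ 0 := by simpa using hδ
  have h := enorm_sub_sq_le hf x hδ.le
  have hinv : ‖δ⁻¹‖ₑ = (ENNReal.ofReal δ)⁻¹ := by
    rw [Real.enorm_of_nonneg (inv_nonneg.2 hδ.le), ENNReal.ofReal_inv_of_pos hδ]
  unfold diffQuot
  rw [enorm_smul, hinv, mul_pow]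
  calc ENNReal.ofReal δ * ((ENNReal.ofReal δ)⁻¹ ^ 2 * ‖f (x + δ) - f x‖ₑ ^ 2)
      ≤ ENNReal.ofReal δ * ((ENNReal.ofReal δ)⁻¹ ^ 2 *
        (ENNReal.ofReal δ * ∫⁻ y in Set.Ioc x (x + δ), ‖deriv f y‖ₑ ^ 2)) := by gcongr
    _ = (ENNReal.ofReal δ * (ENNReal.ofReal δ)⁻¹) * (ENNReal.ofReal δ * (ENNReal.ofReal δ)⁻¹) *
        ∫⁻ y in Set.Ioc x (x + δ), ‖deriv f y‖ₑ ^ 2 := by ring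
    _ = _ := by rw [ENNReal.mul_inv_cancel hδ0 ENNReal.ofReal_ne_top, one_mul, one_mul]

theorem tsum_setLIntegral_Ioc {δ : ℝ} (hδ : 0 < δ) (F : ℝ → ℝ≥0∞) :
    ∑' n : ℤ, ∫⁻ y in Set.Ioc (δ * n) (δ * n + δ), F y = ∫⁻ y, F y := by
  have hset : ∀ n : ℤ, Set.Ioc (δ * n) (δ * n + δ) = Set.Ioc ((0 : ℝ) + n • δ) (0 + (n + 1) • δ) :=
    fun n => by
      congr 1
      · simp [mul_comm]
      · simp only [zsmul_eq_mul]; push_cast; ring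
  simp_rw [hset]
  rw [← lintegral_iUnion (fun _ => measurableSet_Ioc) (Set.pairwise_disjoint_Ioc_add_zsmul 0 δ),
    iUnion_Ioc_add_zsmul hδ, Measure.restrict_univ]

/-- Tonelli and translation invariance: each y is seen by the windows starting in a set of length δ.
-/
theorem lintegral_setLIntegral_Ioc (δ : ℝ) {F : ℝ → ℝ≥0∞} (hF : Measurable F) :
    ∫⁻ x, ∫⁻ y in Set.Ioc x (x + δ), F y = ENNReal.ofReal δ * ∫⁻ y, F y := by
  have h1 : ∀ x, ∫⁻ y in Set.Ioc x (x + δ), F y = ∫⁻ s in Set.Ioc 0 δ, F (x + s) := fun x => by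
    rw [← lintegral_indicator measurableSet_Ioc, ← lintegral_indicator measurableSet_Ioc,
      ← lintegral_add_left_eq_self _ x]
    refine lintegral_congr fun s => ?_
    by_cases hs : s ∈ Set.Ioc 0 δ
    · rw [Set.indicator_of_mem hs, Set.indicator_of_mem]
      exact ⟨by linarith [hs.1], by linarith [hs.2]⟩
    · rw [Set.indicator_of_notMem hs, Set.indicator_of_notMem]
      exact fun h => hs ⟨by linarith [h.1], by linarith [h.2]⟩
  simp_rw [h1]
  rw [lintegral_lintegral_swap (by fun_prop)]
  simp_rw [lintegral_add_right_eq_self (fun x => F x)]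
  rw [setLIntegral_const]
  simp [mul_comm]

theorem eLpNorm_diffQuot_le [CompleteSpace E] {f : ℝ → E} (hf : ContDiff ℝ ∞ f) {δ : ℝ}
    (hδ : 0 < δ) : eLpNorm (diffQuot δ f) 2 volume ≤ eLpNorm (deriv f) 2 volume := by
  have hδ0 : ENNReal.ofReal δ ≠ 0 := by simpa using hδ
  have hm : Measurable fun y => ‖deriv f y‖ₑ ^ 2 :=
    ((contDiff_deriv hf).continuous.enorm.measurable).pow_const 2
  have h := lintegral_mono (μ := volume) (enorm_diffQuot_sq_le hf hδ)
  rw [lintegral_const_mul' _ _ ENNReal.ofReal_ne_top, lintegral_setLIntegral_Ioc δ hm,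
    ENNReal.mul_le_mul_iff_right hδ0 ENNReal.ofReal_ne_top, ← eLpNorm_two_sq,
    ← eLpNorm_two_sq] at h
  exact (ENNReal.pow_le_pow_left_iff (by norm_num)).1 h

theorem SobolevBound.diffQuot [CompleteSpace E] {k : ℕ} {r : ℝ≥0} {f : ℝ → E}
    (hf : ContDiff ℝ ∞ f) {δ : ℝ} (hδ : 0 < δ) (h : SobolevBound (k + 1) r f) :
    SobolevBound k r (NLQW.diffQuot δ f) := by
  induction k generalizing f with
  | zero =>
    have h' := (sobolevBound_succ.1 h).2
    rw [sobolevBound_zero] at h' ⊢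
    exact (eLpNorm_diffQuot_le hf hδ).trans h'
  | succ k ih =>
    have h' := (sobolevBound_succ.1 h).2
    rw [sobolevBound_succ, deriv_diffQuot hf]
    exact ⟨(eLpNorm_diffQuot_le hf hδ).trans (sobolevBound_succ.1 h').1,
      ih (contDiff_deriv hf) h'⟩

theorem iterate_diffQuot_spec [CompleteSpace E] {k : ℕ} {r : ℝ≥0} {f : ℝ → E}
    (hf : ContDiff ℝ ∞ f) {δ : ℝ} (hδ : 0 < δ) (j : ℕ) (h : SobolevBound (k + j) r f) :
    ContDiff ℝ ∞ ((NLQW.diffQuot δ)^[j] f) ∧ SobolevBound k r ((NLQW.diffQuot δ)^[j] f) := by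
  induction j generalizing f with
  | zero => exact ⟨hf, h⟩
  | succ j ih =>
    rw [Function.iterate_succ_apply]
    exact ih (contDiff_diffQuot hf δ) (SobolevBound.diffQuot hf hδ h)

theorem tsum_enorm_sample_sq_le [CompleteSpace E] {r : ℝ≥0} {f : ℝ → E} (hf : ContDiff ℝ ∞ f)
    {δ : ℝ} (hδ : 0 < δ) (hδ1 : δ ≤ 1) (h : SobolevBound 1 r f) :
    ∑' n : ℤ, ENNReal.ofReal δ * ‖f (δ * n)‖ₑ ^ 2 ≤ ((2 * r : ℝ≥0) : ℝ≥0∞) ^ 2 := by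
  have h' := sobolevBound_succ.1 h
  have hsq : ∀ g : ℝ → E, eLpNorm g 2 volume ≤ r → ∫⁻ y, ‖g y‖ₑ ^ 2 ≤ (r : ℝ≥0∞) ^ 2 :=
    fun g hg => by rw [← eLpNorm_two_sq]; gcongr
  calc ∑' n : ℤ, ENNReal.ofReal δ * ‖f (δ * n)‖ₑ ^ 2
      ≤ ∑' n : ℤ, 2 * ((∫⁻ y in Set.Ioc (δ * n) (δ * n + δ), ‖f y‖ₑ ^ 2)
        + ENNReal.ofReal δ ^ 2 * ∫⁻ y in Set.Ioc (δ * n) (δ * n + δ), ‖deriv f y‖ₑ ^ 2) :=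
        ENNReal.tsum_le_tsum fun n => enorm_sq_le hf _ _
    _ = 2 * ((∫⁻ y, ‖f y‖ₑ ^ 2) + ENNReal.ofReal δ ^ 2 * ∫⁻ y, ‖deriv f y‖ₑ ^ 2) := by
        rw [ENNReal.tsum_mul_left, ENNReal.tsum_add, ENNReal.tsum_mul_left,
          tsum_setLIntegral_Ioc hδ, tsum_setLIntegral_Ioc hδ]
    _ ≤ 2 * ((r : ℝ≥0∞) ^ 2 + 1 ^ 2 * (r : ℝ≥0∞) ^ 2) := by
        gcongr
        · exact hsq f h'.1
        · simpa using hδ1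
        · exact hsq _ (sobolevBound_zero.1 h'.2)
    _ = _ := by push_cast; ring

theorem tsum_enorm_sample_diffQuot_sq_le [CompleteSpace E] {r : ℝ≥0} {f : ℝ → E}
    (hf : ContDiff ℝ ∞ f) {δ : ℝ} (hδ : 0 < δ) (h : SobolevBound 1 r f) :
    ∑' n : ℤ, ENNReal.ofReal δ * ‖NLQW.diffQuot δ f (δ * n)‖ₑ ^ 2 ≤ (r : ℝ≥0∞) ^ 2 := by
  have h' := sobolevBound_succ.1 h
  calc ∑' n : ℤ, ENNReal.ofReal δ * ‖NLQW.diffQuot δ f (δ * n)‖ₑ ^ 2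
      ≤ ∑' n : ℤ, ∫⁻ y in Set.Ioc (δ * n) (δ * n + δ), ‖deriv f y‖ₑ ^ 2 :=
        ENNReal.tsum_le_tsum fun n => enorm_diffQuot_sq_le hf hδ _
    _ = ∫⁻ y, ‖deriv f y‖ₑ ^ 2 := tsum_setLIntegral_Ioc hδ _
    _ ≤ _ := by
        rw [← eLpNorm_two_sq]
        gcongr
        exact sobolevBound_zero.1 h'.2

end Sampling

/-- A sequence with finite `ℓ²(δℤ)` norm as an element of the lattice space. -/
theorem exists_lattice_of_tsum_le {δ : ℝ} (hδ : 0 < δ) {a : ℤ → C2} {r : ℝ≥0}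
    (h : ∑' n : ℤ, ENNReal.ofReal δ * ‖a n‖ₑ ^ 2 ≤ (r : ℝ≥0∞) ^ 2) :
    ∃ v : Lattice, (∀ n, v n = a n) ∧ Real.sqrt δ * ‖v‖ ≤ r := by
  have hreal : ∀ n, ENNReal.ofReal δ * ‖a n‖ₑ ^ 2 = ENNReal.ofReal (δ * ‖a n‖ ^ 2) := fun n => by
    rw [ENNReal.ofReal_mul hδ.le, ENNReal.ofReal_pow (norm_nonneg _), ofReal_norm]
  simp_rw [hreal] at h
  have hs : Summable fun n => δ * ‖a n‖ ^ 2 := by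
    have := ENNReal.summable_toReal (h.trans_lt (by simp : (r : ℝ≥0∞) ^ 2 < ⊤)).ne
    refine this.congr fun n => ENNReal.toReal_ofReal (by positivity)
  have hs' : Summable fun n => ‖a n‖ ^ 2 := (summable_mul_left_iff hδ.ne').1 hs
  have hmem : Memℓp a 2 := memℓp_gen (by simpa using hs')
  refine ⟨⟨a, hmem⟩, fun n => rfl, ?_⟩
  have hnorm : ‖(⟨a, hmem⟩ : Lattice)‖ ^ 2 = ∑' n, ‖a n‖ ^ 2 := by
    have := lp.norm_rpow_eq_tsum (p := 2) (by norm_num) (⟨a, hmem⟩ : Lattice)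
    simpa using this
  refine abs_le_of_sq_le_sq' ?_ r.coe_nonneg |>.2
  rw [mul_pow, Real.sq_sqrt hδ.le, hnorm, ← tsum_mul_left]
  rw [← ENNReal.ofReal_tsum_of_nonneg (fun n => by positivity) hs, ← ENNReal.coe_pow,
    ← ENNReal.ofReal_coe_nnreal, ENNReal.ofReal_le_ofReal_iff (NNReal.coe_nonneg _)] at h
  exact_mod_cast h

end

end NLQW

namespace NLQW

open scoped NNReal

noncomputable section

/-! ### Shannon interpolation -/

variable {δ : ℝ}

/-- The contribution of one site as an element of `L²`. -/
def bandWave (δ : ℝ) (n : ℤ) (c : C2) : L2 := (memLp_bandWaveFun δ n c).toLp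

theorem coeFn_bandWave (δ : ℝ) (n : ℤ) (c : C2) :
    (bandWave δ n c : ℝ → C2) =ᵐ[volume] bandWaveFun δ n c := MemLp.coeFn_toLp _

/-- The phase `e^{-2πiδnξ}`. -/
def phase (δ : ℝ) (n : ℤ) (ξ : ℝ) : ℂ := Complex.exp (-(2 * Real.pi * (δ * n) * ξ : ℝ) * Complex.I)

theorem norm_phase (δ : ℝ) (n : ℤ) (ξ : ℝ) : ‖phase δ n ξ‖ = 1 := by
  unfold phase
  rw [← Complex.ofReal_neg, Complex.norm_exp_ofReal_mul_I]

theorem continuous_phase (δ : ℝ) (n : ℤ) : Continuous (phase δ n) := by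
  unfold phase; fun_prop

theorem phase_mul (δ : ℝ) (n j : ℤ) (ξ : ℝ) : phase δ n ξ * phase δ j ξ = phase δ (n + j) ξ := by
  unfold phase
  rw [← Complex.exp_add]
  congr 1
  push_cast
  ring

theorem star_phase (δ : ℝ) (n : ℤ) (ξ : ℝ) : (starRingEnd ℂ) (phase δ n ξ) = phase δ (-n) ξ := by
  unfold phase
  rw [← Complex.exp_conj, map_mul, map_neg, Complex.conj_ofReal, Complex.conj_I]
  congr 1
  push_cast
  ring

theorem bandWaveFun_apply (δ : ℝ) (n : ℤ) (c : C2) (ξ : ℝ) :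
    bandWaveFun δ n c ξ = (band δ).indicator (fun ξ => ((δ : ℂ) * phase δ n ξ) • c) ξ := rfl

theorem inner_bandWave_left (δ : ℝ) (n : ℤ) (c : C2) (f : L2) :
    inner ℂ (bandWave δ n c) f
      = ∫ ξ in band δ, (δ : ℂ) * (phase δ (-n) ξ * inner ℂ c (f ξ)) := by
  rw [L2.inner_def, ← integral_indicator (measurableSet_band δ)]
  refine integral_congr_ae ?_
  filter_upwards [coeFn_bandWave δ n c] with ξ h
  rw [h, bandWaveFun_apply]
  by_cases hξ : ξ ∈ band δ
  · rw [Set.indicator_of_mem hξ, Set.indicator_of_mem hξ, inner_smul_left, map_mul, star_phase,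
      Complex.conj_ofReal, mul_assoc]
  · rw [Set.indicator_of_notMem hξ, Set.indicator_of_notMem hξ, inner_zero_left]

theorem integral_band_phase (hδ : 0 < δ) (j : ℤ) :
    ∫ ξ in band δ, phase δ j ξ = if j = 0 then (δ : ℂ)⁻¹ else 0 := by
  have hle : -(1 / (2 * δ)) ≤ 1 / (2 * δ) := by
    have : 0 < 1 / (2 * δ) := by positivity
    linarith
  have hδ' : (δ : ℂ) ≠ 0 := by exact_mod_cast hδ.ne'
  rw [band, integral_Icc_eq_integral_Ioc, ← intervalIntegral.integral_of_le hle]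
  split_ifs with hj
  · subst hj
    simp only [phase, Int.cast_zero, mul_zero, zero_mul, Complex.ofReal_zero, neg_zero,
      Complex.exp_zero, intervalIntegral.integral_const]
    rw [show 1 / (2 * δ) - -(1 / (2 * δ)) = δ⁻¹ by field_simp; norm_num]
    simp
  · have hc : (-(2 * Real.pi * (δ * j)) * Complex.I : ℂ) ≠ 0 := by
      simp [hδ.ne', hj, Real.pi_ne_zero]
    have he : ∀ ξ : ℝ, phase δ j ξ = Complex.exp ((-(2 * Real.pi * (δ * j)) * Complex.I : ℂ) * ξ) :=
      fun ξ => by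
        unfold phase
        congr 1
        push_cast
        ring
    simp_rw [he]
    rw [integral_exp_mul_complex hc, div_eq_zero_iff]
    left
    rw [sub_eq_zero, Complex.exp_eq_exp_iff_exists_int]
    -- The band has length 1/δ, so between its endpoints the phase makes a whole number of turns,
    -- namely -j.
    refine ⟨-j, ?_⟩
    push_cast
    field_simp
    ring

theorem inner_bandWave_bandWave (hδ : 0 < δ) (n j : ℤ) (c c' : C2) :
    inner ℂ (bandWave δ n c) (bandWave δ j c') = if n = j then (δ : ℂ) * inner ℂ c c' else 0 := by
  have hδ' : (δ : ℂ) ≠ 0 := by exact_mod_cast hδ.ne'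
  rw [inner_bandWave_left δ]
  have h1 : ∫ ξ in band δ, (δ : ℂ) * (phase δ (-n) ξ * inner ℂ c ((bandWave δ j c') ξ))
      = ∫ ξ in band δ, ((δ : ℂ) * δ * inner ℂ c c') * phase δ (j - n) ξ := by
    refine setIntegral_congr_ae (measurableSet_band δ) ?_
    filter_upwards [coeFn_bandWave δ j c'] with ξ h hξ
    rw [h, bandWaveFun_apply, Set.indicator_of_mem hξ, inner_smul_right, sub_eq_add_neg,
      ← phase_mul]
    ring
  rw [h1, integral_const_mul, integral_band_phase hδ]
  by_cases h : n = j
  · subst h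
    simp only [sub_self, if_true]
    field_simp
  · rw [if_neg (fun h' => h (by omega)), if_neg h, mul_zero]

theorem norm_bandWave (hδ : 0 < δ) (n : ℤ) (c : C2) : ‖bandWave δ n c‖ = Real.sqrt δ * ‖c‖ := by
  have h := inner_bandWave_bandWave hδ n n c c
  rw [if_pos rfl, inner_self_eq_norm_sq_to_K, inner_self_eq_norm_sq_to_K] at h
  have h' : ‖bandWave δ n c‖ ^ 2 = δ * ‖c‖ ^ 2 := by
    have h2 : ((‖bandWave δ n c‖ ^ 2 : ℝ) : ℂ) = ((δ * ‖c‖ ^ 2 : ℝ) : ℂ) := by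
      push_cast
      exact h
    exact_mod_cast h2
  rw [← Real.sqrt_sq (norm_nonneg (bandWave δ n c)), h', Real.sqrt_mul hδ.le,
    Real.sqrt_sq (norm_nonneg c)]

theorem bandWave_add (δ : ℝ) (n : ℤ) (c c' : C2) :
    bandWave δ n (c + c') = bandWave δ n c + bandWave δ n c' := by
  refine Lp.ext ?_
  filter_upwards [coeFn_bandWave δ n c, coeFn_bandWave δ n c', coeFn_bandWave δ n (c + c'),
    Lp.coeFn_add (bandWave δ n c) (bandWave δ n c')] with ξ h1 h2 h3 h4
  rw [h4, Pi.add_apply, h1, h2, h3]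
  by_cases hξ : ξ ∈ band δ
  · simp only [bandWaveFun_apply, Set.indicator_of_mem hξ]
    rw [smul_add]
  · simp only [bandWaveFun_apply, Set.indicator_of_notMem hξ]
    rw [add_zero]

theorem bandWave_smul (δ : ℝ) (n : ℤ) (a : ℂ) (c : C2) :
    bandWave δ n (a • c) = a • bandWave δ n c := by
  refine Lp.ext ?_
  filter_upwards [coeFn_bandWave δ n c, coeFn_bandWave δ n (a • c),
    Lp.coeFn_smul a (bandWave δ n c)] with ξ h1 h2 h3
  rw [h3, Pi.smul_apply, h1, h2]
  by_cases hξ : ξ ∈ band δ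
  · simp only [bandWaveFun_apply, Set.indicator_of_mem hξ]
    rw [smul_comm]
  · simp only [bandWaveFun_apply, Set.indicator_of_notMem hξ]
    rw [smul_zero]

/-- The normalized contribution of one site. -/
def bandIsometry (hδ : 0 < δ) (n : ℤ) : C2 →ₗᵢ[ℂ] L2 where
  toFun c := ((Real.sqrt δ)⁻¹ : ℂ) • bandWave δ n c
  map_add' c c' := by rw [bandWave_add, smul_add]
  map_smul' a c := by rw [bandWave_smul, smul_comm]; rfl
  norm_map' c := by
    have : 0 < Real.sqrt δ := Real.sqrt_pos.2 hδ
    change ‖((Real.sqrt δ)⁻¹ : ℂ) • bandWave δ n c‖ = ‖c‖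
    rw [norm_smul, norm_bandWave hδ, norm_inv, Complex.norm_real, Real.norm_of_nonneg this.le,
      inv_mul_cancel_left₀ this.ne']

theorem orthogonalFamily_bandIsometry (hδ : 0 < δ) :
    OrthogonalFamily ℂ (fun _ : ℤ => C2) (bandIsometry hδ) := by
  intro n j hnj c c'
  change inner ℂ (((Real.sqrt δ)⁻¹ : ℂ) • bandWave δ n c) (((Real.sqrt δ)⁻¹ : ℂ) • bandWave δ j c')
    = 0
  rw [inner_smul_left, inner_smul_right, inner_bandWave_bandWave hδ, if_neg hnj, mul_zero, mul_zero]

/-- After division by √δ the sites give isometries with mutually orthogonal ranges, so the series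
converges in L² for every square summable v, and its norm is √δ times that of v. -/
theorem hasSum_bandWave (hδ : 0 < δ) (v : Lattice) : HasSum (fun n => bandWave δ n (v n))
    ((Real.sqrt δ : ℂ) • (orthogonalFamily_bandIsometry hδ).linearIsometry v) := by
  have h := ((orthogonalFamily_bandIsometry hδ).hasSum_linearIsometry v).const_smul
    (Real.sqrt δ : ℂ)
  refine h.congr_fun ?_
  intro n
  have : (Real.sqrt δ : ℂ) ≠ 0 := by exact_mod_cast (Real.sqrt_pos.2 hδ).ne'
  change _ = (Real.sqrt δ : ℂ) • ((Real.sqrt δ)⁻¹ : ℂ) • bandWave δ n (v n)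
  rw [smul_smul, mul_inv_cancel₀ this, one_smul]

theorem latticeFourier_eq (hδ : 0 < δ) (v : Lattice) : latticeFourier δ v =
    (Real.sqrt δ : ℂ) • (orthogonalFamily_bandIsometry hδ).linearIsometry v :=
  (hasSum_bandWave hδ v).tsum_eq

theorem hasSum_latticeFourier (hδ : 0 < δ) (v : Lattice) :
    HasSum (fun n => bandWave δ n (v n)) (latticeFourier δ v) := by
  rw [latticeFourier_eq hδ]
  exact hasSum_bandWave hδ v

theorem norm_latticeFourier (hδ : 0 < δ) (v : Lattice) :
    ‖latticeFourier δ v‖ = Real.sqrt δ * ‖v‖ := by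
  rw [latticeFourier_eq hδ, norm_smul, LinearIsometry.norm_map, Complex.norm_real,
    Real.norm_of_nonneg (Real.sqrt_nonneg _)]

theorem latticeFourier_sub (hδ : 0 < δ) (v v' : Lattice) :
    latticeFourier δ (v - v') = latticeFourier δ v - latticeFourier δ v' := by
  simp only [latticeFourier_eq hδ, map_sub, smul_sub]

theorem fourier_shannon (δ : ℝ) (v : Lattice) : (𝓕 (shannon δ v) : L2) = latticeFourier δ v := by
  unfold shannon
  rw [FourierTransform.fourier_fourierInv_eq]

theorem shannon_sub (hδ : 0 < δ) (v v' : Lattice) :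
    shannon δ (v - v') = shannon δ v - shannon δ v' := by
  refine fourier_injective ?_
  simp only [fourier_sub, fourier_shannon, latticeFourier_sub hδ]

theorem shannon_injective (hδ : 0 < δ) : Function.Injective (shannon δ) := by
  intro v v' h
  have h1 : ‖latticeFourier δ (v - v')‖ = 0 := by
    rw [← fourier_shannon, shannon_sub hδ, h, sub_self, Lp.norm_fourier_eq, norm_zero]
  rw [norm_latticeFourier hδ] at h1
  have : Real.sqrt δ ≠ 0 := (Real.sqrt_pos.2 hδ).ne'
  exact sub_eq_zero.1 (norm_eq_zero.1 ((mul_eq_zero.1 h1).resolve_left this))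

theorem shannonInv_shannon (hδ : 0 < δ) (v : Lattice) : shannonInv δ (shannon δ v) = v :=
  Function.leftInverse_invFun (shannon_injective hδ) v

/-- Sitewise operations on the lattice are multiplications on the Fourier side. -/
theorem latticeFourier_eq_mulOp (hδ : 0 < δ) {m : ℝ → C2 →L[ℂ] C2} (hm : IsMultiplier m)
    (e : ℤ ≃ ℤ) {v v' : Lattice}
    (h : ∀ n, bandWave δ (e n) (v' (e n)) = mulOp m hm (bandWave δ n (v n))) :
    latticeFourier δ v' = mulOp m hm (latticeFourier δ v) := by
  have h1 := (mulOp m hm).hasSum (hasSum_latticeFourier hδ v)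
  have h2 := (e.hasSum_iff (f := fun n => bandWave δ n (v' n))).2 (hasSum_latticeFourier hδ v')
  refine h2.unique ?_
  convert h1 using 1
  ext1 n
  exact h n

theorem isMultiplier_scalarMul_phase (δ : ℝ) (j : ℤ) : IsMultiplier (scalarMul (phase δ j)) :=
  isMultiplier_scalarMul (continuous_phase δ j).measurable (fun ξ => (norm_phase δ j ξ).le)

theorem latticeFourier_translate (hδ : 0 < δ) (j : ℤ) {v v' : Lattice}
    (h : ∀ n, v' n = v (n - j)) :
    (latticeFourier δ v' : ℝ → C2) =ᵐ[volume] fun ξ => phase δ j ξ • latticeFourier δ v ξ := by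
  rw [latticeFourier_eq_mulOp hδ (isMultiplier_scalarMul_phase δ j) (Equiv.addRight j)
    (v := v) (v' := v') fun n => ?_]
  · exact coeFn_mulOp _ _
  · refine Lp.ext ?_
    filter_upwards [coeFn_bandWave δ (n + j) (v n), coeFn_bandWave δ n (v n),
      coeFn_mulOp (isMultiplier_scalarMul_phase δ j) (bandWave δ n (v n))] with ξ h1 h2 h3
    rw [Equiv.coe_addRight, h (n + j), add_sub_cancel_right, h1, h3, h2, scalarMul_apply]
    by_cases hξ : ξ ∈ band δ
    · simp only [bandWaveFun_apply, Set.indicator_of_mem hξ]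
      rw [smul_smul, ← phase_mul]
      congr 1
      ring
    · simp only [bandWaveFun_apply, Set.indicator_of_notMem hξ]
      rw [smul_zero]

theorem isMultiplier_const (A : C2 →L[ℂ] C2) : IsMultiplier fun _ => A :=
  ⟨aestronglyMeasurable_const, ‖A‖, fun _ => le_rfl⟩

theorem latticeFourier_clm (hδ : 0 < δ) (A : C2 →L[ℂ] C2) {v v' : Lattice}
    (h : ∀ n, v' n = A (v n)) :
    (latticeFourier δ v' : ℝ → C2) =ᵐ[volume] fun ξ => A (latticeFourier δ v ξ) := by
  rw [latticeFourier_eq_mulOp hδ (isMultiplier_const A) (Equiv.refl ℤ)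
    (v := v) (v' := v') fun n => ?_]
  · exact coeFn_mulOp _ _
  · refine Lp.ext ?_
    filter_upwards [coeFn_bandWave δ n (A (v n)), coeFn_bandWave δ n (v n),
      coeFn_mulOp (isMultiplier_const A) (bandWave δ n (v n))] with ξ h1 h2 h3
    rw [Equiv.refl_apply, h n, h1, h3, h2]
    by_cases hξ : ξ ∈ band δ
    · simp only [bandWaveFun_apply, Set.indicator_of_mem hξ]
      rw [map_smul]
    · simp only [bandWaveFun_apply, Set.indicator_of_notMem hξ]
      rw [map_zero]

/-- Shannon interpolants are band limited. -/
theorem bandLimited_shannon (hδ : 0 < δ) (v : Lattice) : BandLimited δ (shannon δ v) := by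
  -- Multiplication by the indicator of the complement of the band is continuous and kills each term
  -- of the series, hence the sum.
  have hm : IsMultiplier (scalarMul ((band δ)ᶜ.indicator 1)) :=
    isMultiplier_scalarMul (measurable_one.indicator (measurableSet_band δ).compl) (C := 1)
      fun ξ => by
        refine (norm_indicator_le_norm_self _ _).trans ?_
        simp
  have h0 : mulOp _ hm (latticeFourier δ v) = 0 := by
    refine ((mulOp _ hm).hasSum (hasSum_latticeFourier hδ v)).unique ?_
    convert hasSum_zero using 1
    ext1 n
    refine Lp.ext ?_
    filter_upwards [coeFn_bandWave δ n (v n), coeFn_mulOp hm (bandWave δ n (v n)),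
      Lp.coeFn_zero C2 2 (volume : Measure ℝ)] with ξ h1 h2 h3
    rw [h2, h3, h1, scalarMul_apply, bandWaveFun_apply]
    by_cases hξ : ξ ∈ band δ
    · simp [hξ]
    · simp [hξ]
  have h1 := coeFn_mulOp hm (latticeFourier δ v)
  rw [h0] at h1
  rw [BandLimited, fourier_shannon]
  filter_upwards [h1, Lp.coeFn_zero C2 2 (volume : Measure ℝ)] with ξ e1 e2 hξ
  rw [e2, scalarMul_apply, Set.indicator_of_mem (Set.mem_compl hξ)] at e1
  simpa using e1.symm

/-- On interpolants the lattice shift is the free Dirac group at time `δ`. -/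
theorem shannon_shift (hδ : 0 < δ) (v : Lattice) : shannon δ (shift v) = prop δ (shannon δ v) := by
  have hmem : ∀ (i : Fin 2) (j : ℤ), Memℓp (fun n => compProj i (v (n - j))) 2 := fun i j => by
    refine memℓp_of_norm_le (memℓp_comp (lp.memℓp v) (Equiv.subRight j)) fun n => ?_
    have : ‖compProj i (v (n - j))‖ ^ 2 ≤ ‖v (n - j)‖ ^ 2 := by
      rw [norm_C2_sq, norm_C2_sq]
      fin_cases i <;> simp [compProj_apply]
    exact abs_le_of_sq_le_sq' this (norm_nonneg _) |>.2
  have hT : ∀ j : ℤ, Memℓp (fun n => v (n - j)) 2 := fun j =>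
    memℓp_comp (lp.memℓp v) (Equiv.subRight j)
  -- The shift is written as a difference, with a sign absorbed into the second term, so that
  -- `latticeFourier_sub` applies. On each component translation by one site becomes the phase of
  -- the free group.
  have hneg : Memℓp (fun n => -compProj 1 (v (n - (-1)))) 2 := (hmem 1 (-1)).neg
  have hsplit : shift v = (⟨fun n => compProj 0 (v (n - 1)), hmem 0 1⟩ : Lattice) -
      (⟨fun n => -compProj 1 (v (n - (-1))), hneg⟩ : Lattice) := by
    ext1
    funext n
    change (!₂[v (n - 1) 0, v (n + 1) 1] : C2) =
      compProj 0 (v (n - 1)) - -compProj 1 (v (n - (-1)))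
    refine C2.ext ?_ ?_ <;> simp [compProj_apply]
  refine fourier_injective (Lp.ext ?_)
  simp only [fourier_shannon]
  have e1 := latticeFourier_translate hδ 1 (v := v) (v' := ⟨fun n => v (n - 1), hT 1⟩) fun n => rfl
  have e2 := latticeFourier_translate hδ (-1) (v := v) (v' := ⟨fun n => v (n - (-1)), hT (-1)⟩)
    fun n => rfl
  have e3 := latticeFourier_clm hδ (compProj 0) (v := ⟨fun n => v (n - 1), hT 1⟩)
    (v' := ⟨fun n => compProj 0 (v (n - 1)), hmem 0 1⟩) fun n => rfl
  have e4 := latticeFourier_clm hδ (-compProj 1) (v := ⟨fun n => v (n - (-1)), hT (-1)⟩)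
    (v' := ⟨fun n => -compProj 1 (v (n - (-1))), hneg⟩) fun n => rfl
  have e5 := coeFn_fourier_prop δ (shannon δ v)
  rw [fourier_shannon] at e5
  rw [hsplit, latticeFourier_sub hδ]
  filter_upwards [e1, e2, e3, e4, e5, Lp.coeFn_sub
    (latticeFourier δ (⟨fun n => compProj 0 (v (n - 1)), hmem 0 1⟩ : Lattice))
    (latticeFourier δ (⟨fun n => -compProj 1 (v (n - (-1))), hneg⟩ : Lattice))]
    with ξ h1 h2 h3 h4 h5 h6
  rw [h6, Pi.sub_apply, h3, h4, h1, h2, h5]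
  refine C2.ext ?_ ?_
  · simp only [propSymbol, diagCLM_apply_zero, PiLp.sub_apply, _root_.neg_apply, PiLp.neg_apply,
      compProj_apply, PiLp.smul_apply, smul_eq_mul, phase]
    simp
  · simp only [propSymbol, diagCLM_apply_one, PiLp.sub_apply, _root_.neg_apply, PiLp.neg_apply,
      compProj_apply, PiLp.smul_apply, smul_eq_mul, phase]
    simp

end

end NLQW

namespace NLQW

open scoped NNReal

noncomputable section

variable {δ : ℝ} {w : L2}

/-! ### The sampling theorem -/

theorem inner_bandWave_latticeFourier (hδ : 0 < δ) (n : ℤ) (c : C2) (v : Lattice) :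
    inner ℂ (bandWave δ n c) (latticeFourier δ v) = (δ : ℂ) * inner ℂ c (v n) := by
  have h1 := (innerSL ℂ (bandWave δ n c)).hasSum (hasSum_latticeFourier hδ v)
  refine h1.unique ?_
  have h2 := hasSum_ite_eq n ((δ : ℂ) * inner ℂ c (v n))
  refine h2.congr_fun fun j => ?_
  change inner ℂ (bandWave δ n c) (bandWave δ j (v j)) = _
  rw [inner_bandWave_bandWave hδ]
  by_cases h : n = j
  · subst h; simp
  · rw [if_neg h, if_neg (fun h' => h h'.symm)]

theorem fourierInv_sample (δ : ℝ) (n : ℤ) (f : ℝ → C2) :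
    𝓕⁻ f (δ * n) = ∫ ξ, phase δ (-n) ξ • f ξ := by
  rw [Real.fourierInv_eq']
  refine integral_congr_ae (ae_of_all _ fun ξ => ?_)
  simp only [phase]
  congr 2
  simp
  ring_nf

theorem inner_bandWave_fourier (hw : BandLimited δ w) (n : ℤ) (c : C2) :
    inner ℂ (bandWave δ n c) (𝓕 w : L2)
      = (δ : ℂ) * inner ℂ c (𝓕⁻ ((𝓕 w : L2) : ℝ → C2) (δ * n)) := by
  have hint : Integrable (fun ξ => phase δ (-n) ξ • (𝓕 w : L2) ξ) volume := by
    refine hw.integrable_fourier.bdd_smul 1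
      (continuous_phase δ (-n)).aestronglyMeasurable (ae_of_all _ fun ξ => ?_)
    exact (norm_phase δ (-n) ξ).le
  rw [inner_bandWave_left, integral_const_mul, fourierInv_sample, ← integral_inner hint]
  congr 1
  rw [← integral_indicator (measurableSet_band δ)]
  refine integral_congr_ae ?_
  filter_upwards [hw] with ξ h
  by_cases hξ : ξ ∈ band δ
  · rw [Set.indicator_of_mem hξ, inner_smul_right]
  · rw [Set.indicator_of_notMem hξ, h hξ, smul_zero, inner_zero_right]

/-- The band waves are total in the band-limited functions. -/
theorem BandLimited.eq_zero (hδ : 0 < δ) {f : L2} (hf : ∀ᵐ ξ, ξ ∉ band δ → f ξ = 0)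
    (h : ∀ n c, inner ℂ (bandWave δ n c) f = 0) : f = 0 := by
  have hδ' : (δ : ℂ) ≠ 0 := by exact_mod_cast hδ.ne'
  have hab : -(1 / (2 * δ)) < 1 / (2 * δ) := by
    have : 0 < 1 / (2 * δ) := by positivity
    linarith
  have hlen : 1 / (2 * δ) - -(1 / (2 * δ)) = δ⁻¹ := by field_simp; norm_num
  have key : ∀ i : Fin 2, ∀ᵐ ξ, ξ ∈ band δ → f ξ i = 0 := by
    intro i
    have hL : MemLp (fun ξ => f ξ i) 2 (volume.restrict
        (Set.Ioc (-(1 / (2 * δ))) (1 / (2 * δ)))) := by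
      have : MemLp (fun ξ => f ξ i) 2 volume :=
        (EuclideanSpace.proj i : C2 →L[ℂ] ℂ).comp_memLp' (Lp.memLp f)
      exact this.restrict _
    -- Inner products with the waves are, up to a nonzero factor, Fourier coefficients over the band
    -- of a component of f; the site -n gives the n-th one. Parseval then forces the component to
    -- vanish.
    have hcoef : ∀ n : ℤ, fourierCoeffOn hab (fun ξ => f ξ i) n = 0 := by
      intro n
      rw [fourierCoeffOn_eq_integral, intervalIntegral.integral_of_le hab.le,
        ← integral_Icc_eq_integral_Ioc]
      have h1 := h (-n) (EuclideanSpace.single i 1)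
      rw [inner_bandWave_left, integral_const_mul, mul_eq_zero, or_iff_right hδ', neg_neg] at h1
      rw [smul_eq_zero]
      right
      rw [← h1]
      refine integral_congr_ae (ae_of_all _ fun ξ => ?_)
      simp only [smul_eq_mul, EuclideanSpace.inner_single_left, map_one, one_mul]
      congr 1
      rw [fourier_coe_apply, phase, hlen]
      congr 1
      push_cast
      field_simp
    have hsum := hasSum_sq_fourierCoeffOn hab hL
    simp only [hcoef, norm_zero, ne_eq, OfNat.ofNat_ne_zero, not_false_eq_true, zero_pow] at hsum
    have h0 := hsum.unique hasSum_zero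
    rw [hlen, smul_eq_zero, inv_inv, or_iff_right hδ.ne',
      intervalIntegral.integral_of_le hab.le,
      integral_eq_zero_iff_of_nonneg (fun _ => by positivity)
        (by simpa using hL.integrable_norm_pow (by norm_num))] at h0
    rw [← ae_restrict_iff' (measurableSet_band δ), band, restrict_Ioc_eq_restrict_Icc.symm]
    filter_upwards [h0] with ξ hξ
    simpa using hξ
  refine Lp.ext ?_
  filter_upwards [key 0, key 1, hf, Lp.coeFn_zero C2 2 (volume : Measure ℝ)] with ξ h0 h1 h2 h3
  rw [h3]
  by_cases hξ : ξ ∈ band δ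
  · exact C2.ext (h0 hξ) (h1 hξ)
  · exact h2 hξ

/-- The sampling theorem: a band-limited function is the interpolant of its samples. -/
theorem BandLimited.shannon_sample (hδ : 0 < δ) (hw : BandLimited δ w) {v : Lattice}
    (hv : ∀ n : ℤ, v n = 𝓕⁻ ((𝓕 w : L2) : ℝ → C2) (δ * n)) : shannon δ v = w := by
  refine fourier_injective ?_
  simp only [fourier_shannon]
  rw [← sub_eq_zero]
  refine BandLimited.eq_zero hδ ?_ fun n c => ?_
  · have hs := bandLimited_shannon hδ v
    rw [BandLimited, fourier_shannon] at hs
    filter_upwards [hs, hw, Lp.coeFn_sub (latticeFourier δ v) (𝓕 w : L2)] with ξ h1 h2 h3 hξ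
    rw [h3, Pi.sub_apply, h1 hξ, h2 hξ, sub_zero]
  · rw [inner_sub_right, inner_bandWave_latticeFourier hδ, inner_bandWave_fourier hw, hv, sub_self]

/-! ### Stability of sampling and interpolation -/

/-- The symbol of the forward difference quotient. -/
def diffSymbol (δ ξ : ℝ) : ℂ := (δ : ℂ)⁻¹ * (phase δ (-1) ξ - 1)

/-- Here |e^{iθ} - 1| = 2|sin(θ/2)| with |θ/2| ≤ π/2 on the band, so Jordan's inequality bounds the
difference symbol below by 4|ξ|, and π ≤ 4 suffices. On band-limited functions discrete derivatives
thus control true ones. -/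
theorem two_pi_mul_abs_le (hδ : 0 < δ) {ξ : ℝ} (hξ : ξ ∈ band δ) :
    2 * Real.pi * |ξ| ≤ 2 * ‖diffSymbol δ ξ‖ := by
  have hxi : |ξ| ≤ 1 / (2 * δ) := abs_le.2 hξ
  have hpi := Real.pi_pos
  have h1 : ‖phase δ (-1) ξ - 1‖ = 2 * |Real.sin (Real.pi * δ * ξ)| := by
    have : phase δ (-1) ξ = Complex.exp (Complex.I * ((2 * Real.pi * δ * ξ : ℝ) : ℂ)) := by
      unfold phase; congr 1; push_cast; ring
    rw [this, Complex.norm_exp_I_mul_ofReal_sub_one, Real.norm_eq_abs, abs_mul, abs_two]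
    congr 3
    ring
  have habs : |Real.pi * δ * ξ| = Real.pi * δ * |ξ| := by
    rw [abs_mul, abs_of_pos (by positivity)]
  have h2 := Real.mul_abs_le_abs_sin (x := Real.pi * δ * ξ) (by
    rw [habs]
    calc Real.pi * δ * |ξ| ≤ Real.pi * δ * (1 / (2 * δ)) := by gcongr
      _ = Real.pi / 2 := by field_simp)
  rw [habs] at h2
  have h3 : 2 / Real.pi * (Real.pi * δ * |ξ|) = 2 * δ * |ξ| := by field_simp
  rw [h3] at h2
  unfold diffSymbol
  rw [norm_mul, h1, norm_inv, Complex.norm_real, Real.norm_of_nonneg hδ.le]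
  calc 2 * Real.pi * |ξ| ≤ 8 * |ξ| := by nlinarith [Real.pi_le_four, abs_nonneg ξ]
    _ = 2 * (δ⁻¹ * (2 * (2 * δ * |ξ|))) := by field_simp; ring
    _ ≤ _ := by gcongr

theorem latticeFourier_smul (hδ : 0 < δ) (a : ℂ) (v : Lattice) :
    latticeFourier δ (a • v) = a • latticeFourier δ v := by
  simp only [latticeFourier_eq hδ, map_smul]
  rw [smul_comm]

theorem exists_lattice_iterate_diffQuot (hδ : 0 < δ) {f : ℝ → C2} {v : Lattice}
    (hv : ∀ n : ℤ, v n = f (δ * n)) (j : ℕ) :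
    ∃ v' : Lattice, (∀ n : ℤ, v' n = (NLQW.diffQuot δ)^[j] f (δ * n)) ∧
      (latticeFourier δ v' : ℝ → C2) =ᵐ[volume] fun ξ => diffSymbol δ ξ ^ j • latticeFourier δ v ξ := by
  induction j with
  | zero => exact ⟨v, hv, by simp⟩
  | succ j ih =>
    obtain ⟨v', hv', hF⟩ := ih
    have hT : Memℓp (fun n => v' (n - (-1))) 2 := memℓp_comp (lp.memℓp v') (Equiv.subRight (-1))
    refine ⟨(δ : ℂ)⁻¹ • ((⟨fun n => v' (n - (-1)), hT⟩ : Lattice) - v'), fun n => ?_, ?_⟩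
    · change (δ : ℂ)⁻¹ • (v' (n - (-1)) - v' n) = _
      rw [Function.iterate_succ_apply', NLQW.diffQuot, hv', hv', ← Complex.ofReal_inv,
        Complex.coe_smul]
      congr 3
      push_cast
      ring_nf
    · rw [latticeFourier_smul hδ, latticeFourier_sub hδ]
      filter_upwards [hF, latticeFourier_translate hδ (-1) (v := v')
        (v' := ⟨fun n => v' (n - (-1)), hT⟩) (fun n => rfl),
        Lp.coeFn_smul (δ : ℂ)⁻¹ (latticeFourier δ (⟨fun n => v' (n - (-1)), hT⟩ : Lattice)
          - latticeFourier δ v'),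
        Lp.coeFn_sub (latticeFourier δ (⟨fun n => v' (n - (-1)), hT⟩ : Lattice))
          (latticeFourier δ v')] with ξ h1 h2 h3 h4
      rw [h3, Pi.smul_apply, h4, Pi.sub_apply, h2, h1, pow_succ, diffSymbol]
      module

theorem L2_norm_le_of_ae_le {f g h : L2} {a b : ℝ} (ha : 0 ≤ a) (hb : 0 ≤ b)
    (hle : ∀ᵐ ξ, ‖f ξ‖ ≤ a * ‖g ξ‖ + b * ‖h ξ‖) : ‖f‖ ≤ a * ‖g‖ + b * ‖h‖ := by
  have h1 : eLpNorm f 2 volume ≤ eLpNorm (fun ξ => a * ‖g ξ‖ + b * ‖h ξ‖) 2 volume := by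
    refine eLpNorm_mono_ae ?_
    filter_upwards [hle] with ξ hξ
    rwa [Real.norm_of_nonneg (by positivity)]
  have h2 := h1.trans (eLpNorm_add_le ((Lp.aestronglyMeasurable g).norm.const_mul a)
    ((Lp.aestronglyMeasurable h).norm.const_mul b) (by norm_num))
  have h3 : ∀ (c : ℝ) (f : L2), 0 ≤ c →
      eLpNorm (fun ξ => c * ‖f ξ‖) 2 volume = ENNReal.ofReal (c * ‖f‖) := fun c f hc => by
    have := eLpNorm_const_smul c (fun ξ => ‖f ξ‖) 2 (volume : Measure ℝ)
    rw [eLpNorm_norm] at this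
    rw [ENNReal.ofReal_mul hc, Lp.norm_def, ENNReal.ofReal_toReal (Lp.eLpNorm_ne_top f),
      ← Real.enorm_of_nonneg hc]
    exact this
  rw [h3 a g ha, h3 b h hb, ← ENNReal.ofReal_add (by positivity) (by positivity)] at h2
  rw [Lp.norm_def]
  exact ENNReal.toReal_le_of_le_ofReal (by positivity) h2

/-- Interpolation of samples is bounded in the Sobolev norms of positive order. -/
theorem SobolevBound.sobolevLE_shannon {k : ℕ} (hδ : 0 < δ) (hδ1 : δ ≤ 1) {f : ℝ → C2}
    (hf : ContDiff ℝ ∞ f) {r : ℝ≥0} (h : SobolevBound (k + 1) r f) {v : Lattice}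
    (hv : ∀ n : ℤ, v n = f (δ * n)) :
    SobolevLE (k + 1) (3 * 4 ^ (k + 1) * r) (shannon δ v) := fun N => by
  obtain ⟨v', hv', hF⟩ := exists_lattice_iterate_diffQuot hδ hv (k + 1)
  have n0 : ‖latticeFourier δ v‖ ≤ 2 * r := by
    obtain ⟨u, hu, hn⟩ := exists_lattice_of_tsum_le hδ
      (tsum_enorm_sample_sq_le hf hδ hδ1 (h.mono (by omega) le_rfl))
    have : u = v := by
      ext1
      funext n
      rw [hu, hv]
    rw [norm_latticeFourier hδ, ← this]
    exact_mod_cast hn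
  have n1 : ‖latticeFourier δ v'‖ ≤ r := by
    -- Only k of the k + 1 quotients are taken in the Sobolev scale. One derivative is left over,
    -- and it pays for sampling the last quotient.
    obtain ⟨hg, hg'⟩ := iterate_diffQuot_spec (k := 1) hf hδ k (by rwa [add_comm])
    obtain ⟨u, hu, hn⟩ := exists_lattice_of_tsum_le hδ (tsum_enorm_sample_diffQuot_sq_le hg hδ hg')
    have : u = v' := by
      ext1
      funext n
      rw [hu, hv', Function.iterate_succ_apply']
    rw [norm_latticeFourier hδ, ← this]
    exact hn
  have hb := bandLimited_shannon hδ v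
  rw [BandLimited, fourier_shannon] at hb
  rw [fourier_shannon]
  -- On the band, with d the modulus of the difference symbol, (1 + 2π|ξ|)^{k+1} ≤ 2^{k+1} + 4^{k+1}
  -- d^{k+1}. The first term sees the samples, the second their iterated difference quotients.
  have hle := L2_norm_le_of_ae_le (f := weightOp (k + 1) N (latticeFourier δ v))
    (g := latticeFourier δ v) (h := latticeFourier δ v') (a := 2 ^ (k + 1)) (b := 4 ^ (k + 1))
    (by positivity) (by positivity) ?_
  · refine hle.trans ?_
    have e1 : (2 : ℝ) ^ (k + 1) ≤ 4 ^ (k + 1) := by gcongr; norm_num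
    have hr := r.coe_nonneg
    have e2 : (2 : ℝ) ^ (k + 1) * ‖latticeFourier δ v‖ ≤ 4 ^ (k + 1) * (2 * r) := by gcongr
    have e3 : (4 : ℝ) ^ (k + 1) * ‖latticeFourier δ v'‖ ≤ 4 ^ (k + 1) * r := by gcongr
    linarith
  · filter_upwards [hF, hb, coeFn_weightOp (k + 1) N (latticeFourier δ v)] with ξ h1 h2 h3
    rw [h3, norm_smul]
    by_cases hξ : ξ ∈ band δ
    · rw [h1, norm_smul, norm_pow, ← mul_assoc, ← add_mul]
      refine mul_le_mul_of_nonneg_right ((norm_truncWeight_le _ _ _).trans ?_) (norm_nonneg _)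
      have h4 := two_pi_mul_abs_le hδ hξ
      set d := ‖diffSymbol δ ξ‖
      have hd : 0 ≤ d := norm_nonneg _
      have h5 : 1 + 2 * Real.pi * |ξ| ≤ 2 * max 1 (2 * d) := by
        have := le_max_left 1 (2 * d)
        have := le_max_right 1 (2 * d)
        linarith
      calc weight (k + 1) ξ ≤ (2 * max 1 (2 * d)) ^ (k + 1) :=
            pow_le_pow_left₀ (by positivity) h5 _
        _ = 2 ^ (k + 1) * (max 1 (2 * d)) ^ (k + 1) := mul_pow _ _ _
        _ ≤ 2 ^ (k + 1) * (1 + (2 * d) ^ (k + 1)) := by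
            gcongr
            rcases max_choice 1 (2 * d) with hm | hm <;> rw [hm]
            · rw [one_pow]; exact le_add_of_nonneg_right (by positivity)
            · exact le_add_of_nonneg_left zero_le_one
        _ = _ := by
            rw [mul_pow 2 d, show (4 : ℝ) = 2 * 2 by norm_num, mul_pow (2 : ℝ) 2]
            ring
    · rw [h2 hξ, norm_zero, mul_zero]
      positivity

end

end NLQW

namespace NLQW

open scoped NNReal

noncomputable section

variable {k : ℕ} {r δ : ℝ} {w : L2}

/-! ### Interpolation -/

/-- The pointwise inverse Fourier transform of `𝓕 w`; for a band-limited `w` it is a smooth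
representative. -/
def smoothRep (w : L2) : ℝ → C2 := 𝓕⁻ ((𝓕 w : L2) : ℝ → C2)

theorem BandLimited.contDiff_smoothRep (hw : BandLimited δ w) : ContDiff ℝ ∞ (smoothRep w) :=
  hw.contDiff_fourierInv

theorem BandLimited.ae_eq_smoothRep (hw : BandLimited δ w) : w =ᵐ[volume] smoothRep w :=
  hw.ae_eq_fourierInv

theorem BandLimited.sobolevBound_smoothRep (hw : BandLimited δ w) {r : ℝ≥0}
    (h : SobolevLE k r w) : SobolevBound k r (smoothRep w) :=
  h.sobolevBound hw.contDiff_smoothRep hw.ae_eq_smoothRep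

theorem SobolevBound.exists_sample {f : ℝ → C2} (hf : ContDiff ℝ ∞ f) {r : ℝ≥0} (hδ : 0 < δ)
    (hδ1 : δ ≤ 1) (h : SobolevBound (k + 1) r f) : ∃ v : Lattice, ∀ n : ℤ, v n = f (δ * n) := by
  obtain ⟨v, hv, -⟩ := exists_lattice_of_tsum_le hδ
    (tsum_enorm_sample_sq_le hf hδ hδ1 (h.mono (by omega) le_rfl))
  exact ⟨v, hv⟩

/-- The interpolant takes the prescribed values on the lattice. -/
theorem smoothRep_shannon (hδ : 0 < δ) (v : Lattice) (n : ℤ) :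
    smoothRep (shannon δ v) (δ * n) = v n := by
  refine ext_inner_left ℂ fun c => ?_
  have h1 := inner_bandWave_latticeFourier hδ n c v
  rw [← fourier_shannon, inner_bandWave_fourier (bandLimited_shannon hδ v)] at h1
  exact mul_left_cancel₀ (by exact_mod_cast hδ.ne') h1

theorem shannon_add_smul (hδ : 0 < δ) (c : ℂ) (v v' : Lattice) :
    shannon δ (v + c • v') = shannon δ v + c • shannon δ v' := by
  refine fourier_injective ?_
  have h : v + c • v' = v - (-c) • v' := by rw [neg_smul, sub_neg_eq_add]
  simp only [FourierTransform.fourier_add, FourierTransform.fourier_smul, fourier_shannon]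
  rw [h, latticeFourier_sub hδ, latticeFourier_smul hδ, neg_smul, sub_neg_eq_add]

/-- A band-limited function of positive regularity is the interpolant of its samples. -/
theorem BandLimited.exists_shannon_eq (hδ : 0 < δ) (hδ1 : δ ≤ 1) (hw : BandLimited δ w)
    (h : SobolevLE (k + 1) r w) : ∃ v : Lattice, shannon δ v = w := by
  lift r to ℝ≥0 using h.nonneg
  obtain ⟨v, hv⟩ := (hw.sobolevBound_smoothRep h).exists_sample hw.contDiff_smoothRep hδ hδ1
  exact ⟨v, hw.shannon_sample hδ hv⟩

/-- The interpolation error is of first order. -/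
theorem SobolevBound.sobolevLE_shannon_sub (hδ : 0 < δ) (hδ1 : δ ≤ 1) {f : ℝ → C2}
    (hf : ContDiff ℝ ∞ f) {r : ℝ≥0} (h : SobolevBound (k + 2) r f) (hw : w =ᵐ[volume] f)
    {v : Lattice} (hv : ∀ n : ℤ, v n = f (δ * n)) :
    SobolevLE (k + 1) (δ * ((3 * 4 ^ (k + 1) + 1) * 2 ^ (k + 2) * r)) (shannon δ v - w) := by
  have hS := h.sobolevLE hf hw
  -- The part b is reproduced exactly by its samples, and w - b is O(δ) at order k + 1. Hence the
  -- error is the interpolant of w - b minus w - b, and both are O(δ).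
  set b := bandLimit δ w with hb
  have hbl : BandLimited δ b := bandLimited_bandLimit δ w
  have herr : SobolevLE (k + 1) (δ * (2 ^ (k + 2) * r)) (w - b) := hS.sub_bandLimit hδ
  obtain ⟨vb, hvb⟩ := hbl.exists_shannon_eq hδ hδ1 (hS.bandLimit δ)
  have hvb' : ∀ n : ℤ, vb n = smoothRep b (δ * n) := fun n => by
    rw [← hvb, smoothRep_shannon hδ]
  have hd : (w - b : L2) =ᵐ[volume] fun x => f x - smoothRep b x := by
    filter_upwards [Lp.coeFn_sub w b, hw, hbl.ae_eq_smoothRep] with x h1 h2 h3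
    rw [h1, Pi.sub_apply, h2, h3]
  have hsm : ContDiff ℝ ∞ (fun x => f x - smoothRep b x) := hf.sub hbl.contDiff_smoothRep
  have hρ : (δ * (2 ^ (k + 2) * r) : ℝ) = ((δ.toNNReal * (2 ^ (k + 2) * r) : ℝ≥0) : ℝ) := by
    push_cast [Real.coe_toNNReal δ hδ.le]; ring
  have herr' := herr
  rw [hρ] at herr'
  have h1 := (herr'.sobolevBound hsm hd).sobolevLE_shannon hδ hδ1 hsm (v := v - vb) fun n => by
    change v n - vb n = _
    rw [hv, hvb']
  rw [shannon_sub hδ, hvb, ← hρ] at h1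
  have h2 := h1.sub herr
  rw [sub_sub_sub_cancel_right] at h2
  exact (h2.mono (le_of_eq (by ring)))

/-! ### Superposition operators on `L²` -/

/-- The smooth embedding holds for the band-limited parts with one constant and passes to the limit
along an almost everywhere convergent subsequence. -/
theorem SobolevLE.ae_norm_le {ρ : ℝ} (h : SobolevLE (k + 1) ρ w) : ∀ᵐ x, ‖w x‖ ≤ 2 * ρ := by
  lift ρ to ℝ≥0 using h.nonneg
  have hlim := (h.mono_order (show 1 ≤ k + 1 by omega)).tendsto_bandLimit
  obtain ⟨ns, -, hns⟩ := (tendstoInMeasure_of_tendsto_Lp hlim).exists_seq_tendsto_ae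
  have hb : ∀ n : ℕ, ∀ᵐ x, ‖NLQW.bandLimit (1 / ((n : ℝ) + 1)) w x‖ ≤ 2 * ρ := fun n => by
    have hbl := bandLimited_bandLimit (1 / ((n : ℝ) + 1)) w
    filter_upwards [hbl.ae_eq_smoothRep] with x hx
    rw [hx]
    exact_mod_cast norm_le_of_sobolevBound hbl.contDiff_smoothRep
      (hbl.sobolevBound_smoothRep (h.bandLimit _)) x
  filter_upwards [hns, ae_all_iff.2 hb] with x h1 h2
  exact le_of_tendsto h1.norm (Eventually.of_forall fun n => h2 _)

theorem bandLimit_sub (δ : ℝ) (a b : L2) : bandLimit δ (a - b) = bandLimit δ a - bandLimit δ b := by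
  refine fourier_injective (Lp.ext ?_)
  simp only [fourier_sub]
  filter_upwards [fourier_bandLimit δ (a - b), fourier_bandLimit δ a, fourier_bandLimit δ b,
    Lp.coeFn_sub (𝓕 a : L2) (𝓕 b : L2),
    Lp.coeFn_sub (𝓕 (bandLimit δ a) : L2) (𝓕 (bandLimit δ b) : L2)] with ξ h1 h2 h3 h4 h5
  rw [h1, h5, Pi.sub_apply, h2, h3, fourier_sub]
  by_cases hξ : ξ ∈ band δ
  · simp only [Set.indicator_of_mem hξ, h4, Pi.sub_apply]
  · simp only [Set.indicator_of_notMem hξ, sub_zero]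

/-- A smooth function is Lipschitz on bounded sets. -/
theorem exists_lipschitz_bound {E F : Type} [NormedAddCommGroup E] [NormedSpace ℝ E]
    [FiniteDimensional ℝ E] [NormedAddCommGroup F] [NormedSpace ℝ F] [FiniteDimensional ℝ F]
    {H : E → F} (hH : ContDiff ℝ ∞ H) (R : ℝ) :
    ∃ M : ℝ≥0, ∀ x y, ‖x‖ ≤ R → ‖y‖ ≤ R → ‖H x - H y‖ ≤ M * ‖x - y‖ := by
  have : CompleteSpace F := FiniteDimensional.complete ℝ _
  obtain ⟨B, hB, hBeq⟩ := exists_hadamard hH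
  obtain ⟨M, hM⟩ := exists_bound_of_continuous hB.continuous R.toNNReal
  refine ⟨M, fun x y hx hy => ?_⟩
  rw [hBeq]
  refine (B (x, y)).le_of_opNorm_le (hM _ ?_) _
  exact (max_le hx hy).trans (Real.le_coe_toNNReal R)

/-- Superposition with a smooth function is locally Lipschitz in the Sobolev spaces. -/
theorem exists_sobolevLE_superposition_sub {Q : Type} [NormedAddCommGroup Q] [NormedSpace ℝ Q]
    [FiniteDimensional ℝ Q] {H : Q × C2 → C2} (hH : ContDiff ℝ ∞ H) (k : ℕ) (R ρ : ℝ≥0) :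
    ∃ C : ℝ≥0, ∀ (q : ℝ → Q) (a b fa fb : L2) (η : ℝ), ContDiff ℝ ∞ q → CoeffBound (k + 1) R q →
      SobolevLE (k + 1) ρ a → SobolevLE (k + 1) ρ b → SobolevLE (k + 1) η (a - b) →
      (fa =ᵐ[volume] fun x => H (q x, a x)) → (fb =ᵐ[volume] fun x => H (q x, b x)) →
      SobolevLE (k + 1) (C * η) (fa - fb) := by
  obtain ⟨C, hC⟩ := exists_sobolevBound_sub hH (k + 1) (R + 2 * ρ)
  obtain ⟨M, hM⟩ := exists_lipschitz_bound hH (R + 2 * ρ)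
  refine ⟨2 ^ (k + 1) * C, fun q a b fa fb η hq bq ha hb hab hfa hfb => ?_⟩
  lift η to ℝ≥0 using hab.nonneg
  have hcb : ∀ (n : ℕ) {a : L2}, SobolevLE (k + 1) ρ a →
      CoeffBound (k + 1) (R + 2 * ρ) (smoothRep (bandLimit (1 / ((n : ℝ) + 1)) a)) := fun n a ha =>
    ((bandLimited_bandLimit _ a).sobolevBound_smoothRep (ha.bandLimit _)).coeffBound
      (bandLimited_bandLimit _ a).contDiff_smoothRep |>.mono le_rfl le_add_self
  -- Both arguments are replaced by band-limited parts, where the smooth estimate holds with bounds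
  -- independent of n.
  have hap : ∀ n : ℕ, ∃ F : L2, (F =ᵐ[volume] fun x =>
      H (q x, smoothRep (bandLimit (1 / ((n : ℝ) + 1)) a) x)
        - H (q x, smoothRep (bandLimit (1 / ((n : ℝ) + 1)) b) x)) ∧
      SobolevLE (k + 1) (2 ^ (k + 1) * C * η) F := fun n => by
    have bla := bandLimited_bandLimit (1 / ((n : ℝ) + 1)) a
    have blb := bandLimited_bandLimit (1 / ((n : ℝ) + 1)) b
    have hsub : SobolevBound (k + 1) η (fun x => smoothRep (bandLimit (1 / ((n : ℝ) + 1)) a) x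
        - smoothRep (bandLimit (1 / ((n : ℝ) + 1)) b) x) := by
      refine (hab.bandLimit (1 / ((n : ℝ) + 1))).sobolevBound
        (bla.contDiff_smoothRep.sub blb.contDiff_smoothRep) ?_
      rw [bandLimit_sub]
      filter_upwards [Lp.coeFn_sub (bandLimit (1 / ((n : ℝ) + 1)) a)
        (bandLimit (1 / ((n : ℝ) + 1)) b), bla.ae_eq_smoothRep, blb.ae_eq_smoothRep] with x h1 h2 h3
      rw [h1, Pi.sub_apply, h2, h3]
    have h1 := hC q _ _ hq bla.contDiff_smoothRep blb.contDiff_smoothRep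
      (bq.mono le_rfl le_self_add) (hcb n ha) (hcb n hb) η hsub
    have hsm := (hH.comp (hq.prodMk bla.contDiff_smoothRep)).sub
      (hH.comp (hq.prodMk blb.contDiff_smoothRep))
    obtain ⟨F, hF⟩ := exists_toLp_of_sobolevBound hsm h1
    refine ⟨F, hF, (h1.sobolevLE hsm hF).mono (le_of_eq ?_)⟩
    push_cast; ring
  choose F hF hFle using hap
  -- Convergence is needed in L² only, where the pointwise Lipschitz bound gives it; the limit
  -- inherits the Sobolev bound.
  have hlim : Tendsto F atTop (𝓝 (fa - fb)) := by
    have ta := (ha.mono_order (show 1 ≤ k + 1 by omega)).tendsto_bandLimit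
    have tb := (hb.mono_order (show 1 ≤ k + 1 by omega)).tendsto_bandLimit
    rw [tendsto_iff_norm_sub_tendsto_zero] at ta tb ⊢
    have t := (ta.const_mul (M : ℝ)).add (tb.const_mul (M : ℝ))
    simp only [mul_zero, add_zero] at t
    refine squeeze_zero (fun _ => norm_nonneg _) (fun n => ?_) t
    refine L2_norm_le_of_ae_le M.coe_nonneg M.coe_nonneg ?_
    have bla := bandLimited_bandLimit (1 / ((n : ℝ) + 1)) a
    have blb := bandLimited_bandLimit (1 / ((n : ℝ) + 1)) b
    filter_upwards [hF n, hfa, hfb, Lp.coeFn_sub (F n) (fa - fb), Lp.coeFn_sub fa fb,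
      bla.ae_eq_smoothRep, blb.ae_eq_smoothRep, ha.ae_norm_le, hb.ae_norm_le,
      Lp.coeFn_sub (bandLimit (1 / ((n : ℝ) + 1)) a) a,
      Lp.coeFn_sub (bandLimit (1 / ((n : ℝ) + 1)) b) b] with x h1 h2 h3 h4 h5 h6 h7 h8 h9 h10 h11
    rw [h4, Pi.sub_apply, h1, h5, Pi.sub_apply, h2, h3, h10, Pi.sub_apply, h11, Pi.sub_apply, h6, h7]
    have key : ∀ {y z : C2}, ‖y‖ ≤ R + 2 * ρ → ‖z‖ ≤ 2 * ρ →
        ‖H (q x, y) - H (q x, z)‖ ≤ M * ‖y - z‖ := fun {y z} hy hz => by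
      have hqx : ‖q x‖ ≤ R + 2 * ρ := (bq.1 x).trans (by simp)
      refine (hM (q x, y) (q x, z) (max_le hqx hy) (max_le hqx (hz.trans (by simp)))).trans ?_
      simp [Prod.norm_def]
    refine le_trans (le_of_eq ?_) ((norm_sub_le _ _).trans (add_le_add
      (key (by exact_mod_cast (hcb n ha).1 x) h8) (key (by exact_mod_cast (hcb n hb).1 x) h9)))
    congr 1
    abel
  exact SobolevLE.of_tendsto (fun n => by simpa using hFle n) hlim

end

end NLQW

namespace NLQW

open scoped NNReal

noncomputable section

/-! ### The generator of the walk -/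

/-- The action of matrices as an algebra homomorphism. -/
abbrev matCLM (M : Mat2) : C2 →L[ℂ] C2 := Matrix.toEuclideanCLM (n := Fin 2) (𝕜 := ℂ) M

theorem matCLM_expI (t : ℝ) (M : Mat2) :
    matCLM (expI t M) = NormedSpace.exp ((t : ℂ) • ((-Complex.I) • matCLM M)) := by
  let : NormedRing Mat2 := Matrix.linftyOpNormedRing
  let : NormedAlgebra ℂ Mat2 := Matrix.linftyOpNormedAlgebra
  let : NormedAlgebra ℚ Mat2 := NormedAlgebra.restrictScalars ℚ ℂ Mat2
  have hc : Continuous (Matrix.toEuclideanCLM (n := Fin 2) (𝕜 := ℂ)) :=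
    LinearMap.continuous_of_finiteDimensional
      (Matrix.toEuclideanCLM (n := Fin 2) (𝕜 := ℂ)).toAlgEquiv.toLinearMap
  have h := NormedSpace.map_exp (Matrix.toEuclideanCLM (n := Fin 2) (𝕜 := ℂ)) hc
    ((-(Complex.I * (t : ℂ))) • M)
  refine Eq.trans h ?_
  rw [map_smul, smul_smul]
  congr 2
  ring

theorem contDiff_exp_clm :
    ContDiff ℝ ∞ (NormedSpace.exp : (C2 →L[ℂ] C2) → (C2 →L[ℂ] C2)) := by
  have h : ContDiff ℂ ∞ (NormedSpace.exp : (C2 →L[ℂ] C2) → (C2 →L[ℂ] C2)) :=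
    contDiff_iff_contDiffAt.2 fun x => (NormedSpace.exp_analytic x).contDiffAt
  exact h.restrict_scalars ℝ

theorem exp_zero_smul_apply (A : C2 →L[ℂ] C2) (z : C2) : NormedSpace.exp ((0 : ℂ) • A) z = z := by
  have h : (0 : ℂ) • A = 0 := by ext z; simp
  have h' : NormedSpace.exp ((0 : ℂ) • A) = ContinuousLinearMap.id ℂ C2 := by
    rw [h]
    exact NormedSpace.exp_zero
  rw [h']
  rfl

theorem matCLM_pauliComb (q : EuclideanSpace ℝ (Fin 4)) :
    matCLM (pauliComb q) = ∑ α, (q α : ℂ) • matCLM (pauli α) := by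
  simp only [matCLM, pauliComb, map_sum, map_smul]

theorem contDiff_quad (γ : Mat2) : ContDiff ℝ ∞ (quad γ) := by
  refine Complex.reCLM.contDiff.comp (f := fun z : C2 => ∑ j, z j * star (act γ z j))
    (ContDiff.sum fun j _ => ?_)
  have h1 : ContDiff ℝ ∞ fun z : C2 => z j :=
    ((EuclideanSpace.proj j : C2 →L[ℂ] ℂ).restrictScalars ℝ).contDiff
  have h2 : ContDiff ℝ ∞ fun z : C2 => star (act γ z j) :=
    Complex.conjCLE.contDiff.comp
      (((EuclideanSpace.proj j : C2 →L[ℂ] ℂ).restrictScalars ℝ).contDiff.comp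
        ((matCLM γ).restrictScalars ℝ).contDiff)
  exact h1.mul h2

/-- One step of the walk at a site, without the shift. -/
def localStep (γ : Mat2) (g : ℝ → ℝ) (y : (ℝ × EuclideanSpace ℝ (Fin 4)) × C2) : C2 :=
  act (expI y.1.1 (pauliComb y.1.2)) (act (expI y.1.1 ((g (quad γ y.2) : ℂ) • γ)) y.2)

theorem localStep_eq (γ : Mat2) (g : ℝ → ℝ) (y : (ℝ × EuclideanSpace ℝ (Fin 4)) × C2) :
    localStep γ g y =
      NormedSpace.exp ((y.1.1 : ℂ) • ((-Complex.I) • matCLM (pauliComb y.1.2)))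
        (NormedSpace.exp ((y.1.1 : ℂ) • ((-Complex.I) • ((g (quad γ y.2) : ℂ) • matCLM γ))) y.2) := by
  change matCLM _ (matCLM _ y.2) = _
  rw [matCLM_expI, matCLM_expI]
  simp only [matCLM, map_smul]

theorem contDiff_localStep (γ : Mat2) {g : ℝ → ℝ} (hg : ContDiff ℝ ∞ g) :
    ContDiff ℝ ∞ (localStep γ g) := by
  rw [funext (localStep_eq γ g)]
  simp only [matCLM_pauliComb]
  have hq : ∀ α, ContDiff ℝ ∞ fun y : (ℝ × EuclideanSpace ℝ (Fin 4)) × C2 => (y.1.2 α : ℂ) := fun α =>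
    Complex.ofRealCLM.contDiff.comp <| (EuclideanSpace.proj α : EuclideanSpace ℝ (Fin 4) →L[ℝ] ℝ).contDiff.comp
      (contDiff_snd.comp contDiff_fst)
  have happ : ∀ {A : (ℝ × EuclideanSpace ℝ (Fin 4)) × C2 → (C2 →L[ℂ] C2)}
      {z : (ℝ × EuclideanSpace ℝ (Fin 4)) × C2 → C2}, ContDiff ℝ ∞ A → ContDiff ℝ ∞ z →
      ContDiff ℝ ∞ fun y => A y (z y) := fun {A z} hA hz =>
    ((ContinuousLinearMap.restrictScalarsL ℂ C2 C2 ℝ ℝ).contDiff.comp hA).clm_apply hz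
  have hgq : ContDiff ℝ ∞ fun y : (ℝ × EuclideanSpace ℝ (Fin 4)) × C2 => (g (quad γ y.2) : ℂ) :=
    Complex.ofRealCLM.contDiff.comp <| hg.comp ((contDiff_quad γ).comp contDiff_snd)
  have ht : ContDiff ℝ ∞ fun y : (ℝ × EuclideanSpace ℝ (Fin 4)) × C2 => (y.1.1 : ℂ) :=
    Complex.ofRealCLM.contDiff.comp <| contDiff_fst.comp contDiff_fst
  have hsm : ∀ {c : (ℝ × EuclideanSpace ℝ (Fin 4)) × C2 → ℂ}
      {A : (ℝ × EuclideanSpace ℝ (Fin 4)) × C2 → (C2 →L[ℂ] C2)}, ContDiff ℝ ∞ c → ContDiff ℝ ∞ A →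
      ContDiff ℝ ∞ fun y => c y • A y := fun hc hA => hc.smul hA
  exact happ (contDiff_exp_clm.comp (hsm ht (hsm contDiff_const
    (ContDiff.sum fun α _ => hsm (hq α) contDiff_const)))) (happ (contDiff_exp_clm.comp
      (hsm ht (hsm contDiff_const (hsm hgq contDiff_const)))) contDiff_snd)

/-- Division by a scalar parameter. -/
theorem exists_smooth_quotient {P Z F : Type} [NormedAddCommGroup P] [NormedSpace ℝ P]
    [FiniteDimensional ℝ P] [NormedAddCommGroup Z] [NormedSpace ℝ Z] [FiniteDimensional ℝ Z]
    [NormedAddCommGroup F] [NormedSpace ℝ F] [CompleteSpace F] {H : (ℝ × P) × Z → F}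
    (hH : ContDiff ℝ ∞ H) (hH0 : ∀ q, H (q, 0) = 0) :
    ∃ K : (ℝ × P) × Z → F, ContDiff ℝ ∞ K ∧ (∀ q, K (q, 0) = 0) ∧
      ∀ t q z, H ((t, q), z) = H ((0, q), z) + t • K ((t, q), z) := by
  obtain ⟨B, hB, hBeq⟩ := exists_hadamard hH
  set K : (ℝ × P) × Z → F := fun y => B (y, ((0, y.1.2), y.2)) ((1, 0), 0) with hK
  have hKs : ContDiff ℝ ∞ K := (hB.comp (by fun_prop)).clm_apply contDiff_const
  have hKeq : ∀ t q z, H ((t, q), z) = H ((0, q), z) + t • K ((t, q), z) := fun t q z => by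
    rw [← sub_eq_iff_eq_add', hBeq, hK, ← map_smul]
    simp
  -- The quotient from Hadamard's lemma need not vanish at z = 0. Subtracting its value there is
  -- harmless, because t K((t, q), 0) = H((t, q), 0) - H((0, q), 0) = 0.
  refine ⟨fun y => K y - K (y.1, 0), hKs.sub (hKs.comp (by fun_prop)), fun q => sub_self _,
    fun t q z => ?_⟩
  have h0 := hKeq t q 0
  rw [hH0, hH0, zero_add] at h0
  rw [smul_sub, ← h0, sub_zero, ← hKeq]

theorem hasDerivAt_exp_apply (A : C2 →L[ℂ] C2) {z : ℝ → C2} {z' : C2} (hz : HasDerivAt z z' 0) :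
    HasDerivAt (fun t : ℝ => NormedSpace.exp ((t : ℂ) • A) (z t)) (A (z 0) + z') 0 := by
  have h1 := (hasDerivAt_exp_smul_const' (𝕂 := ℂ) A ((0 : ℝ) : ℂ)).scomp (0 : ℝ)
    Complex.ofRealCLM.hasDerivAt
  have h2 := ((ContinuousLinearMap.restrictScalarsL ℂ C2 C2 ℝ ℝ).hasFDerivAt.comp_hasDerivAt
    (0 : ℝ) h1).clm_apply hz
  refine h2.congr_deriv ?_
  change ((1 : ℂ) • (A * NormedSpace.exp (((0 : ℝ) : ℂ) • A))) (z 0)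
    + NormedSpace.exp (((0 : ℝ) : ℂ) • A) z' = _
  rw [_root_.smul_apply, one_smul, Complex.ofReal_zero, exp_zero_smul_apply]
  change A (NormedSpace.exp ((0 : ℂ) • A) (z 0)) + z' = _
  rw [exp_zero_smul_apply]

/-- The local step is `z + δ K` with a smooth `K` that deviates from the Dirac nonlinearity by
`δ K'`. -/
structure IsGenerator (γ : Mat2) (g : ℝ → ℝ)
    (K K' : (ℝ × EuclideanSpace ℝ (Fin 4)) × C2 → C2) : Prop where
  smooth : ContDiff ℝ ∞ K
  smooth' : ContDiff ℝ ∞ K'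
  zero : ∀ q, K (q, 0) = 0
  zero' : ∀ q, K' (q, 0) = 0
  step : ∀ t q z, localStep γ g ((t, q), z) = z + t • K ((t, q), z)
  expand : ∀ t q z, K ((t, q), z) = K ((0, q), z) + t • K' ((t, q), z)
  dirac : ∀ q z, Complex.I • K ((0, q), z) = act (pauliComb q) z + (g (quad γ z) : ℂ) • act γ z

/-- At t = 0 both coins are the identity, so dividing by t gives K and dividing once more gives K'.
Differentiating the two exponentials at t = 0 identifies K there: to first order the generators
simply add, whether or not they commute. -/
theorem exists_isGenerator (γ : Mat2) {g : ℝ → ℝ} (hg : ContDiff ℝ ∞ g) :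
    ∃ K K', IsGenerator γ g K K' := by
  have hact0 : ∀ M, act M 0 = 0 := fun M => map_zero (matCLM M)
  obtain ⟨K, hK, hK0, hKeq⟩ := exists_smooth_quotient (contDiff_localStep γ hg)
    (fun q => by simp only [localStep, hact0])
  obtain ⟨K', hK', hK0', hKeq'⟩ := exists_smooth_quotient hK hK0
  have hzero : ∀ q z, localStep γ g ((0, q), z) = z := fun q z => by
    rw [localStep_eq]
    simp only [Complex.ofReal_zero, exp_zero_smul_apply]
  refine ⟨K, K', hK, hK', hK0, hK0', fun t q z => by rw [hKeq, hzero], hKeq', fun q z => ?_⟩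
  have d1 : HasDerivAt (fun t => localStep γ g ((t, q), z)) (K ((0, q), z)) 0 := by
    have hd : Differentiable ℝ fun t : ℝ => K ((t, q), z) :=
      (hK.comp (by fun_prop : ContDiff ℝ ∞ fun t : ℝ => ((t, q), z))).differentiable (by simp)
    have := ((hasDerivAt_id (0 : ℝ)).smul (hd 0).hasDerivAt).const_add z
    refine (this.congr_deriv ?_).congr_of_eventuallyEq (Eventually.of_forall fun t => ?_)
    · simp
    · simp only [hKeq t, hzero]; rfl
  have d2 : HasDerivAt (fun t => localStep γ g ((t, q), z))
      (((-Complex.I) • matCLM (pauliComb q)) z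
        + ((-Complex.I) • ((g (quad γ z) : ℂ) • matCLM γ)) z) 0 := by
    rw [funext fun t => localStep_eq γ g ((t, q), z)]
    have := hasDerivAt_exp_apply ((-Complex.I) • matCLM (pauliComb q))
      (hasDerivAt_exp_apply ((-Complex.I) • ((g (quad γ z) : ℂ) • matCLM γ)) (hasDerivAt_const 0 z))
    refine this.congr_deriv ?_
    rw [Complex.ofReal_zero, exp_zero_smul_apply, add_zero]
  rw [d1.unique d2]
  simp only [_root_.smul_apply, smul_add, smul_smul, mul_neg, neg_mul, ← mul_assoc, Complex.I_mul_I,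
    neg_neg, one_smul, one_mul]
  rfl

/-! ### The coefficient -/

/-- An essential bound of a continuous function holds everywhere, the set where it holds being
closed and dense. The constant t is adjoined so that the step size counts as one more coefficient,
uniformly on [0, 1]. -/
theorem exists_coeffBound {s : ℕ} {p : ℝ → EuclideanSpace ℝ (Fin 4)} (hp : ContDiff ℝ ∞ p)
    (hp_bdd : MemLp p (∞ : ℝ≥0∞) volume)
    (hp_deriv : ∀ j ≤ s, MemLp (iteratedDeriv j (deriv p)) 2 volume) :
    ∃ R : ℝ≥0, ∀ t ∈ Set.Icc (0 : ℝ) 1, CoeffBound (s + 1) R (fun x => (t, p x)) := by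
  obtain ⟨R₀, hR₀⟩ : ∃ R : ℝ≥0, ∀ x, ‖p x‖ ≤ R := by
    have htop : eLpNormEssSup p volume ≠ (∞ : ℝ≥0∞) := by
      simpa [eLpNorm_exponent_top] using hp_bdd.eLpNorm_ne_top
    refine ⟨(eLpNormEssSup p volume).toNNReal, ?_⟩
    have hae : ∀ᵐ x, ‖p x‖ ≤ (eLpNormEssSup p volume).toNNReal := by
      filter_upwards [enorm_ae_le_eLpNormEssSup p volume] with x hx
      rw [← ENNReal.coe_toNNReal htop, enorm_le_coe] at hx
      exact_mod_cast hx
    have hd : Dense {x | ‖p x‖ ≤ (eLpNormEssSup p volume).toNNReal} := Measure.dense_of_ae hae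
    have hcl : IsClosed {x | ‖p x‖ ≤ (eLpNormEssSup p volume).toNNReal} :=
      isClosed_le hp.continuous.norm continuous_const
    intro x
    have := hd.closure_eq ▸ Set.mem_univ x
    rwa [hcl.closure_eq] at this
  set R₁ : ℝ≥0 := ∑ j ∈ Finset.range (s + 1),
    (eLpNorm (iteratedDeriv j (deriv p)) 2 volume).toNNReal with hR₁
  have hpb : CoeffBound (s + 1) (R₀ + R₁) p := by
    refine ⟨fun x => (hR₀ x).trans (by simp), fun j hj => ?_⟩
    rw [iteratedDeriv_succ', ← ENNReal.coe_toNNReal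
      (hp_deriv j (by omega)).eLpNorm_ne_top]
    norm_cast
    refine le_trans ?_ (le_add_self (a := R₁))
    exact Finset.single_le_sum (f := fun j =>
      (eLpNorm (iteratedDeriv j (deriv p)) 2 volume).toNNReal) (fun _ _ => zero_le)
      (Finset.mem_range.2 hj)
  refine ⟨1 + (R₀ + R₁), fun t ht => ?_⟩
  refine ((CoeffBound.const (s + 1) t).mono le_rfl ?_).prodMk contDiff_const hp hpb
  rw [← NNReal.coe_le_coe, coe_nnnorm, Real.norm_of_nonneg ht.1]
  exact ht.2

/-! ### The Dirac equation on the Fourier side -/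

theorem fourier_clm (A : C2 →L[ℂ] C2) {w w' : L2} (h : w' =ᵐ[volume] fun x => A (w x)) :
    ((𝓕 w' : L2) : ℝ → C2) =ᵐ[volume] fun ξ => A ((𝓕 w : L2) ξ) := by
  have key : ∀ (w : L2) (φ : 𝓢(ℝ, ℂ)), ∫ ξ, φ ξ • (𝓕 w : L2) ξ = ∫ x, (𝓕 φ) x • w x := by
    intro w φ
    have := congrArg (fun u : 𝓢'(ℝ, C2) => u φ) (Lp.fourier_toTemperedDistribution_eq w)
    simpa only [TemperedDistribution.fourier_apply, Lp.toTemperedDistribution_apply]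
      using this.symm
  have hloc := fun u : L2 => (Lp.memLp u).locallyIntegrable (by norm_num : (1 : ℝ≥0∞) ≤ 2)
  have hA := coeFn_mulOp (isMultiplier_const A) (𝓕 w)
  refine EventuallyEq.trans (ae_eq_of_schwartz_integral_eq (hloc _) (hloc _) fun φ => ?_) hA
  have hI : ∀ (u : L2) (φ : 𝓢(ℝ, ℂ)), ∫ x, φ x • A (u x) = A (∫ x, φ x • u x) := fun u φ => by
    rw [← A.integral_comp_comm (integrable_smul_of_memLp_two (φ.memLp 2 volume) (Lp.memLp u))]
    simp only [map_smul]
  rw [key]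
  calc ∫ x, (𝓕 φ) x • w' x = ∫ x, (𝓕 φ) x • A (w x) := by
        refine integral_congr_ae ?_
        filter_upwards [h] with x hx
        rw [hx]
    _ = A (∫ ξ, φ ξ • (𝓕 w : L2) ξ) := by rw [hI, key]
    _ = ∫ ξ, φ ξ • A ((𝓕 w : L2) ξ) := (hI _ φ).symm
    _ = _ := by
        refine integral_congr_ae ?_
        filter_upwards [hA] with x hx
        rw [hx]

theorem act_pauli_three (z : C2) : act (pauli 3) z = sigmaThree z := by
  refine C2.ext ?_ ?_ <;>
  simp [act, pauli, sigmaThree, Matrix.mulVec, dotProduct, Fin.sum_univ_two]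

end

end NLQW

namespace NLQW

open scoped NNReal

noncomputable section

variable {k : ℕ} {r δ : ℝ} {γ : Mat2} {g : ℝ → ℝ}
  {K K' : (ℝ × EuclideanSpace ℝ (Fin 4)) × C2 → C2} {p : ℝ → EuclideanSpace ℝ (Fin 4)}

/-! ### One step of the walk -/

/-- Interpolation is linear, so the sitewise form z + δK of the coins survives on interpolants, and
the shift becomes the free group. -/
theorem IsGenerator.shannon_step (hK : IsGenerator γ g K K') (hγ : γ.IsHermitian) (hδ : 0 < δ)
    {a b : Lattice}
    (hb : ∀ n : ℤ, b n = K ((δ, p (δ * n)), smoothRep (shannon δ a) (δ * n))) :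
    shannon δ (shift (coin δ p (nonlinearCoin δ γ hγ g a)))
      = prop δ (shannon δ a + (δ : ℂ) • shannon δ b) := by
  rw [shannon_shift hδ, ← shannon_add_smul hδ]
  congr 2
  ext1
  funext n
  change localStep γ g ((δ, p (δ * n)), a n) = a n + (δ : ℂ) • b n
  rw [hK.step, hb, smoothRep_shannon hδ, Complex.coe_smul]

/-- The increment of one step: it is bounded with a loss that is linear in the highest norm, and
it agrees with the Dirac nonlinearity up to `O(δ)`. -/
theorem IsGenerator.exists_increment (hK : IsGenerator γ g K K') (hp : ContDiff ℝ ∞ p) {R : ℝ≥0}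
    (hR : ∀ t ∈ Set.Icc (0 : ℝ) 1, CoeffBound (k + 2) R (fun x => (t, p x))) (ρ : ℝ≥0) :
    ∃ C : ℝ≥0, ∀ δ : ℝ, 0 < δ → δ ≤ 1 → ∀ (v : L2) (r : ℝ), BandLimited δ v →
      SobolevLE (k + 1) ρ v → SobolevLE (k + 2) r v →
      ∃ (b : Lattice) (h : L2), (∀ n : ℤ, b n = K ((δ, p (δ * n)), smoothRep v (δ * n))) ∧
        (h =ᵐ[volume] fun x => K ((0, p x), v x)) ∧
        SobolevLE (k + 2) (C * (1 + r)) (shannon δ b) ∧ SobolevLE (k + 2) (C * (1 + r)) h ∧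
        SobolevLE (k + 1) (C * δ * (1 + r)) (h - shannon δ b) := by
  obtain ⟨A, hA⟩ := exists_sobolevBound_tame hK.smooth hK.zero (k + 1) (R + 2 * ρ)
  obtain ⟨B, hB⟩ := exists_sobolevBound_of_vanish hK.smooth' hK.zero' (k + 1) (R + 2 * ρ)
  -- The summands serve, in order, the interpolated increment, the increment h, the interpolation
  -- error, and the term δK' between the parameters δ and 0.
  refine ⟨3 * 4 ^ (k + 2) * A + 2 ^ (k + 2) * A + (3 * 4 ^ (k + 1) + 1) * 2 ^ (k + 2) * A
    + 2 ^ (k + 1) * (B * ρ), fun δ hδ hδ1 v r hv hρ hr => ?_⟩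
  lift r to ℝ≥0 using hr.nonneg
  have hφ := hv.contDiff_smoothRep
  have bφ : CoeffBound (k + 1) (R + 2 * ρ) (smoothRep v) :=
    ((hv.sobolevBound_smoothRep hρ).coeffBound hφ).mono le_rfl le_add_self
  have hq : ∀ t : ℝ, ContDiff ℝ ∞ fun x => (t, p x) := fun t => contDiff_const.prodMk hp
  have bq : ∀ t ∈ Set.Icc (0 : ℝ) 1, CoeffBound (k + 2) (R + 2 * ρ) (fun x => (t, p x)) :=
    fun t ht => (hR t ht).mono le_rfl le_self_add
  have m0 : (0 : ℝ) ∈ Set.Icc (0 : ℝ) 1 := ⟨le_rfl, zero_le_one⟩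
  have mδ : δ ∈ Set.Icc (0 : ℝ) 1 := ⟨hδ.le, hδ1⟩
  have s0 : ContDiff ℝ ∞ fun x => K ((0, p x), smoothRep v x) := hK.smooth.comp ((hq 0).prodMk hφ)
  have sδ : ContDiff ℝ ∞ fun x => K ((δ, p x), smoothRep v x) := hK.smooth.comp ((hq δ).prodMk hφ)
  have s' : ContDiff ℝ ∞ fun x => K' ((δ, p x), smoothRep v x) :=
    hK.smooth'.comp ((hq δ).prodMk hφ)
  have b0 := hA _ _ (hq 0) hφ (bq 0 m0) bφ r (hv.sobolevBound_smoothRep hr)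
  have bδ := hA _ _ (hq δ) hφ (bq δ mδ) bφ r (hv.sobolevBound_smoothRep hr)
  have b' := hB _ _ (hq δ) hφ ((bq δ mδ).mono (Nat.le_succ _) le_rfl) bφ ρ
    (hv.sobolevBound_smoothRep hρ)
  obtain ⟨b, hb⟩ := bδ.exists_sample sδ hδ hδ1
  obtain ⟨h, hh⟩ := exists_toLp_of_sobolevBound s0 b0
  obtain ⟨h', hh'⟩ := exists_toLp_of_sobolevBound s' b'
  have hκ : (h + (δ : ℂ) • h' : L2) =ᵐ[volume] fun x => K ((δ, p x), smoothRep v x) := by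
    filter_upwards [Lp.coeFn_add h ((δ : ℂ) • h'), Lp.coeFn_smul (δ : ℂ) h', hh, hh'] with x e1 e2 e3 e4
    rw [e1, Pi.add_apply, e2, Pi.smul_apply, e3, e4, Complex.coe_smul, ← hK.expand]
  have hrnn := r.coe_nonneg
  refine ⟨b, h, hb, ?_, ?_, ?_, ?_⟩
  · filter_upwards [hh, hv.ae_eq_smoothRep] with x e1 e2
    rw [e1, e2]
  · refine (bδ.sobolevLE_shannon hδ hδ1 sδ hb).mono ?_
    push_cast
    rw [← mul_assoc]
    gcongr
    have h1 : (0 : ℝ) ≤ 2 ^ (k + 2) * A := by positivity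
    have h2 : (0 : ℝ) ≤ (3 * 4 ^ (k + 1) + 1) * 2 ^ (k + 2) * A := by positivity
    have h3 : (0 : ℝ) ≤ 2 ^ (k + 1) * (B * ρ) := by positivity
    linarith
  · refine (b0.sobolevLE s0 hh).mono ?_
    push_cast
    rw [← mul_assoc]
    gcongr
    have h1 : (0 : ℝ) ≤ 3 * 4 ^ (k + 2) * A := by positivity
    have h2 : (0 : ℝ) ≤ (3 * 4 ^ (k + 1) + 1) * 2 ^ (k + 2) * A := by positivity
    have h3 : (0 : ℝ) ≤ 2 ^ (k + 1) * (B * ρ) := by positivity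
    linarith
  · have e := ((bδ.sobolevLE_shannon_sub hδ hδ1 sδ hκ hb).add
      ((b'.sobolevLE s' hh').smul (δ : ℂ))).neg
    have heq : -(shannon δ b - (h + (δ : ℂ) • h') + (δ : ℂ) • h') = h - shannon δ b := by abel
    rw [heq, Complex.norm_real, Real.norm_of_nonneg hδ.le] at e
    refine e.mono ?_
    push_cast
    have h1 : (0 : ℝ) ≤ 3 * 4 ^ (k + 2) * A := by positivity
    have h2 : (0 : ℝ) ≤ 2 ^ (k + 2) * A := by positivity
    have h3 : (0 : ℝ) ≤ 2 ^ (k + 1) * (B * ρ) := by positivity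
    calc δ * ((3 * 4 ^ (k + 1) + 1) * 2 ^ (k + 2) * (A * (1 + r))) + δ * (2 ^ (k + 1) * (B * ρ))
        = δ * (((3 * 4 ^ (k + 1) + 1) * 2 ^ (k + 2) * A) * (1 + r)
            + (2 ^ (k + 1) * (B * ρ)) * 1) := by ring
      _ ≤ δ * (((3 * 4 ^ (k + 1) + 1) * 2 ^ (k + 2) * A) * (1 + r)
            + (2 ^ (k + 1) * (B * ρ)) * (1 + r)) := by
          gcongr; linarith
      _ = (0 + 0 + (3 * 4 ^ (k + 1) + 1) * 2 ^ (k + 2) * A + 2 ^ (k + 1) * (B * ρ)) * δ * (1 + r) := by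
          ring
      _ ≤ _ := by gcongr

/-! ### Solutions of the Dirac equation -/

/-- The nonlinear term along a solution. -/
theorem IsDiracSolution.exists_nonlinearity (hK : IsGenerator γ g K K') {T : ℝ} {u₀ : L2}
    {u : ℝ → L2} (hu : IsDiracSolution (k + 1) p γ g T u₀ u) :
    ∃ d h : ℝ → L2, ∀ t ∈ Set.Icc 0 T, HasDerivWithinAt u (d t) (Set.Icc 0 T) t ∧
      (((𝓕 (d t) : L2) : ℝ → C2) =ᵐ[volume] fun ξ =>
        (𝓕 (h t) : L2) ξ - (2 * Real.pi * Complex.I * ξ) • sigmaThree ((𝓕 (u t) : L2) ξ)) ∧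
      (h t =ᵐ[volume] fun x => K ((0, p x), u t x)) := by
  have key : ∀ t, ∃ d h : L2, t ∈ Set.Icc 0 T → HasDerivWithinAt u d (Set.Icc 0 T) t ∧
      (((𝓕 d : L2) : ℝ → C2) =ᵐ[volume] fun ξ =>
        (𝓕 h : L2) ξ - (2 * Real.pi * Complex.I * ξ) • sigmaThree ((𝓕 (u t) : L2) ξ)) ∧
      (h =ᵐ[volume] fun x => K ((0, p x), u t x)) := by
    intro t
    by_cases ht : t ∈ Set.Icc 0 T
    swap
    · exact ⟨0, 0, fun h => absurd h ht⟩
    obtain ⟨d, hd, heq⟩ := hu.eqn t ht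
    obtain ⟨w, hw, -⟩ := hu.mem t ht
    rw [hw.weakDeriv_eq] at heq
    -- The nonlinear term is recovered as ∂ₜu + σ₃∂ₓu, so it lies in L² without any estimate on g.
    set σ := mulOp (fun _ => sigmaThree) (isMultiplier_const sigmaThree) w with hσ
    have hσw : σ =ᵐ[volume] fun x => sigmaThree (w x) := coeFn_mulOp _ _
    refine ⟨d, d + σ, fun _ => ⟨hd, ?_, ?_⟩⟩
    · rw [FourierTransform.fourier_add]
      filter_upwards [Lp.coeFn_add (𝓕 d : L2) (𝓕 σ : L2), fourier_clm sigmaThree hσw,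
        isWeakDeriv_iff.1 hw] with ξ h1 h2 h3
      rw [h1, Pi.add_apply, h2, h3, map_smul, add_sub_cancel_right]
    · filter_upwards [Lp.coeFn_add d σ, hσw, heq] with x h1 h2 h3
      rw [act_pauli_three, add_assoc, ← hK.dirac] at h3
      rw [h1, Pi.add_apply, h2]
      refine smul_right_injective C2 Complex.I_ne_zero ?_
      simp only [smul_add, h3]
      abel
  choose d h hdh using key
  exact ⟨d, h, hdh⟩

/-- The error of one step. -/
theorem IsGenerator.exists_step_error (hK : IsGenerator γ g K K') (hp : ContDiff ℝ ∞ p) {R : ℝ≥0}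
    (hR : ∀ t ∈ Set.Icc (0 : ℝ) 1, CoeffBound (k + 2) R (fun x => (t, p x)))
    (hγ : γ.IsHermitian) (ρ : ℝ≥0) :
    ∃ C : ℝ≥0, ∀ (T : ℝ) (u₀ : L2) (u : ℝ → L2), IsDiracSolution (k + 1) p γ g T u₀ u →
      (∀ t ∈ Set.Icc 0 T, SobolevLE (k + 1) ρ (u t)) →
      ∀ (δ τ : ℝ) (a : Lattice) (r ε : ℝ), 0 < δ → δ ≤ 1 → 0 ≤ τ → τ + δ ≤ T →
      SobolevLE (k + 1) ρ (shannon δ a) → SobolevLE (k + 2) r (shannon δ a) →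
      SobolevLE (k + 1) ε (u τ - shannon δ a) →
      SobolevLE (k + 2) (r + C * δ * (1 + r))
        (shannon δ (shift (coin δ p (nonlinearCoin δ γ hγ g a)))) ∧
      SobolevLE (k + 1) (ε + C * δ * (ε + δ * (1 + r)))
        (u (τ + δ) - shannon δ (shift (coin δ p (nonlinearCoin δ γ hγ g a)))) := by
  obtain ⟨A, hA⟩ := hK.exists_increment hp hR ρ
  obtain ⟨B, hB⟩ := exists_sobolevLE_superposition_sub hK.smooth k R ρ
  refine ⟨A + (B + B * B * ρ + B + 2 * A), fun T u₀ u hu huρ δ τ a r ε hδ hδ1 hτ hτT haρ har hε => ?_⟩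
  obtain ⟨b, h₀, hb, hh₀, hbr, hh₀r, herr⟩ := hA δ hδ hδ1 _ r (bandLimited_shannon hδ a) haρ har
  obtain ⟨d, h, hdh⟩ := hu.exists_nonlinearity hK
  have hr0 := har.nonneg
  have hε0 := hε.nonneg
  rw [hK.shannon_step hγ hδ hb]
  have hq : ContDiff ℝ ∞ fun x => ((0 : ℝ), p x) := contDiff_const.prodMk hp
  have bq : CoeffBound (k + 1) R (fun x => ((0 : ℝ), p x)) :=
    (hR 0 ⟨le_rfl, zero_le_one⟩).mono (Nat.le_succ _) le_rfl
  have hsub : Set.Icc τ (τ + δ) ⊆ Set.Icc 0 T := Set.Icc_subset_Icc hτ hτT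
  set v := shannon δ a with hv
  have hbound : ∀ t ∈ Set.Icc τ (τ + δ), SobolevLE (k + 1) (B * ρ) (h t) := fun t ht => by
    have ht' := hsub ht
    have := hB (fun x => ((0 : ℝ), p x)) (u t) 0 (h t) 0 ρ hq bq (huρ t ht')
      ((sobolevLE_zero_right (k + 1)).mono ρ.coe_nonneg) (by simpa using huρ t ht')
      (hdh t ht').2.2 (by
        filter_upwards [Lp.coeFn_zero C2 2 (volume : Measure ℝ)] with x hx
        rw [hx, Pi.zero_apply, hK.zero])
    simpa using this
  -- Duhamel's formula with zero reference costs δBρ, the error ε is transported without growth, and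
  -- the free motion of v costs δr. The derivative lost falls on v, not on u.
  have hmove : ∀ t ∈ Set.Icc τ (τ + δ), SobolevLE (k + 1) (δ * (B * ρ) + ε + δ * r) (u t - v) := by
    intro t ht
    have hsub' : Set.Icc τ t ⊆ Set.Icc τ (τ + δ) := Set.Icc_subset_Icc le_rfl ht.2
    have e1 := duhamel_estimate ht.1 (u := u) (d := d) (h := h)
      (fun t' ht' => (hdh t' (hsub (hsub' ht'))).1.mono (hsub'.trans hsub))
      (fun t' ht' => (hdh t' (hsub (hsub' ht'))).2.1) 0
      (fun t' ht' => by simpa using (hbound t' (hsub' ht')).prop (τ - t'))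
    have e2 := ((e1.add hε).prop (t - τ)).add
      ((har.prop_sub_self (t - τ)))
    have heq : prop (t - τ) (prop (τ - t) (u t) - u τ - ((t - τ : ℝ) : ℂ) • (0 : L2) + (u τ - v))
        + (prop (t - τ) v - v) = u t - v := by
      rw [smul_zero, sub_zero, sub_add_sub_cancel, prop_sub, prop_prop, sub_add_sub_cancel]
      simp [prop_zero]
    rw [heq] at e2
    have htd : t - τ ≤ δ := by linarith [ht.2]
    have ht0 : 0 ≤ t - τ := by linarith [ht.1]
    refine e2.mono ?_
    rw [abs_of_nonneg ht0]
    gcongr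
  have hG : ∀ t ∈ Set.Icc τ (τ + δ), SobolevLE (k + 1)
      (B * (δ * (B * ρ) + ε + δ * r) + δ * (A * (1 + r)) + A * δ * (1 + r))
      (prop (τ - t) (h t) - shannon δ b) := by
    intro t ht
    have ht' := hsub ht
    have e1 := (hB _ (u t) v (h t) h₀ _ hq bq (huρ t ht') haρ (hmove t ht) (hdh t ht').2.2
      hh₀).prop (τ - t)
    have e2 := hh₀r.prop_sub_self (τ - t)
    have heq : prop (τ - t) (h t - h₀) + (prop (τ - t) h₀ - h₀) + (h₀ - shannon δ b)
        = prop (τ - t) (h t) - shannon δ b := by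
      rw [prop_sub]; abel
    have e3 := (e1.add e2).add herr
    rw [heq] at e3
    refine e3.mono ?_
    have htd : |τ - t| ≤ δ := abs_le.2 ⟨by linarith [ht.2], by linarith [ht.1]⟩
    gcongr
  constructor
  · have e := (har.add (hbr.smul (δ : ℂ))).prop δ
    rw [Complex.norm_real, Real.norm_of_nonneg hδ.le] at e
    refine e.mono ?_
    push_cast
    have h1 : (0 : ℝ) ≤ (B + B * B * ρ + B + 2 * A) * δ * (1 + r) := by positivity
    nlinarith
  · have e1 := duhamel_estimate (show τ ≤ τ + δ by linarith) (u := u) (d := d) (h := h)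
      (fun t ht => (hdh t (hsub ht)).1.mono hsub) (fun t ht => (hdh t (hsub ht)).2.1)
      (shannon δ b) hG
    have e2 := (e1.add hε).prop δ
    have heq : prop δ (prop (τ - (τ + δ)) (u (τ + δ)) - u τ
        - ((τ + δ - τ : ℝ) : ℂ) • shannon δ b + (u τ - v))
        = u (τ + δ) - prop δ (v + (δ : ℂ) • shannon δ b) := by
      rw [show prop (τ - (τ + δ)) (u (τ + δ)) - u τ - ((τ + δ - τ : ℝ) : ℂ) • shannon δ b
        + (u τ - v) = prop (-δ) (u (τ + δ)) - (v + (δ : ℂ) • shannon δ b) by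
          rw [show τ - (τ + δ) = -δ by ring, show τ + δ - τ = δ by ring]; abel,
        prop_sub, prop_prop, add_neg_cancel, prop_zero]
    rw [heq] at e2
    refine e2.mono ?_
    push_cast
    rw [show τ + δ - τ = δ by ring]
    have h1 : (0 : ℝ) ≤ δ * (B * B * ρ * (δ * r)) := by positivity
    have h2 : (0 : ℝ) ≤ δ * (B * δ) := by positivity
    have h3 : (0 : ℝ) ≤ δ * ((A + B + B * B * ρ + 2 * A) * ε) := by positivity
    have h4 : (0 : ℝ) ≤ δ * ((A + B) * (δ * (1 + r))) := by positivity
    nlinarith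

end

end NLQW

namespace NLQW

open scoped NNReal

noncomputable section

variable {k : ℕ} {γ : Mat2} {g : ℝ → ℝ}
  {K K' : (ℝ × EuclideanSpace ℝ (Fin 4)) × C2 → C2} {p : ℝ → EuclideanSpace ℝ (Fin 4)}

/-! ### Convergence for bounded solutions -/

theorem one_add_mul_pow_le_exp {C δ T : ℝ} (hC : 0 ≤ C) (hδ : 0 ≤ δ) {m : ℕ} (hm : m * δ ≤ T) :
    (1 + C * δ) ^ m ≤ Real.exp (C * T) := by
  calc (1 + C * δ) ^ m ≤ Real.exp (C * δ) ^ m := by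
        gcongr
        linarith [Real.add_one_le_exp (C * δ)]
    _ = Real.exp (C * (m * δ)) := by rw [← Real.exp_nat_mul]; ring_nf
    _ ≤ Real.exp (C * T) := by gcongr

/-- First order convergence, uniformly for solutions that are bounded in `H^{k+1}`. -/
theorem IsGenerator.exists_error_bound (hK : IsGenerator γ g K K') (hp : ContDiff ℝ ∞ p) {R : ℝ≥0}
    (hR : ∀ t ∈ Set.Icc (0 : ℝ) 1, CoeffBound (k + 2) R (fun x => (t, p x)))
    (hγ : γ.IsHermitian) {T : ℝ} (Λ M : ℝ≥0) :
    ∃ C : ℝ, 0 < C ∧ ∃ δ₀ : ℝ, 0 < δ₀ ∧ ∀ (u₀ : L2) (u : ℝ → L2), SobolevLE (k + 2) Λ u₀ →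
      IsDiracSolution (k + 1) p γ g T u₀ u → (∀ t ∈ Set.Icc 0 T, SobolevLE (k + 1) M (u t)) →
      ∀ δ ∈ Set.Ioc (0 : ℝ) δ₀, ∀ m : ℕ, (m : ℝ) * δ ≤ T →
        SobolevLE (k + 1) (C * δ)
          (shannon δ (walk δ p γ hγ g m (shannonInv δ (bandLimit δ u₀))) - u (m * δ)) := by
  -- The extra 1 is room for the error: for δ ≤ 1/C the error stays below 1, so the walk remains in
  -- the ball where B is valid.
  obtain ⟨B, hB⟩ := hK.exists_step_error hp hR hγ (M + 1)
  -- W bounds 1 + r along the walk, since 1 + r is multiplied by 1 + Bδ at each step. The quantity ε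
  -- + δW is then multiplied by the same factor and starts from δ(Λ + W), which gives C.
  set W : ℝ := Real.exp (B * T) * (1 + Λ) with hW
  set C : ℝ := Real.exp (B * T) * (Λ + W) with hC
  have hWpos : 0 < W := by positivity
  have hCpos : 0 < C := by positivity
  refine ⟨C, hCpos, min 1 (1 / C), by positivity, fun u₀ u hu₀ hu huM δ hδ m hm => ?_⟩
  have hδ0 : 0 < δ := hδ.1
  have hδ1 : δ ≤ 1 := hδ.2.trans (min_le_left _ _)
  have hδC : C * δ ≤ 1 := by
    have := hδ.2.trans (min_le_right _ _)
    rwa [le_div_iff₀ hCpos, mul_comm] at this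
  set a : ℕ → Lattice := fun m => walk δ p γ hγ g m (shannonInv δ (bandLimit δ u₀)) with ha
  have ha0 : shannon δ (a 0) = bandLimit δ u₀ := by
    obtain ⟨v, hv⟩ := (bandLimited_bandLimit δ u₀).exists_shannon_eq hδ0 hδ1 (hu₀.bandLimit δ)
    change shannon δ (shannonInv δ (bandLimit δ u₀)) = _
    rw [← hv, shannonInv_shannon hδ0]
  have hasucc : ∀ m, a (m + 1) = shift (coin δ p (nonlinearCoin δ γ hγ g (a m))) := fun m =>
    Function.iterate_succ_apply' _ _ _
  have main : ∀ m : ℕ, (m : ℝ) * δ ≤ T →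
      SobolevLE (k + 2) ((1 + B * δ) ^ m * (1 + Λ) - 1) (shannon δ (a m)) ∧
      SobolevLE (k + 1) ((1 + B * δ) ^ m * (δ * (Λ + W)) - δ * W)
        (u (m * δ) - shannon δ (a m)) := by
    intro m
    induction m with
    | zero =>
      intro _
      rw [ha0]
      refine ⟨by simpa using hu₀.bandLimit δ, ?_⟩
      rw [Nat.cast_zero, zero_mul, hu.initial]
      exact (hu₀.sub_bandLimit hδ0).mono (le_of_eq (by ring))
    | succ m ih =>
      intro hm
      push_cast at hm
      have hm' : (m : ℝ) * δ ≤ T := by nlinarith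
      obtain ⟨hr, hε⟩ := ih hm'
      have hpow : (1 + B * δ) ^ m ≤ Real.exp (B * T) :=
        one_add_mul_pow_le_exp B.coe_nonneg hδ0.le hm'
      have hεC : (1 + B * δ) ^ m * (δ * (Λ + W)) - δ * W ≤ 1 := by
        have : (1 + B * δ) ^ m * (δ * (Λ + W)) ≤ Real.exp (B * T) * (δ * (Λ + W)) := by gcongr
        have h2 : Real.exp (B * T) * (δ * (Λ + W)) = C * δ := by rw [hC]; ring
        have h3 : 0 ≤ δ * W := by positivity
        linarith
      have hmT : (m : ℝ) * δ ∈ Set.Icc 0 T := ⟨by positivity, hm'⟩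
      have hρ : SobolevLE (k + 1) ((M + 1 : ℝ≥0) : ℝ) (shannon δ (a m)) := by
        have := (huM _ hmT).sub hε
        rw [sub_sub_cancel] at this
        refine this.mono ?_
        push_cast
        linarith
      have huM' : ∀ t ∈ Set.Icc 0 T, SobolevLE (k + 1) ((M + 1 : ℝ≥0) : ℝ) (u t) := fun t ht =>
        (huM t ht).mono (by push_cast; linarith)
      obtain ⟨h1, h2⟩ := hB T u₀ u hu huM' δ (m * δ) (a m) _ _ hδ0 hδ1 hmT.1 (by linarith) hρ hr hε
      rw [← hasucc] at h1 h2
      refine ⟨h1.mono (le_of_eq (by ring)), ?_⟩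
      rw [show ((m + 1 : ℕ) : ℝ) * δ = m * δ + δ by push_cast; ring]
      refine h2.mono ?_
      have hW' : (1 + B * δ) ^ m * (1 + Λ) ≤ W := by rw [hW]; gcongr
      have : B * δ * (δ * (1 + ((1 + B * δ) ^ m * (1 + Λ) - 1))) ≤ B * δ * (δ * W) := by
        gcongr; linarith
      calc _ = (1 + B * δ) ^ m * (δ * (Λ + W)) - δ * W
            + B * δ * ((1 + B * δ) ^ m * (δ * (Λ + W)) - δ * W)
            + B * δ * (δ * (1 + ((1 + B * δ) ^ m * (1 + Λ) - 1))) := by ring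
        _ ≤ (1 + B * δ) ^ m * (δ * (Λ + W)) - δ * W
            + B * δ * ((1 + B * δ) ^ m * (δ * (Λ + W)) - δ * W) + B * δ * (δ * W) := by gcongr
        _ = _ := by ring
  have h := (main m hm).2.neg
  rw [neg_sub] at h
  refine h.mono ?_
  have hpow : (1 + B * δ) ^ m ≤ Real.exp (B * T) :=
    one_add_mul_pow_le_exp B.coe_nonneg hδ0.le hm
  have h1 : (1 + B * δ) ^ m * (δ * (Λ + W)) ≤ Real.exp (B * T) * (δ * (Λ + W)) := by gcongr
  have h2 : Real.exp (B * T) * (δ * (Λ + W)) = C * δ := by rw [hC]; ring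
  have h3 : 0 ≤ δ * W := by positivity
  linarith

/-! ### Bounds and uniqueness of solutions -/

theorem MemH.sub {k : ℕ} {u v : L2} (hu : MemH k u) (hv : MemH k v) : MemH k (u - v) :=
  (hu.sobolevLE_normH.sub hv.sobolevLE_normH).memH

/-- Continuity into H^k bounds u near each time, and compactness of [0, T] leaves finitely many such
bounds. -/
theorem IsDiracSolution.exists_bound {T : ℝ} {u₀ : L2} {u : ℝ → L2}
    (hu : IsDiracSolution k p γ g T u₀ u) :
    ∃ M : ℝ≥0, ∀ t ∈ Set.Icc 0 T, SobolevLE k M (u t) := by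
  refine isCompact_Icc.induction_on (p := fun S => ∃ M : ℝ≥0, ∀ t ∈ S ∩ Set.Icc 0 T,
    SobolevLE k M (u t)) ?_ ?_ ?_ ?_ |>.imp fun M hM t ht => hM t ⟨ht, ht⟩
  · exact ⟨0, by simp⟩
  · rintro S S' hS ⟨M, hM⟩
    exact ⟨M, fun t ht => hM t ⟨hS ht.1, ht.2⟩⟩
  · rintro S S' ⟨M, hM⟩ ⟨M', hM'⟩
    refine ⟨M + M', fun t ht => ?_⟩
    rcases ht.1 with h | h
    · exact (hM t ⟨h, ht.2⟩).mono (by simp)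
    · exact (hM' t ⟨h, ht.2⟩).mono (by simp)
  · intro t ht
    have h1 : ∀ᶠ τ in 𝓝[Set.Icc 0 T] t, normH k (u τ - u t) < 1 :=
      (hu.cont t ht).eventually_lt_const zero_lt_one
    refine ⟨_, h1, (2 ^ k * 1 + 2 ^ k * normH k (u t)).toNNReal, fun τ hτ => ?_⟩
    have h2 := ((hu.mem τ hτ.2).sub (hu.mem t ht)).sobolevLE_normH.add (hu.mem t ht).sobolevLE_normH
    rw [sub_add_cancel] at h2
    refine h2.mono (le_trans ?_ (Real.le_coe_toNNReal _))
    have h3 : normH k (u τ - u t) < 1 := hτ.1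
    gcongr

/-- The walk depends only on the initial datum: m steps of size t/m end exactly at t and converge to
both solutions, which therefore coincide. -/
theorem IsDiracSolution.eq_of_mem_Icc (hK : IsGenerator γ g K K') (hp : ContDiff ℝ ∞ p) {R : ℝ≥0}
    (hR : ∀ t ∈ Set.Icc (0 : ℝ) 1, CoeffBound (k + 2) R (fun x => (t, p x)))
    (hγ : γ.IsHermitian) {T : ℝ} {u₀ : L2} {u v : ℝ → L2} (hu₀ : MemH (k + 2) u₀)
    (hu : IsDiracSolution (k + 1) p γ g T u₀ u) (hv : IsDiracSolution (k + 1) p γ g T u₀ v)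
    {t : ℝ} (ht : t ∈ Set.Icc 0 T) : u t = v t := by
  rcases ht.1.eq_or_lt with h0 | h0
  · rw [← h0, hu.initial, hv.initial]
  obtain ⟨M, hM⟩ := hu.exists_bound
  obtain ⟨N, hN⟩ := hv.exists_bound
  have hΛ := hu₀.sobolevLE_normH.mono (Real.le_coe_toNNReal _)
  obtain ⟨C, hC, δ₁, hδ₁, h1⟩ := hK.exists_error_bound hp hR hγ (T := T) _ M
  obtain ⟨D, hD, δ₂, hδ₂, h2⟩ := hK.exists_error_bound hp hR hγ (T := T) _ N
  have key : ∀ᶠ m : ℕ in atTop, ‖u t - v t‖ ≤ (D + C) * (t / m) := by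
    have hlim : Tendsto (fun m : ℕ => t / (m : ℝ)) atTop (𝓝 0) :=
      tendsto_const_div_atTop_nhds_zero_nat t
    filter_upwards [hlim.eventually_lt_const (lt_min hδ₁ hδ₂), eventually_gt_atTop 0] with m hm hm0
    have hm0' : (0 : ℝ) < m := by exact_mod_cast hm0
    have hmt : (m : ℝ) * (t / m) = t := by field_simp
    have hδ : 0 < t / m := by positivity
    have e1 := h1 u₀ u hΛ hu hM (t / m) ⟨hδ, hm.le.trans (min_le_left _ _)⟩ m (by rw [hmt]; exact ht.2)
    have e2 := h2 u₀ v hΛ hv hN (t / m) ⟨hδ, hm.le.trans (min_le_right _ _)⟩ m (by rw [hmt]; exact ht.2)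
    rw [hmt] at e1 e2
    have e3 := (e2.sub e1).norm_le
    rw [sub_sub_sub_cancel_left] at e3
    exact e3.trans (le_of_eq (by ring))
  have hlim : Tendsto (fun m : ℕ => (D + C) * (t / (m : ℝ))) atTop (𝓝 0) := by
    simpa using (tendsto_const_div_atTop_nhds_zero_nat t).const_mul (D + C)
  have := ge_of_tendsto hlim key
  exact sub_eq_zero.1 (norm_le_zero_iff.1 this)

/-- The Lipschitz condition bounds all the solutions with data in the ball. -/
theorem LipCondition.exists_uniform_bound {T L : ℝ} (hL : 0 < L)
    (hLip : LipCondition k p γ g T L) :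
    ∃ M : ℝ≥0, ∀ a, MemH k a → normH k a ≤ L →
      ∃ u, IsDiracSolution k p γ g T a u ∧ ∀ t ∈ Set.Icc 0 T, SobolevLE k M (u t) := by
  obtain ⟨C, hC, U, hU, hUL⟩ := hLip
  have h0 : MemH k (0 : L2) := (sobolevLE_zero_right k).memH
  have h0' : normH k (0 : L2) ≤ L :=
    (sobolevLE_zero_right k).normH_le.trans (by simpa using hL.le)
  -- The solution with zero datum is the reference: only it needs the compactness bound, and every
  -- other one stays within CL of it in H^k.
  obtain ⟨M, hM⟩ := (hU 0 h0 h0').exists_bound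
  refine ⟨M + (2 ^ k * (C * L)).toNNReal, fun a ha haL => ⟨_, hU a ha haL, fun t ht => ?_⟩⟩
  have hl := hUL a 0 ha haL h0 h0' t ht
  rw [sub_zero] at hl
  have h1 := (hM t ht).add
    (((hU a ha haL).mem t ht).sub ((hU 0 h0 h0').mem t ht)).sobolevLE_normH
  rw [add_sub_cancel] at h1
  refine h1.mono ?_
  push_cast
  gcongr
  refine le_trans ?_ (Real.le_coe_toNNReal _)
  have h2 : normH k (U t a - U t 0) ≤ C * L := hl.trans (by gcongr)
  gcongr

theorem MemH.of_succ {k : ℕ} {u : L2} (hu : MemH (k + 1) u) : MemH k u :=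
  (hu.sobolevLE_normH.mono_order (Nat.le_succ k)).memH

theorem normH_le_normH_succ (k : ℕ) (u : L2) : normH k u ≤ normH (k + 1) u := by
  unfold normH
  refine Real.sqrt_le_sqrt (Finset.sum_le_sum_of_subset_of_nonneg ?_ fun _ _ _ => by positivity)
  exact Finset.range_mono (by omega)

end

end NLQW

/-! ### The convergence theorem -/

open NLQW

theorem theorem1 (s : ℕ) (hs : 1 ≤ s) (T L : ℝ) (hT : 0 < T) (hL : 0 < L)
    (p : ℝ → EuclideanSpace ℝ (Fin 4)) (hp : ContDiff ℝ ∞ p)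
    (hp_bdd : MemLp p ∞ volume)
    (hp_deriv : ∀ j ≤ s, MemLp (iteratedDeriv j (deriv p)) 2 volume)
    (γ : Mat2) (hγ : γ.IsHermitian) (g : ℝ → ℝ) (hg : ContDiff ℝ ∞ g)
    (hLip : LipCondition s p γ g T L) :
    ∃ C : ℝ, 0 < C ∧ ∃ δ₀ : ℝ, 0 < δ₀ ∧ ∀ u₀ : L2, MemH (s + 1) u₀ → normH (s + 1) u₀ ≤ L →
      ∀ u : ℝ → L2, IsDiracSolution s p γ g T u₀ u →
        ∀ δ ∈ Set.Ioc (0 : ℝ) δ₀, ∀ m : ℕ, (m : ℝ) * δ ≤ T →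
          MemH s (shannon δ (walk δ p γ hγ g m (shannonInv δ (bandLimit δ u₀))) - u (m * δ)) ∧
          normH s (shannon δ (walk δ p γ hγ g m (shannonInv δ (bandLimit δ u₀))) - u (m * δ))
            ≤ C * δ := by
  obtain ⟨k, rfl⟩ : ∃ k, s = k + 1 := ⟨s - 1, by omega⟩
  obtain ⟨K, K', hK⟩ := exists_isGenerator γ hg
  obtain ⟨R, hR⟩ := exists_coeffBound hp hp_bdd hp_deriv
  obtain ⟨M, hM⟩ := hLip.exists_uniform_bound hL
  -- The factor 2^(k+2) passes from the norm by derivatives to the Fourier weight at order k + 2;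
  -- the factor (k + 1) + 1 in the final constant passes back at order k + 1.
  obtain ⟨C, hC, δ₀, hδ₀, key⟩ := hK.exists_error_bound hp hR hγ (T := T)
    (2 ^ (k + 2) * L).toNNReal M
  refine ⟨((k + 1 : ℕ) + 1) * C, by positivity, δ₀, hδ₀, fun u₀ hu₀ huL u hu δ hδ m hm => ?_⟩
  obtain ⟨v, hv, hvM⟩ := hM u₀ hu₀.of_succ ((normH_le_normH_succ _ _).trans huL)
  -- The solution u is arbitrary, whereas the uniform bound is known for the flow of the Lipschitz
  -- condition; uniqueness transfers it.
  have huM : ∀ t ∈ Set.Icc 0 T, SobolevLE (k + 1) M (u t) := fun t ht => by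
    rw [hu.eq_of_mem_Icc hK hp hR hγ hu₀ hv ht]
    exact hvM t ht
  have hΛ := hu₀.sobolevLE_normH.mono
    ((mul_le_mul_of_nonneg_left huL (by positivity)).trans (Real.le_coe_toNNReal _))
  have h := key u₀ u hΛ hu huM δ hδ m hm
  exact ⟨h.memH, h.normH_le.trans (le_of_eq (by ring))⟩
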